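/- The *arboricity* of a finite simple graph is the minimum number of forests into which its edges can be partitioned. A graph $G$ with $m$ edges is *$\epsilon$-close* to having arboricity at most $a$ if one can remove at most $\epsilon m$ edges from $G$ so that the resulting graph has arboricity at most $a$; otherwise it is *$\epsilon$-far* from having arboricity at most $a$. An algorithm has query access to a graph $G$ on the vertex set $\{0,\dots,n-1\}$ if it can ask, for a vertex $v$, for its degree $d(v)$, and, for a vertex $v$ and an index $i$, for the $i$-th neighbor of $v$ (in an arbitrary fixed order of the neighbors), the answer being a special symbol if $i\notin\{1,\dots,d(v)\}$. Running time is measured on a word RAM with words of $O(\log (n+\alpha+q))$ bits, where $q$ is the denominator of the input parameter $\epsilon$ in lowest terms, with unit-cost word operations, unit-cost queries, and unit-cost sampling of a uniform element of $\{0,\dots,s-1\}$ for a word $s$. **Theorem.** There are a single randomized algorithm and absolute constants $C,k,D$ such that, for every $n$, every simple graph $G$ on $n$ vertices with $m$ edges, every order of the neighbors of its vertices, every integer $\alpha\ge 0$ and every rational $\epsilon$ with $0<\epsilon\le 1/20$, the algorithm, given $n$, $\alpha$, $\epsilon$ and query access to $G$, satisfies the following. 1. If $G$ is $\epsilon$-close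 to having arboricity at most $\alpha$, then the algorithm halts and returns YES with probability at least $2/3$. 2. If $G$ is $20\epsilon$-far from having arboricity at most $3\alpha$, then the algorithm halts and returns NO with probability at least $2/3$. 3. If $m\ge 1$, then the expected number of queries and the expected running time of the algorithm are both at most $$C\,(1+\log n)^k\left(\frac{n}{\sqrt m}\cdot\frac{\log(1/\epsilon)}{\epsilon}+\frac{n\alpha}{m}\cdot\left(\frac1\epsilon\right)^{D\log(1/\epsilon)}\right).$$ -/

import Mathlib

open scoped ENNReal

namespace ArbTest

/-! ### Arboricity and distance -/

section Arboricity

variable {V : Type*}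

/-- The edges of `G` can be partitioned into `k` forests. -/
def HasForestPartition (G : SimpleGraph V) (k : ℕ) : Prop :=
  ∃ F : Fin k → SimpleGraph V,
    (∀ i, (F i).IsAcyclic) ∧ Pairwise (fun i j => Disjoint (F i) (F j)) ∧ ⨆ i, F i = G

/-- The arboricity of a (finite) graph: the minimum number of forests into which its edges can be
partitioned. -/
noncomputable def arboricity (G : SimpleGraph V) : ℕ :=
  sInf {k : ℕ | HasForestPartition G k}

/-- `G` is `ε`-close to having arboricity at most `a`: removing at most `ε * m` of its `m` edges
yields a graph of arboricity at most `a`. -/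
def IsCloseToArboricity (G : SimpleGraph V) (ε : ℝ) (a : ℕ) : Prop :=
  ∃ H : SimpleGraph V, H ≤ G ∧ arboricity H ≤ a ∧
    ((G.edgeSet \ H.edgeSet).ncard : ℝ) ≤ ε * (G.edgeSet.ncard : ℝ)

/-- `G` is `ε`-far from having arboricity at most `a`: more than `ε * m` edges have to be removed
to obtain a graph of arboricity at most `a`. -/
def IsFarFromArboricity (G : SimpleGraph V) (ε : ℝ) (a : ℕ) : Prop :=
  ¬ IsCloseToArboricity G ε a

end Arboricity

/-! ### Query access -/

/-- An ordering of the neighbours of every vertex of a graph with vertex set `{0, …, n-1}`. -/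
structure AdjList {n : ℕ} (G : SimpleGraph (Fin n)) where
  list : Fin n → List (Fin n)
  nodup : ∀ v, (list v).Nodup
  mem_iff : ∀ v u, u ∈ list v ↔ G.Adj v u

/-- The answer to the degree query `v` (and `0` if `v` is not a vertex). -/
def AdjList.degreeQuery {n : ℕ} {G : SimpleGraph (Fin n)} (L : AdjList G) (v : ℕ) : ℕ :=
  if h : v < n then (L.list ⟨v, h⟩).length else 0

/-- The answer to the neighbour query `(v, i)`: the `i`-th neighbour of `v` for
`1 ≤ i ≤ d(v)`. In all other cases it is the special symbol, for which we take the number `n`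
(vertices are the numbers `0, …, n-1`). -/
def AdjList.neighborQuery {n : ℕ} {G : SimpleGraph (Fin n)} (L : AdjList G) (v i : ℕ) : ℕ :=
  if h : v < n then
    if 1 ≤ i then ((L.list ⟨v, h⟩)[i - 1]?.map Fin.val).getD n else n
  else n

/-! ### Randomized word RAM programs with query access to a graph

A machine has registers and a random access memory, all of whose cells hold words of `w` bits.
Arithmetic is modulo `2 ^ w`. -/

/-- The word operations. -/
inductive Op where
  | add | sub | mul | div | mod | lt | eq

/-- `sub` is truncated subtraction, `div` the rounded down quotient, and the comparisons
return `1` for true and `0` for false. -/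
def Op.eval : Op → ℕ → ℕ → ℕ
  | .add, a, b => a + b
  | .sub, a, b => a - b
  | .mul, a, b => a * b
  | .div, a, b => a / b
  | .mod, a, b => a % b
  | .lt, a, b => if a < b then 1 else 0
  | .eq, a, b => if a = b then 1 else 0

/-- Expressions: constants, registers, memory cells (indirect addressing), and operations. -/
inductive Expr where
  | const (c : ℕ)
  | reg (x : ℕ)
  | mem (addr : Expr)
  | op (o : Op) (a b : Expr)

/-- Number of elementary operations in the evaluation of an expression. -/
def Expr.cost : Expr → ℕ
  | .const _ => 1
  | .reg _ => 1
  | .mem a => a.cost + 1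
  | .op _ a b => a.cost + b.cost + 1

/-- Programs. -/
inductive Cmd where
  /-- do nothing -/
  | skip
  /-- put the value of `e` into register `x` -/
  | assign (x : ℕ) (e : Expr)
  /-- put the value of `e` into the memory cell with address `addr` -/
  | store (addr e : Expr)
  /-- put a uniformly random element of `{0, …, e-1}` into register `x` (`0` if `e = 0`) -/
  | rand (x : ℕ) (e : Expr)
  /-- put the answer to the degree query `v` into register `x` -/
  | degree (x : ℕ) (v : Expr)
  /-- put the answer to the neighbour query `(v, i)` into register `x` -/
  | neighbor (x : ℕ) (v i : Expr)
  /-- first `a`, then `b` -/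
  | seq (a b : Cmd)
  /-- `a` if `e` is nonzero, otherwise `b` -/
  | cond (e : Expr) (a b : Cmd)
  /-- repeat `a` as long as `e` is nonzero -/
  | loop (e : Expr) (a : Cmd)

/-- Contents of the registers and of the memory. -/
structure Store where
  reg : ℕ → ℕ
  mem : ℕ → ℕ

/-- Write to a register. -/
def Store.setReg (s : Store) (x v : ℕ) : Store := { s with reg := Function.update s.reg x v }

/-- Write to a memory cell. -/
def Store.setMem (s : Store) (a v : ℕ) : Store := { s with mem := Function.update s.mem a v }

/-- Value of an expression, for word length `w`. -/
def Expr.eval (w : ℕ) (s : Store) : Expr → ℕ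
  | .const c => c % 2 ^ w
  | .reg x => s.reg x
  | .mem a => s.mem (a.eval w s)
  | .op o a b => o.eval (a.eval w s) (b.eval w s) % 2 ^ w

/-- A configuration: the commands that remain to be executed, in this order, and the store. The
machine has halted when no command remains. -/
structure Config where
  todo : List Cmd
  store : Store

/-- The uniform distribution on `{0, …, b-1}` (the point mass at `0` if `b = 0`). -/
noncomputable def uniformBelow (b : ℕ) : PMF ℕ :=
  if h : 0 < b then
    PMF.uniformOfFinset (Finset.range b) (Finset.nonempty_range_iff.mpr h.ne')
  else PMF.pure 0

/-- One step of the machine. -/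
noncomputable def step (w : ℕ) {n : ℕ} {G : SimpleGraph (Fin n)} (L : AdjList G) :
    Config → PMF Config
  | ⟨[], s⟩ => PMF.pure ⟨[], s⟩
  | ⟨.skip :: k, s⟩ => PMF.pure ⟨k, s⟩
  | ⟨.assign x e :: k, s⟩ => PMF.pure ⟨k, s.setReg x (e.eval w s)⟩
  | ⟨.store a e :: k, s⟩ => PMF.pure ⟨k, s.setMem (a.eval w s) (e.eval w s)⟩
  | ⟨.rand x e :: k, s⟩ => (uniformBelow (e.eval w s)).map fun r => ⟨k, s.setReg x r⟩
  | ⟨.degree x v :: k, s⟩ => PMF.pure ⟨k, s.setReg x (L.degreeQuery (v.eval w s))⟩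
  | ⟨.neighbor x v i :: k, s⟩ =>
      PMF.pure ⟨k, s.setReg x (L.neighborQuery (v.eval w s) (i.eval w s))⟩
  | ⟨.seq a b :: k, s⟩ => PMF.pure ⟨a :: b :: k, s⟩
  | ⟨.cond e a b :: k, s⟩ => PMF.pure ⟨(if e.eval w s ≠ 0 then a else b) :: k, s⟩
  | ⟨.loop e a :: k, s⟩ =>
      PMF.pure ⟨if e.eval w s ≠ 0 then a :: .loop e a :: k else k, s⟩

/-- The distribution of the configuration after `t` steps. -/
noncomputable def distAfter (w : ℕ) {n : ℕ} {G : SimpleGraph (Fin n)} (L : AdjList G)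
    (c : Config) : ℕ → PMF Config
  | 0 => PMF.pure c
  | t + 1 => (distAfter w L c t).bind (step w L)

/-- The time that the next step takes; `0` if the machine has halted. -/
def Config.timeCost (c : Config) : ℕ :=
  match c.todo with
  | [] => 0
  | .skip :: _ => 1
  | .assign _ e :: _ => e.cost + 1
  | .store a e :: _ => a.cost + e.cost + 1
  | .rand _ e :: _ => e.cost + 1
  | .degree _ v :: _ => v.cost + 1
  | .neighbor _ v i :: _ => v.cost + i.cost + 1
  | .seq _ _ :: _ => 1
  | .cond e _ _ :: _ => e.cost + 1
  | .loop e _ :: _ => e.cost + 1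

/-- The number (`0` or `1`) of degree and neighbour queries in the next step. -/
def Config.queryCost (c : Config) : ℕ :=
  match c.todo with
  | .degree _ _ :: _ => 1
  | .neighbor _ _ _ :: _ => 1
  | _ => 0

/-- The expected total cost of a run from `c`, where `cost` gives the cost of the next step. -/
noncomputable def expectedCost (cost : Config → ℕ) (w : ℕ) {n : ℕ} {G : SimpleGraph (Fin n)}
    (L : AdjList G) (c : Config) : ℝ≥0∞ :=
  ∑' t : ℕ, ∑' c' : Config, distAfter w L c t c' * (cost c' : ℝ≥0∞)

/-- The probability that a run from `c` halts with a store that satisfies `P`. -/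
noncomputable def haltProb (P : Store → Prop) (w : ℕ) {n : ℕ} {G : SimpleGraph (Fin n)}
    (L : AdjList G) (c : Config) : ℝ≥0∞ :=
  ⨆ t : ℕ, (distAfter w L c t).toOuterMeasure {c' | c'.todo = [] ∧ P c'.store}

/-! ### Programs with input `n`, `α`, `ε` -/

/-- Word length `(b + 1) * ⌈log₂ (N + 1)⌉` with `N = n + α + (denominator of ε)`, so a word is
longer than the input numbers by a constant factor at most. -/
def wordLength (b n α : ℕ) (ε : ℚ) : ℕ := (b + 1) * Nat.size (n + α + ε.den)

/-- At the start, registers `0, 1, 2, 3` hold `n`, `α` and the numerator and the denominator of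
`ε`; all other registers and the memory are `0`. -/
def initialConfig (p : Cmd) (n α : ℕ) (ε : ℚ) : Config where
  todo := [p]
  store :=
    { reg := fun x =>
        if x = 0 then n else if x = 1 then α else if x = 2 then ε.num.toNat
        else if x = 3 then ε.den else 0
      mem := fun _ => 0 }

section Run

variable (p : Cmd) (b : ℕ) {n : ℕ} {G : SimpleGraph (Fin n)} (L : AdjList G) (α : ℕ) (ε : ℚ)

/-- Probability that the program halts and answers YES (a nonzero value in register `0`). -/
noncomputable def acceptProb : ℝ≥0∞ :=
  haltProb (fun s => s.reg 0 ≠ 0) (wordLength b n α ε) L (initialConfig p n α ε)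

/-- Probability that the program halts and answers NO (the value `0` in register `0`). -/
noncomputable def rejectProb : ℝ≥0∞ :=
  haltProb (fun s => s.reg 0 = 0) (wordLength b n α ε) L (initialConfig p n α ε)

/-- Expected running time. -/
noncomputable def expectedTime : ℝ≥0∞ :=
  expectedCost Config.timeCost (wordLength b n α ε) L (initialConfig p n α ε)

/-- Expected number of queries. -/
noncomputable def expectedQueries : ℝ≥0∞ :=
  expectedCost Config.queryCost (wordLength b n α ε) L (initialConfig p n α ε)

end Run

/-- The complexity bound, with constant factor `C`, the power `k` of the logarithm of `n`, and the
constant `D` in the exponent of `1 / ε`. -/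
noncomputable def complexityBound (C : ℝ) (k : ℕ) (D : ℝ) (n m α : ℕ) (ε : ℝ) : ℝ :=
  C * (1 + Real.log n) ^ k *
    ((n : ℝ) / √(m : ℝ) * (Real.log (1 / ε) / ε)
      + (n : ℝ) * (α : ℝ) / (m : ℝ) * (1 / ε) ^ (D * Real.log (1 / ε)))

end ArbTest

open scoped NNReal

namespace ArbTest

/-! ### First step analysis -/

section Semantics

variable {w n : ℕ} {G : SimpleGraph (Fin n)} {L : AdjList G}

/-! Write m for the number of edges and E for the integer part of 1/ε plus one. The test rests on
peeling: again and again discard the vertices with few neighbours among those that remain. Let a =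
α.

If G is close to arboricity a, discard vertices with fewer than 5a/2 remaining neighbours, except
those of degree above 20aE. The vertices kept in a round have about 5a/2 neighbours each in the
previous set, while arboricity a allows only about a(|A'| + |A|) ordered pairs between the new set
A' and the old set A. Hence a|A| shrinks by the factor 2/3 per round, up to an error O(m/E), and
O(log E) rounds leave at most about 6m/E edges (`sum_mul_nbrSum_le_of_close`). Conversely, whatever
the number of rounds of peeling at 3a, the edges not left over split into 3a forests: order the
vertices by the round in which they disappear (`exists_arboricity_le_of_peel`,
`hasForestPartition_of_order`). So if G is far, at least 20m/E edges are left
(`le_sum_mul_nbrSum_of_far`). It suffices to tell these two cases apart by estimating the fraction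
of edges both of whose endpoints survive, with the threshold 11/E between them.

Whether a vertex survives i + 1 rounds is estimated recursively: sample S = 1000000 E² neighbours,
test each with i rounds, and compare the estimated number of surviving neighbours with 11a/4.
Chebyshev's inequality makes the errors so small that they fit into the gaps between 5/2, 11/4 and 3
(`passReal_succ_le`, `le_passReal_succ`). A vertex of degree above 20aE would need too many samples
and always passes; there are few of them. The recursion costs S to the power O(log E), which is the
factor (1/ε)^(D log(1/ε)).

Almost uniform edges come from a degree bound Θ of order √m. A random vertex and a random index
below Θ give each edge at a light vertex with the same probability; a vertex of degree above Θ has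
almost only light neighbours and is reached through them (`edgeExp_le`, `le_edgeExp`). An attempt
succeeds with probability about m/(nΘ), so order E·n/Θ cheap attempts yield order E edges, and only
these pay for the vertex tests.

The size √m is found by halving a guess θ from n on. The mean of min(d(v), θ) is estimated with
about n/θ samples; stopping at θ has probability O(m/θ²), going on below √m has probability at most
1/256 per step (`stopProb_true_le`, `stopProb_false_le`). Both the error and the cost are therefore
geometric sums, and no factor log n arises. If θ² exceeds 500nα, the graph is too dense to be close,
and the answer is NO at once; otherwise m/θ² = O(nαm/θ⁴), which bounds the cost of the tests by the
second term of the claim.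

To carry this to the machine, `Reach` describes a piece of program by the distribution of an
abstract outcome, a condition on the store for each outcome, and an expected time. These
specifications compose (`Reach.bind`, `Reach.iterate`), so the program is shown to realise the
distribution `searchProb` in time `searchTime`, and all probability is done with these explicit
recursive functions. -/

theorem tsum_bind_mul {α β : Type*} (μ : PMF α) (κ : α → PMF β) (f : β → ℝ≥0∞) :
    ∑' b, (μ.bind κ) b * f b = ∑' a, μ a * ∑' b, κ a b * f b := by
  simp_rw [PMF.bind_apply, ← ENNReal.tsum_mul_right, ← ENNReal.tsum_mul_left]
  rw [ENNReal.tsum_comm]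
  simp_rw [mul_assoc]

theorem tsum_pure_mul {β : Type*} (b : β) (f : β → ℝ≥0∞) :
    ∑' c, (PMF.pure b) c * f c = f b := by
  rw [tsum_eq_single b]
  · simp
  · intro c hc
    simp [PMF.pure_apply, hc]

theorem tsum_map_mul {α β : Type*} (μ : PMF α) (h : α → β) (f : β → ℝ≥0∞) :
    ∑' b, (μ.map h) b * f b = ∑' a, μ a * f (h a) := by
  rw [PMF.map, tsum_bind_mul]
  simp_rw [Function.comp, tsum_pure_mul]

theorem tsum_uniformBelow_mul {N : ℕ} (hN : 0 < N) (f : ℕ → ℝ≥0∞) :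
    ∑' r, uniformBelow N r * f r = ∑ r ∈ Finset.range N, (N : ℝ≥0∞)⁻¹ * f r := by
  rw [tsum_eq_sum (s := Finset.range N)]
  · refine Finset.sum_congr rfl fun r hr => ?_
    rw [uniformBelow, dif_pos hN, PMF.uniformOfFinset_apply_of_mem _ hr]
    simp
  · intro r hr
    rw [uniformBelow, dif_pos hN, PMF.uniformOfFinset_apply_of_notMem _ hr, zero_mul]

/-- `distAfter` appends steps at the end of a run; reasoning along the program needs the first step
split off instead. -/
theorem distAfter_succ_left (c : Config) (t : ℕ) :
    distAfter w L c (t + 1) = (step w L c).bind fun c' => distAfter w L c' t := by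
  induction t with
  | zero => simp [distAfter]
  | succ t ih =>
    rw [distAfter, ih, PMF.bind_bind]
    rfl

theorem expectedCost_eq (cost : Config → ℕ) (c : Config) :
    expectedCost cost w L c
      = cost c + ∑' c', step w L c c' * expectedCost cost w L c' := by
  unfold expectedCost
  rw [tsum_eq_zero_add' ENNReal.summable]
  congr 1
  · simp [distAfter]
  · simp_rw [distAfter_succ_left, tsum_bind_mul, ← ENNReal.tsum_mul_left]
    rw [ENNReal.tsum_comm]

/-- The probability of having halted with `P` after `t` steps. -/
noncomputable def haltAfter (P : Store → Prop) (w : ℕ) (L : AdjList G) (c : Config) (t : ℕ) :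
    ℝ≥0∞ :=
  (distAfter w L c t).toOuterMeasure {c' | c'.todo = [] ∧ P c'.store}

theorem haltAfter_eq_tsum (P : Store → Prop) (c : Config) (t : ℕ) :
    haltAfter P w L c t = ∑' c', distAfter w L c t c' *
      Set.indicator {c' : Config | c'.todo = [] ∧ P c'.store} 1 c' := by
  rw [haltAfter, PMF.toOuterMeasure_apply]
  refine tsum_congr fun c' => ?_
  by_cases h : c' ∈ {c' : Config | c'.todo = [] ∧ P c'.store} <;> simp [h]

theorem haltAfter_succ (P : Store → Prop) (c : Config) (t : ℕ) :
    haltAfter P w L c (t + 1) = ∑' c', step w L c c' * haltAfter P w L c' t := by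
  simp_rw [haltAfter_eq_tsum, distAfter_succ_left, tsum_bind_mul]

/-- A halted configuration is fixed by `step`, so the probability of having halted well can only
grow, and the supremum in `haltProb` is a limit. -/
theorem haltAfter_mono (P : Store → Prop) (c : Config) : Monotone (haltAfter P w L c) := by
  refine monotone_nat_of_le_succ fun t => ?_
  rw [haltAfter_eq_tsum, haltAfter_eq_tsum, distAfter, tsum_bind_mul]
  refine ENNReal.tsum_le_tsum fun c' => mul_le_mul_right ?_ _
  obtain ⟨l, s⟩ := c'
  cases l with
  | nil => rw [step, tsum_pure_mul]
  | cons a l => simp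

theorem haltProb_eq_iSup (P : Store → Prop) (c : Config) :
    haltProb P w L c = ⨆ t, haltAfter P w L c t := rfl

theorem haltProb_eq_iSup_succ (P : Store → Prop) (c : Config) :
    haltProb P w L c = ⨆ t, haltAfter P w L c (t + 1) := by
  rw [haltProb_eq_iSup]
  exact ((haltAfter_mono P c).iSup_nat_add 1).symm

/-- Expected running time with remaining commands `l` and store `s`. -/
noncomputable def timeFrom (w : ℕ) (L : AdjList G) (l : List Cmd) (s : Store) : ℝ≥0∞ :=
  expectedCost Config.timeCost w L ⟨l, s⟩

/-- Probability of halting with `P`, with remaining commands `l` and store `s`. -/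
noncomputable def haltFrom (w : ℕ) (L : AdjList G) (P : Store → Prop) (l : List Cmd) (s : Store) :
    ℝ≥0∞ :=
  haltProb P w L ⟨l, s⟩

theorem timeFrom_nil (s : Store) : timeFrom w L [] s = 0 := by
  have h : ∀ t, distAfter w L ⟨[], s⟩ t = PMF.pure ⟨[], s⟩ := by
    intro t
    induction t with
    | zero => rfl
    | succ t ih => rw [distAfter, ih, PMF.pure_bind, step]
  simp [timeFrom, expectedCost, h, Config.timeCost]

theorem haltFrom_nil {P : Store → Prop} {s : Store} (hs : P s) : haltFrom w L P [] s = 1 := by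
  refine le_antisymm ?_ ?_
  · refine iSup_le fun t => ?_
    change haltAfter P w L ⟨[], s⟩ t ≤ 1
    rw [haltAfter_eq_tsum, ← (distAfter w L ⟨[], s⟩ t).tsum_coe]
    refine ENNReal.tsum_le_tsum fun c => ?_
    by_cases hc : c ∈ {c' : Config | c'.todo = [] ∧ P c'.store} <;> simp [hc]
  · refine le_trans ?_ (le_iSup (haltAfter P w L ⟨[], s⟩) 0)
    rw [haltAfter_eq_tsum, distAfter, tsum_pure_mul]
    simp [hs]

theorem timeFrom_of_pure {l l' : List Cmd} {s s' : Store}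
    (h : step w L ⟨l, s⟩ = PMF.pure ⟨l', s'⟩) :
    timeFrom w L l s = (Config.timeCost ⟨l, s⟩ : ℕ) + timeFrom w L l' s' := by
  rw [timeFrom, expectedCost_eq, h, tsum_pure_mul, timeFrom]

theorem haltFrom_of_pure {P : Store → Prop} {l l' : List Cmd} {s s' : Store}
    (h : step w L ⟨l, s⟩ = PMF.pure ⟨l', s'⟩) :
    haltFrom w L P l s = haltFrom w L P l' s' := by
  rw [haltFrom, haltProb_eq_iSup_succ, haltFrom, haltProb_eq_iSup]
  simp_rw [haltAfter_succ, h, tsum_pure_mul]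

theorem timeFrom_rand {l : List Cmd} {s : Store} {x N : ℕ} {e : Expr} (he : e.eval w s = N)
    (hN : 0 < N) :
    timeFrom w L (.rand x e :: l) s
      = (e.cost + 1 : ℕ) + ∑ r ∈ Finset.range N, (N : ℝ≥0∞)⁻¹ * timeFrom w L l (s.setReg x r) := by
  rw [timeFrom, expectedCost_eq, step, tsum_map_mul, he, tsum_uniformBelow_mul hN]
  rfl

/-- The supremum over the number of steps passes through the finite average because `haltAfter` is
monotone in time. -/
theorem haltFrom_rand {P : Store → Prop} {l : List Cmd} {s : Store} {x N : ℕ} {e : Expr}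
    (he : e.eval w s = N) (hN : 0 < N) :
    haltFrom w L P (.rand x e :: l) s
      = ∑ r ∈ Finset.range N, (N : ℝ≥0∞)⁻¹ * haltFrom w L P l (s.setReg x r) := by
  rw [haltFrom, haltProb_eq_iSup_succ]
  simp_rw [haltAfter_succ, step, tsum_map_mul, he, tsum_uniformBelow_mul hN, haltFrom,
    haltProb_eq_iSup, ENNReal.mul_iSup]
  rw [ENNReal.finsetSum_iSup_of_monotone]
  intro r
  exact fun a b hab => mul_le_mul_right (haltAfter_mono P _ hab) _

/-! ### Specifications -/

/-- With the commands `l` left to be executed and the store `s`, the machine gets to a moment at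
which the commands `l'` are left. An outcome `o` in `ι` is then attached to the run, with
probabilities (at least, or exactly if they add up to `1`) `ν`, the store satisfies `Q o`, and the
expected time up to this moment is at most `T`. -/
def Reach {ι : Type} [Fintype ι] (w : ℕ) (L : AdjList G) (l l' : List Cmd) (s : Store)
    (ν : ι → ℝ≥0) (Q : ι → Store → Prop) (T : ℝ≥0) : Prop :=
  (∀ g : ι → ℝ≥0∞, (∀ o s', Q o s' → timeFrom w L l' s' ≤ g o) →
    timeFrom w L l s ≤ T + ∑ o, (ν o : ℝ≥0∞) * g o) ∧
  (∀ (P : Store → Prop) (g : ι → ℝ≥0∞), (∀ o s', Q o s' → g o ≤ haltFrom w L P l' s') →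
    ∑ o, (ν o : ℝ≥0∞) * g o ≤ haltFrom w L P l s)

variable {ι κ : Type} [Fintype ι] [Fintype κ] {l l' l'' : List Cmd} {s : Store} {ν : ι → ℝ≥0}
  {Q : ι → Store → Prop} {T : ℝ≥0}

theorem Reach.mono {ν' : ι → ℝ≥0} {Q' : ι → Store → Prop} {T' : ℝ≥0}
    (h : Reach w L l l' s ν Q T) (hν : ∀ o, ν o = ν' o)
    (hQ : ∀ o s', Q o s' → Q' o s') (hT : T ≤ T') : Reach w L l l' s ν' Q' T' := by
  obtain rfl : ν = ν' := funext hν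
  refine ⟨fun g hg => (h.1 g fun o s' hs => hg o s' (hQ o s' hs)).trans ?_,
    fun P g hg => h.2 P g fun o s' hs => hg o s' (hQ o s' hs)⟩
  gcongr

theorem Reach.le (h : Reach w L l l' s ν Q T) {T' : ℝ≥0} (hT : T ≤ T') :
    Reach w L l l' s ν Q T' :=
  h.mono (fun _ => rfl) (fun _ _ => id) hT

/-- The distribution concentrated on one outcome. -/
def dirac [DecidableEq ι] (o : ι) : ι → ℝ≥0 := fun o' => if o' = o then 1 else 0

theorem Reach.refl [DecidableEq ι] (o : ι) (hs : Q o s) : Reach w L l l s (dirac o) Q 0 := by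
  have key : ∀ g : ι → ℝ≥0∞, ∑ o', (dirac o o' : ℝ≥0∞) * g o' = g o := fun g => by
    simp [dirac, apply_ite ENNReal.ofNNReal]
  refine ⟨fun g hg => ?_, fun P g hg => ?_⟩
  · simpa [key] using hg o s hs
  · simpa [key] using hg o s hs

/-- Since `Reach` quantifies over all bounds `g` for the continuation, composition is substitution:
the estimate that the second part yields after the outcome `o` is itself an admissible bound for the
first part. The expected times of the second part are averaged over the outcomes of the first. -/
theorem Reach.bind {μ : ι → κ → ℝ≥0} {R : κ → Store → Prop} {T' : ι → ℝ≥0}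
    (h : Reach w L l l' s ν Q T)
    (h' : ∀ o s', Q o s' → Reach w L l' l'' s' (μ o) R (T' o)) :
    Reach w L l l'' s (fun o' => ∑ o, ν o * μ o o') R (T + ∑ o, ν o * T' o) := by
  have key : ∀ g : κ → ℝ≥0∞, ∑ o, (ν o : ℝ≥0∞) * ∑ o', (μ o o' : ℝ≥0∞) * g o'
      = ∑ o', ((∑ o, ν o * μ o o' : ℝ≥0) : ℝ≥0∞) * g o' := by
    intro g
    push_cast
    simp_rw [Finset.mul_sum, Finset.sum_mul]
    rw [Finset.sum_comm]
    simp_rw [mul_assoc]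
  refine ⟨fun g hg => ?_, fun P g hg => ?_⟩
  · refine (h.1 (fun o => T' o + ∑ o', (μ o o' : ℝ≥0∞) * g o')
      fun o s' hs => (h' o s' hs).1 g hg).trans ?_
    simp_rw [mul_add, Finset.sum_add_distrib, key]
    push_cast
    rw [add_assoc]
  · rw [← key]
    exact h.2 P _ fun o s' hs => (h' o s' hs).2 P g hg

/-- Composition with a first part that has only one outcome. -/
theorem Reach.bind_unit {Q : Unit → Store → Prop} {T₁ T₂ : ℝ≥0} {ν : κ → ℝ≥0}
    {R : κ → Store → Prop}
    (h : Reach w L l l' s (dirac ()) Q T₁)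
    (h' : ∀ s', Q () s' → Reach w L l' l'' s' ν R T₂) :
    Reach w L l l'' s ν R (T₁ + T₂) := by
  have := h.bind (μ := fun _ => ν) (T' := fun _ => T₂) (fun _ s' hs => h' s' hs)
  exact this.mono (by simp [dirac]) (fun _ _ => id) (by simp [dirac])

theorem Reach.of_pure {l₁ : List Cmd} {s₁ : Store}
    (hs : step w L ⟨l, s⟩ = PMF.pure ⟨l₁, s₁⟩) (h : Reach w L l₁ l' s₁ ν Q T) :
    Reach w L l l' s ν Q ((Config.timeCost ⟨l, s⟩ : ℕ) + T) := by
  refine ⟨fun g hg => ?_, fun P g hg => ?_⟩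
  · rw [timeFrom_of_pure hs]
    push_cast
    rw [add_assoc]
    gcongr
    exact h.1 g hg
  · rw [haltFrom_of_pure hs]
    exact h.2 P g hg

theorem Reach.assign {x : ℕ} {e : Expr} {v : ℕ} (hv : e.eval w s = v)
    (h : Reach w L l l' (s.setReg x v) ν Q T) :
    Reach w L (.assign x e :: l) l' s ν Q ((e.cost + 1 : ℕ) + T) :=
  Reach.of_pure (by rw [step, hv]) h

theorem Reach.store {a e : Expr} {i v : ℕ} (hi : a.eval w s = i) (hv : e.eval w s = v)
    (h : Reach w L l l' (s.setMem i v) ν Q T) :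
    Reach w L (.store a e :: l) l' s ν Q ((a.cost + e.cost + 1 : ℕ) + T) :=
  Reach.of_pure (by rw [step, hi, hv]) h

theorem Reach.degree {x : ℕ} {e : Expr} {v : ℕ} (hv : L.degreeQuery (e.eval w s) = v)
    (h : Reach w L l l' (s.setReg x v) ν Q T) :
    Reach w L (.degree x e :: l) l' s ν Q ((e.cost + 1 : ℕ) + T) :=
  Reach.of_pure (by rw [step, hv]) h

theorem Reach.neighbor {x : ℕ} {e i : Expr} {v : ℕ}
    (hv : L.neighborQuery (e.eval w s) (i.eval w s) = v)
    (h : Reach w L l l' (s.setReg x v) ν Q T) :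
    Reach w L (.neighbor x e i :: l) l' s ν Q ((e.cost + i.cost + 1 : ℕ) + T) :=
  Reach.of_pure (by rw [step, hv]) h

theorem Reach.seq {a b : Cmd} (h : Reach w L (a :: b :: l) l' s ν Q T) :
    Reach w L (.seq a b :: l) l' s ν Q ((1 : ℕ) + T) :=
  Reach.of_pure (by rw [step]) h

theorem Reach.skip (h : Reach w L l l' s ν Q T) :
    Reach w L (.skip :: l) l' s ν Q ((1 : ℕ) + T) :=
  Reach.of_pure (by rw [step]) h

theorem Reach.cond_true {e : Expr} {a b : Cmd} (he : e.eval w s ≠ 0)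
    (h : Reach w L (a :: l) l' s ν Q T) :
    Reach w L (.cond e a b :: l) l' s ν Q ((e.cost + 1 : ℕ) + T) :=
  Reach.of_pure (by rw [step, if_pos he]) h

theorem Reach.cond_false {e : Expr} {a b : Cmd} (he : e.eval w s = 0)
    (h : Reach w L (b :: l) l' s ν Q T) :
    Reach w L (.cond e a b :: l) l' s ν Q ((e.cost + 1 : ℕ) + T) :=
  Reach.of_pure (by rw [step, if_neg (not_not.mpr he)]) h

theorem Reach.loop_true {e : Expr} {a : Cmd} (he : e.eval w s ≠ 0)
    (h : Reach w L (a :: .loop e a :: l) l' s ν Q T) :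
    Reach w L (.loop e a :: l) l' s ν Q ((e.cost + 1 : ℕ) + T) :=
  Reach.of_pure (by rw [step, if_pos he]) h

theorem Reach.loop_false {e : Expr} {a : Cmd} (he : e.eval w s = 0)
    (h : Reach w L l l' s ν Q T) :
    Reach w L (.loop e a :: l) l' s ν Q ((e.cost + 1 : ℕ) + T) :=
  Reach.of_pure (by rw [step, if_neg (not_not.mpr he)]) h

theorem Reach.rand {x N : ℕ} {e : Expr} (he : e.eval w s = N) (hN : 0 < N) {μ : ℕ → ι → ℝ≥0}
    {T : ℕ → ℝ≥0}
    (h : ∀ r < N, Reach w L l l' (s.setReg x r) (μ r) Q (T r)) :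
    Reach w L (.rand x e :: l) l' s (fun o => ∑ r ∈ Finset.range N, (N : ℝ≥0)⁻¹ * μ r o) Q
      ((e.cost + 1 : ℕ) + ∑ r ∈ Finset.range N, (N : ℝ≥0)⁻¹ * T r) := by
  have hN' : (N : ℝ≥0) ≠ 0 := by positivity
  have key : ∀ g : ι → ℝ≥0∞,
      ∑ r ∈ Finset.range N, (N : ℝ≥0∞)⁻¹ * ∑ o, (μ r o : ℝ≥0∞) * g o
      = ∑ o, ((∑ r ∈ Finset.range N, (N : ℝ≥0)⁻¹ * μ r o : ℝ≥0) : ℝ≥0∞) * g o := by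
    intro g
    push_cast [ENNReal.coe_inv hN']
    simp_rw [Finset.mul_sum, Finset.sum_mul]
    rw [Finset.sum_comm]
    simp_rw [mul_assoc]
  refine ⟨fun g hg => ?_, fun P g hg => ?_⟩
  · rw [timeFrom_rand he hN, ← key]
    push_cast [ENNReal.coe_inv hN']
    rw [add_assoc (_ + 1 : ℝ≥0∞), ← Finset.sum_add_distrib]
    gcongr with r hr
    rw [← mul_add]
    gcongr
    exact (h r (Finset.mem_range.mp hr)).1 g hg
  · rw [haltFrom_rand he hN, ← key]
    gcongr with r hr
    exact (h r (Finset.mem_range.mp hr)).2 P g hg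

/-- A random choice after which the expected time does not depend on the number chosen. -/
theorem Reach.rand_const {x N : ℕ} {e : Expr} (he : e.eval w s = N) (hN : 0 < N)
    {μ : ℕ → ι → ℝ≥0}
    (h : ∀ r < N, Reach w L l l' (s.setReg x r) (μ r) Q T) :
    Reach w L (.rand x e :: l) l' s (fun o => ∑ r ∈ Finset.range N, (N : ℝ≥0)⁻¹ * μ r o) Q
      ((e.cost + 1 : ℕ) + T) := by
  refine (Reach.rand he hN h).le ?_
  have hN' : (N : ℝ≥0) ≠ 0 := by positivity
  simp [hN']

theorem Reach.timeFrom_le (h : Reach w L l [] s ν Q T) : timeFrom w L l s ≤ T := by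
  simpa using h.1 (fun _ => 0) fun o s' _ => (timeFrom_nil s').le

theorem Reach.le_haltFrom {P : Store → Prop} (h : Reach w L l [] s ν Q T) (o : ι)
    (hP : ∀ s', Q o s' → P s') : (ν o : ℝ≥0∞) ≤ haltFrom w L P l s := by
  classical
  -- The indicator function of `o` extracts the single probability `ν o`.
  have := h.2 P (fun o' => if o' = o then 1 else 0) fun o' s' hs => by
    by_cases ho : o' = o
    · subst ho
      rw [if_pos rfl, haltFrom_nil (hP s' hs)]
    · simp [ho]
  simpa using this

end Semantics

/-! ### Sums of independent random integers -/

section Iterate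

variable {ι κ : Type} [Fintype ι] [Fintype κ]

/-- The expected value of `f (z + Y₁ + ⋯ + Yᵣ)`, where `Y₁, …, Yᵣ` are independent and take the
value `y i` with probability `p i`. -/
def iterExp (p : ι → ℝ≥0) (y : ι → ℤ) (f : ℤ → ℝ≥0) : ℕ → ℤ → ℝ≥0
  | 0, z => f z
  | r + 1, z => ∑ i, p i * iterExp p y f r (z + y i)

variable {p : ι → ℝ≥0} {y : ι → ℤ}

theorem iterExp_add_eq_one (hp : ∑ i, p i = 1) {f f' : ℤ → ℝ≥0} (hf : ∀ z, f z + f' z = 1)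
    (r : ℕ) (z : ℤ) : iterExp p y f r z + iterExp p y f' r z = 1 := by
  induction r generalizing z with
  | zero => exact hf z
  | succ r ih =>
    simp only [iterExp]
    rw [← Finset.sum_add_distrib, ← hp]
    refine Finset.sum_congr rfl fun i _ => ?_
    rw [← mul_add, ih, mul_one]

/-- The second moment about `c` of a sum of independent terms is the squared bias plus the variance,
by induction on the number of terms. The variance is replaced by the uncentred second moment, which
is easier to bound and costs only the square of the mean. -/
theorem iterExp_mul_sq_le (hp : ∑ i, p i = 1) {f : ℤ → ℝ≥0} {a c : ℝ}
    (hf : ∀ z, (f z : ℝ) * a ^ 2 ≤ (z - c) ^ 2) (r : ℕ) (z : ℤ) :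
    (iterExp p y f r z : ℝ) * a ^ 2
      ≤ (z + r * (∑ i, (p i : ℝ) * y i) - c) ^ 2 + r * ∑ i, (p i : ℝ) * (y i : ℝ) ^ 2 := by
  have hp' : ∑ i, (p i : ℝ) = 1 := by exact_mod_cast hp
  set μ := ∑ i, (p i : ℝ) * y i with hμ
  set v := ∑ i, (p i : ℝ) * (y i : ℝ) ^ 2 with hv
  induction r generalizing z with
  | zero => simpa [iterExp] using hf z
  | succ r ih =>
    have h1 : (iterExp p y f (r + 1) z : ℝ) * a ^ 2
        ≤ ∑ i, (p i : ℝ) * (((z + y i : ℤ) + r * μ - c) ^ 2 + r * v) := by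
      simp only [iterExp]
      push_cast
      rw [Finset.sum_mul]
      refine Finset.sum_le_sum fun i _ => ?_
      rw [mul_assoc]
      have := ih (z + y i)
      push_cast at this
      gcongr
    refine h1.trans ?_
    have gen : ∀ A B : ℝ, ∑ i, (p i : ℝ) * ((A + y i) ^ 2 + B)
        = (A ^ 2 + B) * ∑ i, (p i : ℝ) + 2 * A * ∑ i, (p i : ℝ) * y i
          + ∑ i, (p i : ℝ) * (y i : ℝ) ^ 2 := by
      intro A B
      simp_rw [Finset.mul_sum, ← Finset.sum_add_distrib]
      exact Finset.sum_congr rfl fun i _ => by ring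
    have h2 : ∑ i, (p i : ℝ) * (((z + y i : ℤ) + r * μ - c) ^ 2 + r * v)
        = ((z + r * μ - c) ^ 2 + r * v) * ∑ i, (p i : ℝ) + 2 * (z + r * μ - c) * μ + v := by
      rw [← gen]
      refine Finset.sum_congr rfl fun i _ => ?_
      push_cast
      ring
    rw [h2, hp']
    push_cast
    -- The induction produces an excess of exactly the square of `μ`, which is dropped here.
    nlinarith [sq_nonneg μ]

/-- Chebyshev's inequality. -/
theorem iterExp_chebyshev (hp : ∑ i, p i = 1) {f : ℤ → ℝ≥0} (hf1 : ∀ z, f z ≤ 1) {a μ v : ℝ}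
    (r : ℕ) (ha : 0 ≤ a) (hμ : ∑ i, (p i : ℝ) * y i = μ) (hv : ∑ i, (p i : ℝ) * (y i : ℝ) ^ 2 ≤ v)
    (hf : ∀ z : ℤ, f z ≠ 0 → a ≤ |(z : ℝ) - r * μ|) :
    (iterExp p y f r 0 : ℝ) * a ^ 2 ≤ r * v := by
  have := iterExp_mul_sq_le (y := y) hp (f := f) (a := a) (c := r * μ) (fun z => ?_) r 0
  · refine this.trans ?_
    rw [hμ]
    have : (r : ℝ) * ∑ i, (p i : ℝ) * (y i : ℝ) ^ 2 ≤ r * v := by gcongr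
    simpa using this
  · by_cases h0 : f z = 0
    · simp [h0, sq_nonneg]
    · have h1 : (f z : ℝ) ≤ 1 := by exact_mod_cast hf1 z
      have h2 : a ^ 2 ≤ |(z : ℝ) - r * μ| ^ 2 := by gcongr; exact hf z h0
      rw [sq_abs] at h2
      nlinarith [sq_nonneg a]

/-- Markov's inequality. -/
theorem iterExp_markov (hp : ∑ i, p i = 1) {f : ℤ → ℝ≥0} {a : ℝ} (hy : ∀ i, 0 ≤ y i)
    (hf : ∀ z : ℤ, 0 ≤ z → (f z : ℝ) * a ≤ z) (r : ℕ) {z : ℤ} (hz : 0 ≤ z) :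
    (iterExp p y f r z : ℝ) * a ≤ z + r * ∑ i, (p i : ℝ) * y i := by
  have hp' : ∑ i, (p i : ℝ) = 1 := by exact_mod_cast hp
  set μ := ∑ i, (p i : ℝ) * y i with hμ
  induction r generalizing z with
  | zero => simpa [iterExp] using hf z hz
  | succ r ih =>
    have h1 : (iterExp p y f (r + 1) z : ℝ) * a ≤ ∑ i, (p i : ℝ) * ((z + y i : ℤ) + r * μ) := by
      simp only [iterExp]
      push_cast
      rw [Finset.sum_mul]
      refine Finset.sum_le_sum fun i _ => ?_
      rw [mul_assoc]
      have := ih (z := z + y i) (by have := hy i; omega)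
      push_cast at this
      gcongr
    refine h1.trans (le_of_eq ?_)
    have gen : ∀ A : ℝ, ∑ i, (p i : ℝ) * (A + y i)
        = A * ∑ i, (p i : ℝ) + ∑ i, (p i : ℝ) * y i := by
      intro A
      simp_rw [Finset.mul_sum, ← Finset.sum_add_distrib]
      exact Finset.sum_congr rfl fun i _ => by ring
    have h2 : ∑ i, (p i : ℝ) * ((z + y i : ℤ) + r * μ) = (z + r * μ) * ∑ i, (p i : ℝ) + μ := by
      rw [← gen]
      refine Finset.sum_congr rfl fun i _ => ?_
      push_cast
      ring
    rw [h2, hp']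
    push_cast
    ring

variable {w n : ℕ} {G : SimpleGraph (Fin n)} {L : AdjList G} {l l' : List Cmd}

/-- A loop that makes a fixed number of independent trials. -/
theorem Reach.iterate {Inv : ℕ → ℤ → Store → Prop} {c T : ℝ≥0} {f : κ → ℤ → ℝ≥0}
    {R : κ → Store → Prop} (hp : ∑ i, p i = 1)
    (hstep : ∀ r z s, Inv (r + 1) z s → Reach w L l l s p (fun i => Inv r (z + y i)) c)
    (hexit : ∀ z s, Inv 0 z s → Reach w L l l' s (fun o => f o z) R T)
    (r : ℕ) (z : ℤ) (s : Store) (hs : Inv r z s) :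
    Reach w L l l' s (fun o => iterExp p y (f o) r z) R (r * c + T) := by
  induction r generalizing z s with
  | zero => exact (hexit z s hs).mono (fun _ => rfl) (fun _ _ => id) (by simp)
  | succ r ih =>
    have := (hstep r z s hs).bind (fun i s' hs' => ih (z + y i) s' hs')
    refine this.mono (fun o => rfl) (fun _ _ => id) ?_
    rw [← Finset.sum_mul, hp]
    push_cast
    apply le_of_eq
    ring

end Iterate

/-! ### Counting edges between vertex sets -/

section Counting

open Classical in
/-- The number of pairs in `A × B` that are adjacent in `F`. -/
noncomputable def adjPairs {V : Type*} (F : SimpleGraph V) (A B : Finset V) : ℝ :=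
  ∑ v ∈ A, ∑ u ∈ B, if F.Adj v u then 1 else 0

variable {V : Type*} {F H G : SimpleGraph V} {A B : Finset V}

theorem adjPairs_nonneg : 0 ≤ adjPairs F A B :=
  Finset.sum_nonneg fun _ _ => Finset.sum_nonneg fun _ _ => by split_ifs <;> norm_num

theorem adjPairs_comm : adjPairs F A B = adjPairs F B A := by
  classical
  rw [adjPairs, Finset.sum_comm]
  refine Finset.sum_congr rfl fun v _ => Finset.sum_congr rfl fun u _ => ?_
  by_cases h : F.Adj u v <;> simp [h, F.adj_comm v u]

theorem adjPairs_mono {A' B' : Finset V} (hF : F ≤ G) (hA : A ⊆ A') (hB : B ⊆ B') :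
    adjPairs F A B ≤ adjPairs G A' B' := by
  classical
  unfold adjPairs
  refine (Finset.sum_le_sum fun v _ => ?_).trans (Finset.sum_le_sum_of_subset_of_nonneg hA
    fun v _ _ => Finset.sum_nonneg fun u _ => by split_ifs <;> norm_num)
  refine (Finset.sum_le_sum fun u _ => ?_).trans (Finset.sum_le_sum_of_subset_of_nonneg hB
    fun u _ _ => by split_ifs <;> norm_num)
  by_cases h : F.Adj v u
  · simp [h, hF h]
  · simp only [h, if_false]
    split_ifs <;> norm_num

theorem adjPairs_le_card_mul_card : adjPairs F A B ≤ A.card * B.card := by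
  classical
  unfold adjPairs
  refine (Finset.sum_le_card_nsmul _ _ (B.card : ℝ) fun v _ => ?_).trans_eq (by simp)
  refine (Finset.sum_le_card_nsmul _ _ (1 : ℝ) fun u _ => ?_).trans_eq (by simp)
  split_ifs <;> norm_num

/-- `adjPairs` counts ordered pairs, so an edge inside a set counts twice. All edge counts below
carry this factor 2. -/
theorem adjPairs_univ [Fintype V] :
    adjPairs G Finset.univ Finset.univ = 2 * G.edgeSet.ncard := by
  classical
  have h := G.sum_degrees_eq_twice_card_edges
  have h1 : G.edgeSet.ncard = G.edgeFinset.card := by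
    rw [← SimpleGraph.coe_edgeFinset, Set.ncard_coe_finset]
  have h2 : adjPairs G Finset.univ Finset.univ = ((∑ v, G.degree v : ℕ) : ℝ) := by
    push_cast
    refine Finset.sum_congr rfl fun v _ => ?_
    rw [← SimpleGraph.card_neighborFinset_eq_degree, SimpleGraph.neighborFinset_eq_filter]
    simp
  rw [h2, h, h1]
  push_cast
  rfl

theorem adjPairs_union_right [DecidableEq V] {C : Finset V} (h : Disjoint B C) :
    adjPairs F A (B ∪ C) = adjPairs F A B + adjPairs F A C := by
  simp_rw [adjPairs, Finset.sum_union h, Finset.sum_add_distrib]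

theorem adjPairs_union_left [DecidableEq V] {C : Finset V} (h : Disjoint A C) :
    adjPairs F (A ∪ C) B = adjPairs F A B + adjPairs F C B := by
  simp_rw [adjPairs, Finset.sum_union h]

/-- Split `B` into `A` and its complement in `B`: the two sides differ by the pairs inside that
complement. This turns bounds inside single sets into bounds between consecutive peeling sets. -/
theorem two_mul_adjPairs_le (h : A ⊆ B) :
    2 * adjPairs F A B ≤ adjPairs F A A + adjPairs F B B := by
  classical
  obtain ⟨C, hC, rfl⟩ : ∃ C, Disjoint A C ∧ A ∪ C = B :=
    ⟨B \ A, Finset.disjoint_sdiff, Finset.union_sdiff_of_subset h⟩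
  rw [adjPairs_union_right hC, adjPairs_union_right hC, adjPairs_union_left hC,
    adjPairs_union_left hC, adjPairs_comm (A := C) (B := A)]
  linarith [adjPairs_nonneg (F := F) (A := C) (B := C)]

theorem adjPairs_le_add_two_mul_ncard [Fintype V] :
    adjPairs G A B ≤ adjPairs H A B + 2 * (G.edgeSet \ H.edgeSet).ncard := by
  classical
  have h1 : adjPairs G A B ≤ adjPairs H A B + adjPairs (G \ H) A B := by
    simp_rw [adjPairs, ← Finset.sum_add_distrib]
    refine Finset.sum_le_sum fun v _ => Finset.sum_le_sum fun u _ => ?_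
    by_cases hG : G.Adj v u <;> by_cases hH : H.Adj v u <;> simp [hG, hH]
  have h2 : adjPairs (G \ H) A B ≤ 2 * (G.edgeSet \ H.edgeSet).ncard := by
    rw [← SimpleGraph.edgeSet_sdiff, ← adjPairs_univ]
    exact adjPairs_mono le_rfl (Finset.subset_univ _) (Finset.subset_univ _)
  linarith

/-! ### Arboricity -/

/-- The forest induced on `S` extends to a spanning tree of the complete graph on `S`, which has one
edge fewer than `S` has vertices. -/
theorem adjPairs_le_of_isAcyclic [Fintype V] (hF : F.IsAcyclic) (S : Finset V) :
    adjPairs F S S ≤ 2 * S.card := by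
  classical
  rcases S.eq_empty_or_nonempty with rfl | hS
  · simp [adjPairs]
  have : Nonempty (S : Set V) := hS.to_subtype
  have hI := hF.induce (S : Set V)
  obtain ⟨T, hT, -, hle⟩ :=
    SimpleGraph.connected_top.exists_isTree_le_of_le_of_isAcyclic le_top hI
  have hc := hle.card_edgeFinset
  have h1 : adjPairs F S S = adjPairs (F.induce (S : Set V)) Finset.univ Finset.univ := by
    unfold adjPairs
    rw [← Finset.sum_coe_sort]
    refine Finset.sum_congr rfl fun v _ => ?_
    rw [← Finset.sum_coe_sort]
    rfl
  have h2 : adjPairs (F.induce (S : Set V)) Finset.univ Finset.univ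
      ≤ adjPairs T Finset.univ Finset.univ :=
    adjPairs_mono hT subset_rfl subset_rfl
  have h3 : T.edgeSet.ncard = T.edgeFinset.card := by
    rw [← SimpleGraph.coe_edgeFinset, Set.ncard_coe_finset]
  have h4 : (T.edgeSet.ncard : ℝ) ≤ S.card := by
    have : Fintype.card (S : Set V) = S.card := by simp
    rw [h3]
    exact_mod_cast (by omega)
  rw [adjPairs_univ (G := T)] at h2
  linarith

/-- A graph has a partition into `k` forests if its vertices can be ordered so that each vertex
has at most `k` neighbours after it. -/
theorem hasForestPartition_of_order [Fintype V] {key : V → ℕ} (hkey : Function.Injective key)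
    {k : ℕ} (hk : ∀ v, {u | G.Adj v u ∧ key v < key u}.ncard ≤ k) : HasForestPartition G k := by
  classical
  have hidx : ∀ v, ∃ f : V → Fin k ⊕ Unit, Set.InjOn f {u | G.Adj v u ∧ key v < key u} ∧
      ∀ u, G.Adj v u ∧ key v < key u → ∃ i, f u = Sum.inl i := by
    intro v
    have hfin : Finite {u | G.Adj v u ∧ key v < key u} := Subtype.finite
    obtain ⟨e⟩ : Nonempty ({u | G.Adj v u ∧ key v < key u} ↪ Fin k) := by
      have : Fintype {u | G.Adj v u ∧ key v < key u} := Fintype.ofFinite _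
      refine Function.Embedding.nonempty_of_card_le ?_
      rw [Fintype.card_fin, ← Nat.card_eq_fintype_card]
      exact hk v
    refine ⟨fun u => if h : u ∈ {u | G.Adj v u ∧ key v < key u} then Sum.inl (e ⟨u, h⟩)
      else Sum.inr (), ?_, ?_⟩
    · intro a ha b hb hab
      simp only [dif_pos ha, dif_pos hb, Sum.inl.injEq, EmbeddingLike.apply_eq_iff_eq,
        Subtype.mk.injEq] at hab
      exact hab
    · intro u hu
      exact ⟨e ⟨u, hu⟩, dif_pos hu⟩
  choose f hinj hf using hidx
  -- Orient each edge towards the larger key. The at most `k` edges that leave a vertex get distinct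
  -- colours, and each colour is a forest.
  let D : Fin k → V → V → Prop := fun i v u => G.Adj v u ∧ key v < key u ∧ f v u = Sum.inl i
  let F : Fin k → SimpleGraph V := fun i =>
    { Adj := fun v u => D i v u ∨ D i u v
      symm := ⟨fun v u h => h.symm⟩
      loopless := ⟨fun v h => by rcases h with h | h <;> exact G.irrefl h.1⟩ }
  refine ⟨F, fun i v c hc => ?_, fun i j hij => ?_, ?_⟩
  -- At the vertex of smallest key on a one-coloured cycle, both cycle edges leave that vertex and
  -- have the same colour, so they coincide, which is impossible on a cycle. The cycle is rotated to
  -- start there, so that the two neighbours are its second and its penultimate vertex.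
  · obtain ⟨x, hx, hmin⟩ := Finset.exists_min_image c.support.toFinset key ⟨v, by simp⟩
    rw [List.mem_toFinset] at hx
    have hc' := hc.rotate hx
    set c' := c.rotate x hx with hc'_def
    have hsupp : ∀ y ∈ c'.support, key x ≤ key y := by
      intro y hy
      apply hmin
      rw [List.mem_toFinset]
      exact (c.mem_support_rotate_iff x hx).mp hy
    have key_out : ∀ y ∈ c'.support, (F i).Adj x y → D i x y := by
      rintro y hy (h | h)
      · exact h
      · exact absurd h.2.1 (not_lt.mpr (hsupp y hy))
    have h1 := key_out c'.snd (c'.getVert_mem_support 1) (c'.adj_snd hc'.not_nil)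
    have h2 := key_out c'.penultimate (c'.getVert_mem_support _)
      (c'.adj_penultimate hc'.not_nil).symm
    exact hc'.snd_ne_penultimate (hinj x ⟨h1.1, h1.2.1⟩ ⟨h2.1, h2.2.1⟩ (h1.2.2.trans h2.2.2.symm))
  · change Disjoint (F i) (F j)
    rw [SimpleGraph.disjoint_left]
    rintro v u (h | h) (h' | h')
    · exact hij (Sum.inl.inj (h.2.2.symm.trans h'.2.2))
    · exact absurd h.2.1 (not_lt.mpr h'.2.1.le)
    · exact absurd h.2.1 (not_lt.mpr h'.2.1.le)
    · exact hij (Sum.inl.inj (h.2.2.symm.trans h'.2.2))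
  · ext v u
    rw [SimpleGraph.iSup_adj]
    constructor
    · rintro ⟨i, h | h⟩
      · exact h.1
      · exact h.1.symm
    · intro h
      rcases lt_or_gt_of_ne (fun hne => h.ne (hkey hne)) with hlt | hlt
      · obtain ⟨i, hi⟩ := hf v u ⟨h, hlt⟩
        exact ⟨i, Or.inl ⟨h, hlt, hi⟩⟩
      · obtain ⟨i, hi⟩ := hf u v ⟨h.symm, hlt⟩
        exact ⟨i, Or.inr ⟨h.symm, hlt, hi⟩⟩

/-- The infimum of the empty set of naturals is 0, so this is needed to know that `arboricity` is
attained by an actual partition. -/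
theorem exists_hasForestPartition [Fintype V] : ∃ k, HasForestPartition G k := by
  classical
  refine ⟨Fintype.card V, hasForestPartition_of_order
    (key := fun v => (Fintype.equivFin V v : ℕ)) (fun a b h => ?_) fun v => ?_⟩
  · exact (Fintype.equivFin V).injective (Fin.ext h)
  · refine (Set.ncard_le_ncard (Set.subset_univ _)).trans_eq ?_
    rw [Set.ncard_univ, Nat.card_eq_fintype_card]

/-- The easy half of the Nash-Williams theorem: each of the at most `a` forests contributes at most
`2 * |S|` ordered pairs. This is the only way in which small arboricity is used. -/
theorem adjPairs_le_of_arboricity_le [Fintype V] {a : ℕ} (hH : arboricity H ≤ a) (S : Finset V) :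
    adjPairs H S S ≤ 2 * a * S.card := by
  classical
  have hpart : HasForestPartition H (arboricity H) := Nat.sInf_mem exists_hasForestPartition
  generalize arboricity H = k at hH hpart
  obtain ⟨F, hF, -, rfl⟩ := hpart
  have h1 : adjPairs (⨆ i, F i) S S ≤ ∑ i, adjPairs (F i) S S := by
    have : ∑ i, adjPairs (F i) S S
        = ∑ v ∈ S, ∑ u ∈ S, ∑ i, if (F i).Adj v u then (1 : ℝ) else 0 := by
      unfold adjPairs
      rw [Finset.sum_comm]
      exact Finset.sum_congr rfl fun v _ => Finset.sum_comm
    rw [this, adjPairs]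
    refine Finset.sum_le_sum fun v _ => Finset.sum_le_sum fun u _ => ?_
    split_ifs with h
    · obtain ⟨i, hi⟩ := SimpleGraph.iSup_adj.mp h
      calc (1 : ℝ) = if (F i).Adj v u then 1 else 0 := by rw [if_pos hi]
        _ ≤ _ := Finset.single_le_sum (f := fun i => if (F i).Adj v u then (1 : ℝ) else 0)
            (fun j _ => by split_ifs <;> norm_num) (Finset.mem_univ i)
    · exact Finset.sum_nonneg fun j _ => by split_ifs <;> norm_num
  have h2 : ∑ i, adjPairs (F i) S S ≤ k * (2 * S.card) := by
    refine (Finset.sum_le_card_nsmul _ _ _ fun i _ => adjPairs_le_of_isAcyclic (hF i) S).trans_eq ?_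
    simp
  have h3 : (k : ℝ) ≤ a := by exact_mod_cast hH
  calc _ ≤ (k : ℝ) * (2 * S.card) := h1.trans h2
    _ ≤ a * (2 * S.card) := by gcongr
    _ = _ := by ring

end Counting

/-! ### Peeling -/

section Peeling

variable {V : Type*} {G : SimpleGraph V}

open Classical in
/-- The number of neighbours of `v` in `S`. -/
noncomputable def degInto (G : SimpleGraph V) (S : Finset V) (v : V) : ℝ :=
  ∑ u ∈ S, if G.Adj v u then 1 else 0

theorem sum_degInto {A B : Finset V} : ∑ v ∈ A, degInto G B v = adjPairs G A B := rfl

theorem degInto_nonneg {S : Finset V} {v : V} : 0 ≤ degInto G S v :=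
  Finset.sum_nonneg fun _ _ => by split_ifs <;> norm_num

theorem degInto_mono {S S' : Finset V} (h : S ⊆ S') (v : V) : degInto G S v ≤ degInto G S' v :=
  Finset.sum_le_sum_of_subset_of_nonneg h fun _ _ _ => by split_ifs <;> norm_num

variable [Fintype V]

open Classical in
/-- Starting from all vertices, keep in each round the vertices that satisfy `keep` with respect to
the set of remaining vertices. -/
noncomputable def peel (keep : Finset V → V → Prop) : ℕ → Finset V
  | 0 => Finset.univ
  | i + 1 => {v ∈ peel keep i | keep (peel keep i) v}

variable {keep : Finset V → V → Prop}

theorem mem_peel_succ {i : ℕ} {v : V} :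
    v ∈ peel keep (i + 1) ↔ v ∈ peel keep i ∧ keep (peel keep i) v := by
  simp [peel]

theorem peel_antitone : Antitone (peel keep) :=
  antitone_nat_of_succ_le fun _ _ hv => (mem_peel_succ.mp hv).1

theorem exists_of_notMem_peel {i : ℕ} {v : V} (hv : v ∉ peel keep i) :
    ∃ j < i, ¬ keep (peel keep j) v := by
  induction i with
  | zero => simp [peel] at hv
  | succ i ih =>
    by_cases h : v ∈ peel keep i
    · exact ⟨i, i.lt_succ_self, fun hk => hv (mem_peel_succ.mpr ⟨h, hk⟩)⟩
    · obtain ⟨j, hj, hk⟩ := ih h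
      exact ⟨j, hj.trans i.lt_succ_self, hk⟩

open Classical in
/-- The sum of the values of `x` at the neighbours of `v`. -/
noncomputable def nbrSum (G : SimpleGraph V) (x : V → ℝ) (v : V) : ℝ :=
  ∑ u, if G.Adj v u then x u else 0

theorem sum_degInto_univ : ∑ v, degInto G Finset.univ v = 2 * G.edgeSet.ncard := by
  rw [sum_degInto, adjPairs_univ]

/-- If `x` is nearly supported on `S`, its sum over the neighbours of `v` is the degree into `S` up
to an error proportional to the full degree. This is why heavy vertices must be exempt from the
test. -/
theorem nbrSum_le {x : V → ℝ} {S : Finset V} {δ : ℝ} (hδ : 0 ≤ δ) (hx : ∀ v, x v ≤ 1)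
    (hS : ∀ v ∉ S, x v ≤ δ) (v : V) :
    nbrSum G x v ≤ degInto G S v + δ * degInto G Finset.univ v := by
  classical
  rw [nbrSum, degInto, degInto, Finset.mul_sum, ← Finset.sum_filter_add_sum_filter_not _ (· ∈ S)]
  refine add_le_add ?_ ?_
  · rw [Finset.filter_mem_eq_inter, Finset.univ_inter]
    refine Finset.sum_le_sum fun u _ => ?_
    split_ifs
    · exact hx u
    · rfl
  · refine (Finset.sum_le_sum (g := fun u => δ * if G.Adj v u then 1 else 0) fun u hu => ?_).trans
      (Finset.sum_le_sum_of_subset_of_nonneg (Finset.filter_subset _ _) fun u _ _ => ?_)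
    · rw [Finset.mem_filter] at hu
      split_ifs
      · simpa using hS u hu.2
      · simp
    · split_ifs <;> simp [hδ]

theorem le_nbrSum {x : V → ℝ} {S : Finset V} {δ : ℝ} (hx : ∀ v, 0 ≤ x v)
    (hS : ∀ v ∈ S, δ ≤ x v) (v : V) : δ * degInto G S v ≤ nbrSum G x v := by
  classical
  rw [nbrSum, degInto, Finset.mul_sum]
  refine (Finset.sum_le_sum (g := fun u => if G.Adj v u then x u else 0) fun u hu => ?_).trans
    (Finset.sum_le_sum_of_subset_of_nonneg (Finset.subset_univ _) fun u _ _ => ?_)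
  · split_ifs
    · simpa using hS u hu
    · simp
  · split_ifs
    · exact hx u
    · rfl

/-- Peeling a graph that is close to a graph of arboricity at most `a` leaves few edges. -/
theorem sum_mul_nbrSum_le_of_close {a E j : ℕ} {m : ℝ} (ha : 1 ≤ a) (hE : 21 ≤ E)
    (hj : 4 * E ≤ 2 ^ j) (hm : m = G.edgeSet.ncard) {H : SimpleGraph V}
    (hH : arboricity H ≤ a) (hR : ((G.edgeSet \ H.edgeSet).ncard : ℝ) * (E - 1) ≤ m)
    {x : ℕ → V → ℝ} (hx0 : ∀ i v, 0 ≤ x i v) (hx1 : ∀ i v, x i v ≤ 1)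
    (hx : ∀ i v, degInto G Finset.univ v ≤ 20 * a * E → nbrSum G (x i) v ≤ 51 / 20 * a →
      x (i + 1) v ≤ 1 / (400 * E)) :
    ∑ v, x (1 + 2 * j) v * nbrSum G (x (1 + 2 * j)) v ≤ 12 * m / E := by
  classical
  have hE' : (21 : ℝ) ≤ E := by exact_mod_cast hE
  have ha' : (1 : ℝ) ≤ a := by exact_mod_cast ha
  have hm0 : 0 ≤ m := by rw [hm]; positivity
  set R : ℝ := ((G.edgeSet \ H.edgeSet).ncard : ℝ) with hRdef
  -- The constant is the bound 21/20 for E/(E - 1) when E is at least 21.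
  have hR' : R ≤ 1.05 * (m / E) := by
    rw [← mul_div_assoc, le_div_iff₀ (by positivity)]
    have : 0 ≤ R := by positivity
    nlinarith
  set t := m / E with ht
  have ht0 : 0 ≤ t := by positivity
  have htm : t * E = m := div_mul_cancel₀ _ (by positivity)
  -- The ideal peeling: its threshold 5a/2 lies below the threshold 11a/4 of the randomized test, so
  -- that a vertex dropped here fails the test with high probability even if its neighbours were
  -- tested with errors.
  set keep : Finset V → V → Prop := fun S v =>
    20 * a * E < degInto G Finset.univ v ∨ 5 * a ≤ 2 * degInto G S v with hkeep
  set A := peel keep with hA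
  have hsum : ∑ v, degInto G Finset.univ v = 2 * m := by rw [sum_degInto_univ, hm]
  -- the probability is small off the set of remaining vertices
  have hoff : ∀ i, ∀ v ∉ A i, x i v ≤ 1 / (400 * E) := by
    intro i
    induction i with
    | zero => intro v hv; simp [hA, peel] at hv
    | succ i ih =>
      intro v hv
      obtain ⟨k, hk, hnk⟩ := exists_of_notMem_peel hv
      rw [hkeep, not_or, not_lt, not_le] at hnk
      refine hx i v hnk.1 ?_
      have h1 := nbrSum_le (G := G) (x := x i) (S := A i) (δ := 1 / (400 * E)) (by positivity)
        (hx1 i) ih v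
      have h2 : degInto G (A i) v ≤ degInto G (A k) v :=
        degInto_mono (peel_antitone (Nat.lt_succ_iff.mp hk)) v
      -- The error 1/(400E) per neighbour times the degree bound 20aE gives a/20, and 5/2 + 1/20 =
      -- 51/20.
      have h3 : 1 / (400 * E) * degInto G Finset.univ v ≤ 1 / 20 * a := by
        rw [one_div, inv_mul_le_iff₀ (by positivity)]
        linarith [hnk.1]
      linarith [hnk.2]
  -- few vertices are heavy
  set W : Finset V := {v | 20 * (a : ℝ) * E < degInto G Finset.univ v} with hW
  have hWcard : a * (W.card : ℝ) ≤ t / 10 := by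
    have h1 : W.card * (20 * a * E : ℝ) ≤ 2 * m := by
      rw [← hsum]
      calc W.card * (20 * a * E : ℝ) = ∑ v ∈ W, (20 * a * E : ℝ) := by simp
        _ ≤ ∑ v ∈ W, degInto G Finset.univ v :=
          Finset.sum_le_sum fun v hv => (Finset.mem_filter.mp hv).2.le
        _ ≤ _ := Finset.sum_le_sum_of_subset_of_nonneg (Finset.subset_univ _)
          fun _ _ _ => degInto_nonneg
    rw [ht, div_div, le_div_iff₀ (by positivity)]
    linarith
  -- the first round
  have hfirst : a * ((A 1).card : ℝ) ≤ 4 / 5 * m := by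
    have h1 : ((A 1).card : ℝ) * (5 / 2 * a) ≤ 2 * m := by
      rw [← hsum]
      calc ((A 1).card : ℝ) * (5 / 2 * a) = ∑ v ∈ A 1, (5 / 2 * a : ℝ) := by simp
        _ ≤ ∑ v ∈ A 1, degInto G Finset.univ v := by
          refine Finset.sum_le_sum fun v hv => ?_
          obtain ⟨-, h | h⟩ := mem_peel_succ.mp hv
          · have : (5 / 2 * a : ℝ) ≤ 20 * a * E := by nlinarith
            linarith
          · have : degInto G (A 0) v ≤ degInto G Finset.univ v :=
              degInto_mono (Finset.subset_univ _) v
            linarith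
        _ ≤ _ := Finset.sum_le_sum_of_subset_of_nonneg (Finset.subset_univ _)
          fun _ _ _ => degInto_nonneg
    linarith
  -- the later rounds
  have hround : ∀ i, a * ((A (i + 1)).card : ℝ) ≤ 2 / 3 * (a * ((A i).card : ℝ) + 2.35 * t) := by
    intro i
    have hsub : A (i + 1) ⊆ A i := peel_antitone (Nat.le_succ i)
    have h1 : 5 * a * (((A (i + 1)).card : ℝ) - W.card) ≤ 2 * adjPairs G (A (i + 1)) (A i) := by
      have h2 : ((A (i + 1)).card : ℝ) ≤ (A (i + 1) \ W).card + W.card := by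
        exact_mod_cast (Finset.card_le_card_sdiff_add_card (s := A (i + 1)) (t := W))
      calc 5 * a * (((A (i + 1)).card : ℝ) - W.card) ≤ 5 * a * ((A (i + 1) \ W).card : ℝ) := by
            gcongr
            linarith
        _ = ∑ v ∈ A (i + 1) \ W, (5 * a : ℝ) := by simp; ring
        _ ≤ ∑ v ∈ A (i + 1) \ W, 2 * degInto G (A i) v := by
          refine Finset.sum_le_sum fun v hv => ?_
          rw [Finset.mem_sdiff] at hv
          obtain ⟨-, h | h⟩ := mem_peel_succ.mp hv.1
          · exact absurd (Finset.mem_filter.mpr ⟨Finset.mem_univ v, h⟩) hv.2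
          · exact h
        _ ≤ ∑ v ∈ A (i + 1), 2 * degInto G (A i) v :=
          Finset.sum_le_sum_of_subset_of_nonneg Finset.sdiff_subset
            fun _ _ _ => mul_nonneg zero_le_two degInto_nonneg
        _ = _ := by rw [← Finset.mul_sum, sum_degInto]
    have h3 : adjPairs G (A (i + 1)) (A i) ≤ adjPairs H (A (i + 1)) (A i) + 2 * R :=
      adjPairs_le_add_two_mul_ncard
    have h4 := two_mul_adjPairs_le (F := H) hsub
    have h5 := adjPairs_le_of_arboricity_le hH (A (i + 1))
    have h6 := adjPairs_le_of_arboricity_le hH (A i)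
    -- Together: 5a(|A'| - |W|) ≤ 2a|A'| + 2a|A| + 4R. With R ≤ 1.05t and a|W| ≤ t/10 this is 3a|A'|
    -- ≤ 2a|A| + 4.7t.
    linarith
  -- 4.7t is the fixed point of the recursion s ↦ (2/3)(s + 2.35t).
  have hiter : ∀ i, a * ((A (1 + i)).card : ℝ) ≤ 4.7 * t + (2 / 3) ^ i * (4 / 5 * m) := by
    intro i
    induction i with
    | zero => simpa using hfirst.trans (by linarith)
    | succ i ih =>
      have := hround (1 + i)
      rw [show 1 + (i + 1) = 1 + i + 1 by ring, pow_succ]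
      linarith
  -- Two rounds shrink by 4/9, which is less than 1/2, so `2 * j` rounds shrink by 1/(4E) and leave
  -- at most t/5 of the initial 4m/5.
  have hlast : a * ((A (1 + 2 * j)).card : ℝ) ≤ 4.9 * t := by
    refine (hiter (2 * j)).trans ?_
    have h1 : ((2 : ℝ) / 3) ^ (2 * j) ≤ (1 / 2) ^ j := by
      rw [pow_mul]
      gcongr
      norm_num
    have h2 : ((1 : ℝ) / 2) ^ j * (4 * E) ≤ 1 := by
      rw [one_div, inv_pow, inv_mul_le_iff₀ (by positivity), mul_one]
      exact_mod_cast hj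
    have h3 : ((2 : ℝ) / 3) ^ (2 * j) * m ≤ (1 / 2) ^ j * m := by gcongr
    have h4 : ((1 : ℝ) / 2) ^ j * m ≤ t / 4 := by
      rw [← htm]
      nlinarith
    linarith
  set B := A (1 + 2 * j) with hB
  -- 2 · 4.9t from the graph of small arboricity and 2 · 1.05t from the removed edges make 11.9t;
  -- the errors off `B` add t/100 below.
  have hpairs : adjPairs G B B ≤ 11.9 * t := by
    have h3 : adjPairs G B B ≤ adjPairs H B B + 2 * R := adjPairs_le_add_two_mul_ncard
    have h5 := adjPairs_le_of_arboricity_le hH B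
    linarith
  set X := x (1 + 2 * j) with hX
  have hfin : ∑ v, X v * nbrSum G X v
      ≤ adjPairs G B B + 2 * (1 / (400 * E)) * (2 * m) := by
    have h1 : ∀ v, X v * nbrSum G X v ≤ (if v ∈ B then degInto G B v else 0)
        + 2 * (1 / (400 * E)) * degInto G Finset.univ v := by
      intro v
      have h2 := nbrSum_le (G := G) (x := X) (S := B) (δ := 1 / (400 * E)) (by positivity)
        (hx1 _) (hoff _) v
      have h3 : 0 ≤ nbrSum G X v := by
        simpa using le_nbrSum (G := G) (x := X) (S := ∅) (δ := 0) (hx0 _) (by simp) v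
      have h4 : 0 ≤ degInto G Finset.univ v := degInto_nonneg
      have h5 : (0 : ℝ) ≤ 1 / (400 * E) := by positivity
      split_ifs with hv
      · have := hx1 (1 + 2 * j) v
        nlinarith [mul_nonneg h5 h4]
      · have h6 := hoff _ v hv
        have h7 : nbrSum G X v ≤ degInto G Finset.univ v := by
          simpa using nbrSum_le (G := G) (x := X) (S := Finset.univ) (δ := 0) le_rfl
            (hx1 _) (by simp) v
        have h8 : X v * nbrSum G X v ≤ 1 / (400 * E) * degInto G Finset.univ v :=
          mul_le_mul h6 h7 h3 h5
        nlinarith [mul_nonneg h5 h4]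
    refine (Finset.sum_le_sum fun v _ => h1 v).trans_eq ?_
    rw [Finset.sum_add_distrib, ← Finset.mul_sum, hsum, ← sum_degInto, ← Finset.sum_filter]
    simp
  have h9 : 2 * (1 / (400 * E)) * (2 * m) = t / 100 := by
    rw [ht]
    field_simp
    ring
  rw [mul_div_assoc, ← ht]
  linarith

/-- Removing the edges that are left after some rounds of peeling the vertices with at most `k`
remaining neighbours makes the arboricity at most `k`. -/
theorem exists_arboricity_le_of_peel (G : SimpleGraph V) (k l : ℕ) :
    ∃ H ≤ G, arboricity H ≤ k ∧ 2 * ((G.edgeSet \ H.edgeSet).ncard : ℝ)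
      ≤ adjPairs G (peel (fun S v => (k : ℝ) < degInto G S v) l)
        (peel (fun S v => (k : ℝ) < degInto G S v) l) := by
  classical
  set B := peel (fun S v => (k : ℝ) < degInto G S v) with hB
  let H : SimpleGraph V :=
    { Adj := fun v u => G.Adj v u ∧ ¬ (v ∈ B l ∧ u ∈ B l)
      symm := ⟨fun v u h => ⟨h.1.symm, fun h' => h.2 h'.symm⟩⟩
      loopless := ⟨fun v h => G.irrefl h.1⟩ }
  refine ⟨H, fun v u h => h.1, Nat.sInf_le ?_, ?_⟩
  -- The rank is the last round, up to `l`, in which the vertex is still present. The key orders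
  -- vertices by rank and breaks ties by an arbitrary numbering.
  · let rank : V → ℕ := fun v => Nat.findGreatest (fun i => v ∈ B i) l
    have hrank : ∀ v, v ∈ B (rank v) := fun v =>
      Nat.findGreatest_spec (P := fun i => v ∈ B i) (Nat.zero_le l) (by simp [hB, peel])
    let key : V → ℕ := fun v => Fintype.equivFin V v + Fintype.card V * rank v
    have hmod : ∀ v, key v % Fintype.card V = Fintype.equivFin V v := fun v => by
      simp only [key, Nat.add_mul_mod_self_left]
      exact Nat.mod_eq_of_lt (Fintype.equivFin V v).2
    have hdiv : ∀ v, key v / Fintype.card V = rank v := fun v => by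
      have hpos : 0 < Fintype.card V := Fintype.card_pos_iff.mpr ⟨v⟩
      simp only [key]
      rw [Nat.add_mul_div_left _ _ hpos, Nat.div_eq_of_lt (Fintype.equivFin V v).2, zero_add]
    refine hasForestPartition_of_order (key := key) (fun v u h => ?_) fun v => ?_
    · apply (Fintype.equivFin V).injective
      apply Fin.ext
      rw [← hmod, ← hmod, h]
    · have hsub : {u | H.Adj v u ∧ key v < key u} ⊆ {u | H.Adj v u ∧ u ∈ B (rank v)} := by
        rintro u ⟨h, hlt⟩
        refine ⟨h, peel_antitone (?_ : rank v ≤ rank u) (hrank u)⟩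
        rw [← hdiv, ← hdiv]
        exact Nat.div_le_div_right hlt.le
      refine (Set.ncard_le_ncard hsub).trans ?_
      -- Later neighbours of `v` are still present in round `rank v`. If `v` is dropped after that
      -- round, it has at most `k` neighbours there; if it is never dropped, they lie with `v` in
      -- the last set, inside which `H` has no edges.
      rcases (Nat.findGreatest_le l : rank v ≤ l).lt_or_eq with hlt | heq
      · have hnot : v ∉ B (rank v + 1) :=
          Nat.findGreatest_is_greatest (P := fun i => v ∈ B i) (Nat.lt_succ_self _) hlt
        have hdeg : degInto G (B (rank v)) v ≤ k := by
          by_contra hcon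
          exact hnot (mem_peel_succ.mpr ⟨hrank v, not_le.mp hcon⟩)
        have hcard : ((({u ∈ B (rank v) | G.Adj v u} : Finset V).card : ℕ) : ℝ)
            = degInto G (B (rank v)) v := by
          rw [degInto]
          simp
        rw [← hcard] at hdeg
        have hle : {u | H.Adj v u ∧ u ∈ B (rank v)}
            ⊆ (({u ∈ B (rank v) | G.Adj v u} : Finset V) : Set V) := by
          rintro u ⟨h, hu⟩
          simp [hu, h.1]
        refine (Set.ncard_le_ncard hle).trans ?_
        rw [Set.ncard_coe_finset]
        exact_mod_cast hdeg
      · have hempty : {u | H.Adj v u ∧ u ∈ B (rank v)} = ∅ := by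
          ext u
          simp only [Set.mem_ofPred_eq, Set.mem_empty_iff_false, iff_false, not_and]
          intro h hu
          exact h.2 ⟨heq ▸ hrank v, heq ▸ hu⟩
        rw [hempty]
        simp
  · rw [← SimpleGraph.edgeSet_sdiff, ← adjPairs_univ]
    unfold adjPairs
    rw [← Finset.sum_filter_add_sum_filter_not _ (· ∈ B l),
      Finset.filter_mem_eq_inter, Finset.univ_inter]
    refine (add_le_add (Finset.sum_le_sum fun v hv => ?_) (le_of_eq (Finset.sum_eq_zero
      fun v hv => Finset.sum_eq_zero fun u _ => ?_))).trans_eq (add_zero _)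
    · rw [← Finset.sum_filter_add_sum_filter_not _ (· ∈ B l),
        Finset.filter_mem_eq_inter, Finset.univ_inter]
      refine (add_le_add (Finset.sum_le_sum fun u hu => ?_) (le_of_eq (Finset.sum_eq_zero
        fun u hu => ?_))).trans_eq (add_zero _)
      · simp [H, hv, hu]
      · have hu' := (Finset.mem_filter.mp hu).2
        simp [H, hu']
    · have hv' := (Finset.mem_filter.mp hv).2
      simp [H, hv']

/-- On the ideal set peeled at `3 * a` every value stays at least 39/40: a vertex with more than `3
* a` remaining neighbours has neighbour sum at least 117a/40. By farness at least 20m/E edges remain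
inside the set, that is 40m/E ordered pairs, and (39/40)² · 40 exceeds 38. -/
theorem le_sum_mul_nbrSum_of_far {a E l : ℕ} {m : ℝ} (hE : 21 ≤ E)
    (hfar : ∀ H ≤ G, arboricity H ≤ 3 * a →
      20 * m ≤ ((G.edgeSet \ H.edgeSet).ncard : ℝ) * E)
    {x : ℕ → V → ℝ} (hx0 : ∀ i v, 0 ≤ x i v) (hstart : ∀ v, x 0 v = 1)
    (hx : ∀ i v, 117 / 40 * a ≤ nbrSum G (x i) v → 39 / 40 ≤ x (i + 1) v) :
    38 * m / E ≤ ∑ v, x l v * nbrSum G (x l) v := by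
  classical
  have hE' : (21 : ℝ) ≤ E := by exact_mod_cast hE
  obtain ⟨H, hHG, hH, hR⟩ := exists_arboricity_le_of_peel G (3 * a) l
  set B := peel (fun S v => ((3 * a : ℕ) : ℝ) < degInto G S v) with hB
  have hon : ∀ i, ∀ v ∈ B i, 39 / 40 ≤ x i v := by
    intro i
    induction i with
    | zero => intro v _; rw [hstart]; norm_num
    | succ i ih =>
      intro v hv
      obtain ⟨-, hk⟩ := mem_peel_succ.mp hv
      refine hx i v ?_
      have := le_nbrSum (G := G) (hx0 i) ih v
      rw [← hB] at hk
      push_cast at hk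
      linarith
  have hlow : 39 / 40 * (39 / 40) * adjPairs G (B l) (B l) ≤ ∑ v, x l v * nbrSum G (x l) v := by
    rw [← sum_degInto, Finset.mul_sum]
    refine (Finset.sum_le_sum (g := fun v => x l v * nbrSum G (x l) v) fun v hv => ?_).trans
      (Finset.sum_le_sum_of_subset_of_nonneg (Finset.subset_univ _) fun v _ _ => ?_)
    · have h1 := le_nbrSum (G := G) (hx0 l) (hon l) v
      have h2 := hon l v hv
      have h3 : 0 ≤ degInto G (B l) v := degInto_nonneg
      calc 39 / 40 * (39 / 40) * degInto G (B l) v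
          = 39 / 40 * (39 / 40 * degInto G (B l) v) := by ring
        _ ≤ x l v * nbrSum G (x l) v := mul_le_mul h2 h1 (by positivity) (hx0 l v)
    · refine mul_nonneg (hx0 l v) ?_
      simpa using le_nbrSum (G := G) (x := x l) (S := ∅) (δ := 0) (hx0 l) (by simp) v
  have h1 := hfar H hHG hH
  rw [div_le_iff₀ (by positivity)]
  have h2 : 40 * m ≤ adjPairs G (B l) (B l) * E := by nlinarith
  have h3 : 39 / 40 * (39 / 40) * adjPairs G (B l) (B l) * E
      ≤ (∑ v, x l v * nbrSum G (x l) v) * E := by gcongr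
  have h4 : 0 ≤ adjPairs G (B l) (B l) * E := mul_nonneg adjPairs_nonneg (by positivity)
  linarith

end Peeling

/-! ### Evaluation of expressions without overflow -/

section Eval

variable {w : ℕ} {s : Store} {a b : Expr} {x y : ℕ}

@[simp]
theorem setReg_reg (s : Store) (x v y : ℕ) :
    (s.setReg x v).reg y = if y = x then v else s.reg y := by
  simp [Store.setReg, Function.update_apply]

@[simp]
theorem setReg_mem (s : Store) (x v : ℕ) : (s.setReg x v).mem = s.mem := rfl

@[simp]
theorem setMem_mem (s : Store) (x v y : ℕ) :
    (s.setMem x v).mem y = if y = x then v else s.mem y := by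
  simp [Store.setMem, Function.update_apply]

@[simp]
theorem setMem_reg (s : Store) (x v : ℕ) : (s.setMem x v).reg = s.reg := rfl

theorem eval_const {c : ℕ} (h : c < 2 ^ w) : (Expr.const c).eval w s = c :=
  Nat.mod_eq_of_lt h

theorem eval_reg {i : ℕ} (h : s.reg i = x) : (Expr.reg i).eval w s = x := h

theorem eval_mem (ha : a.eval w s = x) (h : s.mem x = y) : (Expr.mem a).eval w s = y := by
  rw [Expr.eval, ha, h]

theorem eval_add (ha : a.eval w s = x) (hb : b.eval w s = y) (h : x + y < 2 ^ w) :
    (Expr.op .add a b).eval w s = x + y := by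
  rw [Expr.eval, ha, hb]
  exact Nat.mod_eq_of_lt h

theorem eval_mul (ha : a.eval w s = x) (hb : b.eval w s = y) (h : x * y < 2 ^ w) :
    (Expr.op .mul a b).eval w s = x * y := by
  rw [Expr.eval, ha, hb]
  exact Nat.mod_eq_of_lt h

theorem eval_sub (ha : a.eval w s = x) (hb : b.eval w s = y) (h : x < 2 ^ w) :
    (Expr.op .sub a b).eval w s = x - y := by
  rw [Expr.eval, ha, hb]
  exact Nat.mod_eq_of_lt (lt_of_le_of_lt (Nat.sub_le x y) h)

theorem eval_div (ha : a.eval w s = x) (hb : b.eval w s = y) (h : x < 2 ^ w) :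
    (Expr.op .div a b).eval w s = x / y := by
  rw [Expr.eval, ha, hb]
  exact Nat.mod_eq_of_lt (lt_of_le_of_lt (Nat.div_le_self x y) h)

theorem eval_lt (ha : a.eval w s = x) (hb : b.eval w s = y) (h : 1 < 2 ^ w) :
    (Expr.op .lt a b).eval w s = if x < y then 1 else 0 := by
  rw [Expr.eval, ha, hb]
  refine Nat.mod_eq_of_lt ?_
  rw [Op.eval]
  split_ifs <;> omega

theorem eval_eq (ha : a.eval w s = x) (hb : b.eval w s = y) (h : 1 < 2 ^ w) :
    (Expr.op .eq a b).eval w s = if x = y then 1 else 0 := by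
  rw [Expr.eval, ha, hb]
  refine Nat.mod_eq_of_lt ?_
  rw [Op.eval]
  split_ifs <;> omega

end Eval

/-! ### Queries -/

section Queries

variable {n : ℕ} {G : SimpleGraph (Fin n)} (L : AdjList G)

/-- The degree of a vertex. -/
def AdjList.deg (v : Fin n) : ℕ := (L.list v).length

/-- The neighbour of `v` at position `r` (counted from `0`). -/
def AdjList.nbr (v : Fin n) (r : ℕ) : Fin n := (L.list v).getD r v

variable {L}

theorem degreeQuery_eq (v : Fin n) : L.degreeQuery v = L.deg v := by
  simp [AdjList.degreeQuery, AdjList.deg]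

theorem neighborQuery_eq {v : Fin n} {r : ℕ} (hr : r < L.deg v) :
    L.neighborQuery v (r + 1) = L.nbr v r := by
  simp only [AdjList.neighborQuery, Fin.is_lt, dif_pos, Nat.le_add_left, if_true,
    Nat.add_sub_cancel, AdjList.nbr, List.getD]
  rw [List.getElem?_eq_getElem hr]
  simp

theorem adj_nbr {v : Fin n} {r : ℕ} (hr : r < L.deg v) : G.Adj v (L.nbr v r) := by
  rw [← L.mem_iff, AdjList.nbr, List.getD_eq_getElem _ _ hr]
  exact List.getElem_mem hr

/-- Adjacency lists have no repetitions, so a sum over positions, as the machine samples them, is a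
sum over neighbours. -/
theorem sum_range_nbr {M : Type*} [AddCommMonoid M] [DecidableRel G.Adj] (v : Fin n)
    (f : Fin n → M) :
    ∑ r ∈ Finset.range (L.deg v), f (L.nbr v r) = ∑ u, if G.Adj v u then f u else 0 := by
  classical
  have h1 : ∑ r ∈ Finset.range (L.deg v), f (L.nbr v r) = ∑ u ∈ (L.list v).toFinset, f u := by
    rw [List.sum_toFinset _ (L.nodup v), Finset.sum_range, AdjList.deg]
    rw [← List.sum_ofFn]
    congr 1
    refine List.ext_getElem (by simp) fun i h h' => ?_
    simp only [List.getElem_ofFn, List.getElem_map, AdjList.nbr]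
    rw [List.getD_eq_getElem _ _ (by simpa using h')]
  rw [h1, ← Finset.sum_filter]
  refine Finset.sum_congr ?_ fun _ _ => rfl
  ext u
  simp [L.mem_iff]

theorem deg_eq_degInto (v : Fin n) : (L.deg v : ℝ) = degInto G Finset.univ v := by
  classical
  have := sum_range_nbr (L := L) v (fun _ => (1 : ℝ))
  simp only [Finset.sum_const, Finset.card_range, nsmul_eq_mul, mul_one] at this
  rw [this, degInto]

theorem deg_lt (v : Fin n) : L.deg v < n := by
  have h : (v :: L.list v).Nodup :=
    List.nodup_cons.mpr ⟨fun h => G.irrefl ((L.mem_iff v v).mp h), L.nodup v⟩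
  have := h.length_le_card
  rw [Fintype.card_fin] at this
  exact this

theorem deg_pos_of_adj {v u : Fin n} (h : G.Adj v u) : 0 < L.deg v :=
  List.length_pos_of_mem ((L.mem_iff v u).mpr h)

end Queries

/-! ### The vertex test

`passProb i v` is the probability that the test with `i` rounds, which estimates whether `v`
survives `i` rounds of peeling, has a positive result. The program keeps a stack: the frame of a
vertex for which `h` rounds remain occupies the memory cells `3 * h` (the vertex), `3 * h + 1` (the
number of neighbours still to be sampled) and `3 * h + 2` (the number of sampled neighbours with a
positive result). Register `20` holds `h`, register `21` the vertex to be tested. -/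

section VertexTest

variable {n : ℕ} {G : SimpleGraph (Fin n)}

/-- The distribution of the result of the test of a random neighbour. -/
noncomputable def nbrAvg (L : AdjList G) (ν : Fin n → Bool → ℝ≥0) (v : Fin n) : Bool → ℝ≥0 :=
  fun o => ∑ r ∈ Finset.range (L.deg v), (L.deg v : ℝ≥0)⁻¹ * ν (L.nbr v r) o

/-- The value of a positive result. -/
def bit (o : Bool) : ℤ := if o then 1 else 0

/-- The distribution of the result of the test. -/
noncomputable def passProb (L : AdjList G) (α E S : ℕ) : ℕ → Fin n → Bool → ℝ≥0
  | 0, _ => dirac true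
  | i + 1, v =>
    if 20 * α * E < L.deg v then dirac true
    else fun o => iterExp (nbrAvg L (passProb L α E S i) v) bit
      (fun z => dirac (decide ((11 * α * S : ℕ) ≤ 4 * z * L.deg v)) o) S 0

/-- The address of a cell of the current frame. -/
def frameAddr (k : ℕ) : Expr := .op .add (.op .mul (.const 3) (.reg 20)) (.const k)

/-- Begin the test of the vertex in register `21`. -/
def callVertex : Cmd :=
  .seq (.degree 22 (.reg 21)) <|
  .cond (.op .add (.op .eq (.reg 20) (.const 0))
      (.op .lt (.op .mul (.op .mul (.const 20) (.reg 1)) (.reg 4)) (.reg 22)))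
    (.seq (.assign 20 (.op .add (.reg 20) (.const 1)))
      (.store (frameAddr 2) (.op .add (.mem (frameAddr 2)) (.const 1))))
    (.seq (.store (frameAddr 0) (.reg 21)) <|
      .seq (.store (frameAddr 1) (.reg 5)) <|
      .store (frameAddr 2) (.const 0))

/-- Sample one more neighbour for the current frame, or leave it if it is complete. -/
def frameStep : Cmd :=
  .cond (.mem (frameAddr 1))
    (.seq (.store (frameAddr 1) (.op .sub (.mem (frameAddr 1)) (.const 1))) <|
      .seq (.assign 21 (.mem (frameAddr 0))) <|
      .seq (.degree 22 (.reg 21)) <|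
      .seq (.rand 23 (.reg 22)) <|
      .seq (.neighbor 21 (.reg 21) (.op .add (.reg 23) (.const 1))) <|
      .seq (.assign 20 (.op .sub (.reg 20) (.const 1)))
      callVertex)
    (.seq (.degree 22 (.mem (frameAddr 0))) <|
      .seq (.assign 22 (.op .lt (.op .mul (.op .mul (.const 4) (.mem (frameAddr 2))) (.reg 22))
        (.op .mul (.op .mul (.const 11) (.reg 1)) (.reg 5)))) <|
      .seq (.assign 20 (.op .add (.reg 20) (.const 1))) <|
      .store (frameAddr 2) (.op .add (.mem (frameAddr 2)) (.op .sub (.const 1) (.reg 22))))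

/-- Work until the stack is empty. -/
def testLoop : Cmd := .loop (.op .lt (.reg 20) (.op .add (.reg 7) (.const 1))) frameStep

/-- A bound for the expected time of the test with `i` rounds. -/
def testTime (S : ℕ) : ℕ → ℕ
  | 0 => 100
  | i + 1 => 100 + S * (100 + testTime S i)

/-- The numbers in the vertex test are smaller than `2 ^ w`. -/
structure TestFits (w n α E S l : ℕ) : Prop where
  eps_pos : 0 < E
  samples_pos : 0 < S
  heavy : 20 * α * E < 2 ^ w
  count : 4 * S * n < 2 ^ w
  thresh : 11 * α * S < 2 ^ w
  addr : 3 * l + 8 < 2 ^ w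
  size : n + 100 < 2 ^ w

/-- The registers hold the parameters of the vertex test. -/
structure TestRegs (α E S l : ℕ) (s : Store) : Prop where
  alpha : s.reg 1 = α
  eps : s.reg 4 = E
  samples : s.reg 5 = S
  rounds : s.reg 7 = l

theorem TestRegs.congr {α E S l : ℕ} {s s' : Store} (h : TestRegs α E S l s)
    (hs : ∀ x < 20, s'.reg x = s.reg x) : TestRegs α E S l s' :=
  ⟨(hs 1 (by norm_num)).trans h.alpha, (hs 4 (by norm_num)).trans h.eps,
    (hs 5 (by norm_num)).trans h.samples, (hs 7 (by norm_num)).trans h.rounds⟩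

variable {L : AdjList G} {w α E S l : ℕ}

theorem dirac_true_add_dirac_false (b : Bool) : dirac b true + dirac b false = 1 := by
  cases b <;> simp [dirac]

theorem sum_bool_nbrAvg {ν : Fin n → Bool → ℝ≥0} {v : Fin n} (hv : 0 < L.deg v)
    (hν : ∀ u, 0 < L.deg u → ∑ o, ν u o = 1) : ∑ o, nbrAvg L ν v o = 1 := by
  simp only [nbrAvg]
  rw [Finset.sum_comm]
  have : ∀ r ∈ Finset.range (L.deg v), ∑ o, (L.deg v : ℝ≥0)⁻¹ * ν (L.nbr v r) o
      = (L.deg v : ℝ≥0)⁻¹ := by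
    intro r hr
    rw [← Finset.mul_sum, hν _ (deg_pos_of_adj (adj_nbr (Finset.mem_range.mp hr)).symm), mul_one]
  rw [Finset.sum_congr rfl this]
  have hv' : (L.deg v : ℝ≥0) ≠ 0 := by positivity
  simp [hv']

/-- For an isolated vertex the average over neighbours is an empty sum, and the values need not add
up to 1. The recursion only visits neighbours of vertices, which are never isolated. -/
theorem sum_passProb (i : ℕ) (v : Fin n) (hv : 0 < L.deg v) :
    ∑ o, passProb L α E S i v o = 1 := by
  induction i generalizing v with
  | zero => simp [passProb, dirac]
  | succ i ih =>
    rw [passProb]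
    split_ifs
    · simp [dirac]
    · rw [Fintype.sum_bool]
      refine iterExp_add_eq_one (sum_bool_nbrAvg hv ih) (fun z => ?_) _ _
      exact dirac_true_add_dirac_false _

theorem eval_frameAddr {s : Store} {h k : ℕ} (hf : TestFits w n α E S l) (hs : s.reg 20 = h)
    (hh : h ≤ l + 1) (hk : k ≤ 2) : (frameAddr k).eval w s = 3 * h + k := by
  have := hf.addr
  exact eval_add (eval_mul (eval_const (by omega)) (eval_reg hs) (by omega))
    (eval_const (by omega)) (by omega)

/-- What the test of a vertex with `i` rounds does to the store. -/
def TestPost (s : Store) (i c : ℕ) (o : Bool) (s' : Store) : Prop :=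
  s'.reg 20 = i + 1 ∧ (∀ x < 20, s'.reg x = s.reg x) ∧
    (∀ a, 3 * (i + 1) ≤ a → a ≠ 3 * (i + 1) + 2 → s'.mem a = s.mem a) ∧
    (s'.mem (3 * (i + 1) + 2) : ℤ) = c + bit o

theorem eval_callVertex_cond {s : Store} {i d : ℕ} (hf : TestFits w n α E S l)
    (hr : TestRegs α E S l s) (h20 : s.reg 20 = i) (h22 : s.reg 22 = d) :
    (Expr.op .add (.op .eq (.reg 20) (.const 0))
      (.op .lt (.op .mul (.op .mul (.const 20) (.reg 1)) (.reg 4)) (.reg 22))).eval w s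
      = (if i = 0 then 1 else 0) + (if 20 * α * E < d then 1 else 0) := by
  have h5 := hf.size
  have hE := hf.heavy
  refine eval_add (eval_eq (eval_reg h20) (eval_const (by omega)) (by omega))
    (eval_lt (eval_mul (eval_mul (eval_const (by omega)) (eval_reg hr.alpha) ?_)
      (eval_reg hr.eps) hE) (eval_reg h22) (by omega)) ?_
  · exact lt_of_le_of_lt (Nat.le_mul_of_pos_right _ hf.eps_pos) hE
  · split_ifs <;> omega

/-- With no rounds left, or at a heavy vertex, the result is positive without sampling: no frame is
created, and the counter of the parent frame `i + 1` is increased at once. -/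
theorem reach_callVertex_leaf (hf : TestFits w n α E S l) (l' : List Cmd) {i : ℕ} (hi : i ≤ l)
    {u : Fin n} {s : Store} {c : ℕ} (hr : TestRegs α E S l s)
    (h20 : s.reg 20 = i) (h21 : s.reg 21 = u) (hc : s.mem (3 * (i + 1) + 2) = c)
    (hc' : c + 1 < 2 ^ w) (hleaf : i = 0 ∨ 20 * α * E < L.deg u) :
    Reach w L (callVertex :: l') l' s (dirac true) (TestPost s i c) 40 := by
  have h5 := hf.size
  have ha := hf.addr
  refine (Reach.seq <| Reach.degree (v := L.deg u) ?_ <| Reach.cond_true ?_ <| Reach.seq <|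
    Reach.assign (v := i + 1) ?_ <| Reach.store (i := 3 * (i + 1) + 2) (v := c + 1) ?_ ?_ <|
    Reach.refl true ?_).le ?_
  · rw [eval_reg h21, degreeQuery_eq]
  · rw [eval_callVertex_cond (i := i) (d := L.deg u) hf ⟨by simp [hr.alpha], by simp [hr.eps],
      by simp [hr.samples], by simp [hr.rounds]⟩ (by simp [h20]) (by simp)]
    rcases hleaf with h | h <;> simp [h]
  · exact eval_add (eval_reg (by simp [h20])) (eval_const (by omega)) (by omega)
  · exact eval_frameAddr hf (by simp) (by omega) le_rfl
  · exact eval_add (eval_mem (eval_frameAddr (h := i + 1) hf (by simp) (by omega) le_rfl)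
      (by simpa using hc)) (eval_const (by omega)) hc'
  · refine ⟨by simp, fun x hx => ?_, fun a _ h => by simp [h], by simp [bit]⟩
    simp [show x ≠ 20 by omega, show x ≠ 22 by omega]
  · norm_num [Expr.cost, frameAddr]

/-- The frame of the vertex `u`, with `r` neighbours still to be sampled and `z` positive results.
-/
def FrameInv (S : ℕ) (s : Store) (i : ℕ) (u : Fin n) (r : ℕ) (z : ℤ) (s' : Store) : Prop :=
  s'.reg 20 = i + 1 ∧ (∀ x < 20, s'.reg x = s.reg x) ∧
    (∀ a, 3 * (i + 2) ≤ a → s'.mem a = s.mem a) ∧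
    s'.mem (3 * (i + 1)) = u ∧ s'.mem (3 * (i + 1) + 1) = r ∧
    (s'.mem (3 * (i + 1) + 2) : ℤ) = z ∧ z + r ≤ S

theorem eval_testLoop_cond {s : Store} {h : ℕ} (hf : TestFits w n α E S l)
    (hr : TestRegs α E S l s) (h20 : s.reg 20 = h) :
    (Expr.op .lt (.reg 20) (.op .add (.reg 7) (.const 1))).eval w s
      = if h < l + 1 then 1 else 0 := by
  have h5 := hf.size
  have ha := hf.addr
  exact eval_lt (eval_reg h20) (eval_add (eval_reg hr.rounds) (eval_const (by omega)) (by omega))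
    (by omega)

/-- The recursion of `passProb` is executed by one loop over an explicit stack, so both command
lists go on with the same `testLoop`. A test with `i` rounds ends when level `i + 1` is reached
again; it has added its result to the counter of frame `i + 1` and has left the other cells from
that frame upwards untouched. In this form the induction hypothesis is a single trial for the parent
frame, and `Reach.iterate` repeats it `S` times. -/
theorem reach_callVertex (hf : TestFits w n α E S l) (k : List Cmd) (i : ℕ)
    (hi : i ≤ l) (u : Fin n) (hu : 0 < L.deg u) (s : Store) (c : ℕ) (hr : TestRegs α E S l s)
    (h20 : s.reg 20 = i) (h21 : s.reg 21 = u) (hc : s.mem (3 * (i + 1) + 2) = c)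
    (hc' : c + 1 < 2 ^ w) :
    Reach w L (callVertex :: testLoop :: k) (testLoop :: k) s (passProb L α E S i u)
      (TestPost s i c) (testTime S i) := by
  have h5 := hf.size
  have ha := hf.addr
  induction i generalizing u s c with
  | zero =>
    exact (reach_callVertex_leaf hf _ hi hr h20 h21 hc hc' (Or.inl rfl)).le
      (by norm_num [testTime])
  | succ i ih =>
    by_cases hheavy : 20 * α * E < L.deg u
    · rw [passProb, if_pos hheavy]
      refine (reach_callVertex_leaf hf _ hi hr h20 h21 hc hc' (Or.inr hheavy)).le ?_
      rw [testTime]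
      push_cast
      exact le_add_right (by norm_num)
    have hn : L.deg u < n := deg_lt u
    have hS2 : S < 2 ^ w := by
      have := hf.count
      nlinarith
    rw [passProb, if_neg hheavy]
    have hstep : ∀ r z s', FrameInv S s i u (r + 1) z s' →
        Reach w L (testLoop :: k) (testLoop :: k) s' (nbrAvg L (passProb L α E S i) u)
          (fun o => FrameInv S s i u r (z + bit o)) (100 + testTime S i) := by
      rintro r z s' ⟨g20, gr, gm, gv, grem, gz, gle⟩
      have hr' := hr.congr gr
      have hzc := Nat.cast_nonneg (α := ℤ) (s'.mem (3 * (i + 1) + 2))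
      have hrS : r + 1 ≤ S := by omega
      refine (Reach.loop_true ?_ <| Reach.cond_true ?_ <| Reach.seq <|
        Reach.store (i := 3 * (i + 1) + 1) (v := r) ?_ ?_ <| Reach.seq <|
        Reach.assign (v := u) ?_ <| Reach.seq <| Reach.degree (v := L.deg u) ?_ <| Reach.seq <|
        Reach.rand_const (N := L.deg u) ?_ hu (μ := fun r => passProb L α E S i (L.nbr u r))
          (T := 20 + testTime S i) fun q hq => ?_).le ?_
      · rw [eval_testLoop_cond hf hr' g20, if_pos (by omega)]
        exact one_ne_zero
      · rw [eval_mem (eval_frameAddr hf g20 (by omega) (by omega)) grem]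
        omega
      · exact eval_frameAddr hf g20 (by omega) (by omega)
      · exact eval_sub (eval_mem (eval_frameAddr hf g20 (by omega) (by omega)) grem)
          (eval_const (by omega)) (by omega)
      · exact eval_mem (eval_frameAddr hf (h := i + 1) (by simpa using g20) (by omega) (by omega))
          (by simp [gv])
      · rw [eval_reg (x := u) (by simp), degreeQuery_eq]
      · exact eval_reg (by simp)
      · have hadj : G.Adj u (L.nbr u q) := adj_nbr hq
        have hcur : s'.mem (3 * (i + 1) + 2) + 1 < 2 ^ w := by omega
        refine (Reach.seq <| Reach.neighbor (v := L.nbr u q) ?_ <| Reach.seq <|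
          Reach.assign (v := i) ?_ <|
          (ih (by omega) (L.nbr u q) (deg_pos_of_adj hadj.symm) _ (s'.mem (3 * (i + 1) + 2))
            (hr'.congr ?_) ?_ ?_ ?_ hcur).mono (fun _ => rfl) ?_ le_rfl).le ?_
        · rw [eval_reg (x := u) (by simp), eval_add (x := q) (y := 1) (eval_reg (by simp))
            (eval_const (by omega)) (by omega), neighborQuery_eq hq]
        · exact eval_sub (eval_reg (x := i + 1) (by simpa using g20)) (eval_const (by omega))
            (by omega)
        · intro x hx
          simp [show x ≠ 20 by omega, show x ≠ 21 by omega, show x ≠ 22 by omega,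
            show x ≠ 23 by omega]
        · simp
        · simp
        · simp
        · rintro o s'' ⟨p20, pr, pm, pc⟩
          refine ⟨p20, fun x hx => ?_, fun a ha => ?_, ?_, ?_, ?_, ?_⟩
          · rw [pr x hx, ← gr x hx]
            simp [show x ≠ 20 by omega, show x ≠ 21 by omega, show x ≠ 22 by omega,
              show x ≠ 23 by omega]
          · rw [pm a (by omega) (by omega), ← gm a ha]
            simp [show a ≠ 3 * (i + 1) + 1 by omega]
          · rw [pm _ (by omega) (by omega)]
            simp [gv]
          · rw [pm _ (by omega) (by omega)]
            simp
          · rw [pc, gz]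
          · have : bit o ≤ 1 := by cases o <;> simp [bit]
            push_cast at gle
            omega
        · simp only [Expr.cost]
          exact_mod_cast (by omega)
      · simp only [Expr.cost, frameAddr]
        exact_mod_cast (by omega)
    have hexit : ∀ z s', FrameInv S s i u 0 z s' →
        Reach w L (testLoop :: k) (testLoop :: k) s'
          (fun o => dirac (decide ((11 * α * S : ℕ) ≤ 4 * z * L.deg u)) o)
          (TestPost s (i + 1) c) 60 := by
      rintro z s' ⟨g20, gr, gm, gv, grem, gz, gle⟩
      have hr' := hr.congr gr
      obtain ⟨y, hy⟩ : ∃ y : ℕ, s'.mem (3 * (i + 1) + 2) = y := ⟨_, rfl⟩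
      rw [hy] at gz
      have hyS : y ≤ S := by omega
      have hcnt : 4 * y * L.deg u < 2 ^ w :=
        lt_of_le_of_lt (Nat.mul_le_mul (Nat.mul_le_mul_left 4 hyS) hn.le) hf.count
      -- The machine tests the strict opposite inequality on naturals and subtracts the result from
      -- 1.
      have hbit : 1 - (if 4 * y * L.deg u < 11 * α * S then 1 else 0)
          = if decide ((11 * α * S : ℕ) ≤ 4 * z * L.deg u) = true then 1 else 0 := by
        have : ((11 * α * S : ℕ) ≤ 4 * z * L.deg u) ↔ ¬ 4 * y * L.deg u < 11 * α * S := by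
          rw [← gz, not_lt]
          exact_mod_cast Iff.rfl
        simp only [this]
        by_cases h : 4 * y * L.deg u < 11 * α * S <;> simp [h]
      generalize decide ((11 * α * S : ℕ) ≤ 4 * z * L.deg u) = o at hbit
      have hpost : 3 * (i + 1 + 1) + 2 ≠ 3 * (i + 1) := by omega
      refine (Reach.loop_true ?_ <| Reach.cond_false ?_ <| Reach.seq <|
        Reach.degree (v := L.deg u) ?_ <| Reach.seq <|
        Reach.assign (v := if 4 * y * L.deg u < 11 * α * S then 1 else 0) ?_ <| Reach.seq <|
        Reach.assign (v := i + 1 + 1) ?_ <|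
        Reach.store (i := 3 * (i + 1 + 1) + 2) (v := c + if o = true then 1 else 0) ?_ ?_ <|
        Reach.refl o ?_).le ?_
      · rw [eval_testLoop_cond hf hr' g20, if_pos (by omega)]
        exact one_ne_zero
      · rw [eval_mem (eval_frameAddr hf g20 (by omega) (by omega)) grem]
      · rw [eval_mem (eval_frameAddr hf g20 (by omega) (by omega)) gv, degreeQuery_eq]
      · refine eval_lt (eval_mul (eval_mul (eval_const (by omega)) (eval_mem (eval_frameAddr hf
          (by simpa using g20) (by omega) le_rfl) (by simpa using hy)) ?_) (eval_reg (by simp)) hcnt)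
          (eval_mul (eval_mul (eval_const (by omega)) (eval_reg (by simpa using hr'.alpha)) ?_)
          (eval_reg (by simpa using hr'.samples)) hf.thresh) (by omega)
        · exact lt_of_le_of_lt (Nat.le_mul_of_pos_right _ hu) hcnt
        · exact lt_of_le_of_lt (Nat.le_mul_of_pos_right _ hf.samples_pos) hf.thresh
      · exact eval_add (eval_reg (by simpa using g20)) (eval_const (by omega)) (by omega)
      · exact eval_frameAddr hf (by simp) (by omega) le_rfl
      · rw [← hbit]
        refine eval_add (eval_mem (eval_frameAddr (h := i + 1 + 1) hf (by simp) (by omega) le_rfl)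
          ?_) (eval_sub (eval_const (by omega)) (eval_reg (by simp)) (by omega)) (by omega)
        simp only [setReg_mem]
        rw [gm _ (by omega), hc]
      · refine ⟨by simp, fun x hx => ?_, fun a h1 h2 => ?_, ?_⟩
        · rw [← gr x hx]
          simp [show x ≠ 20 by omega, show x ≠ 22 by omega]
        · rw [← gm a h1]
          simp [h2]
        · cases o <;> simp [bit]
      · norm_num [Expr.cost, frameAddr]
    have hmain := Reach.iterate (y := bit) (sum_bool_nbrAvg hu fun v hv => sum_passProb i v hv)
      hstep hexit S 0
    refine (Reach.seq <| Reach.degree (v := L.deg u) ?_ <| Reach.cond_false ?_ <| Reach.seq <|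
      Reach.store (i := 3 * (i + 1) + 0) (v := u) ?_ ?_ <| Reach.seq <|
      Reach.store (i := 3 * (i + 1) + 1) (v := S) ?_ ?_ <|
      Reach.store (i := 3 * (i + 1) + 2) (v := 0) ?_ ?_ <| hmain _ ?_).le ?_
    · rw [eval_reg h21, degreeQuery_eq]
    · rw [eval_callVertex_cond (i := i + 1) (d := L.deg u) hf ⟨by simp [hr.alpha],
        by simp [hr.eps], by simp [hr.samples], by simp [hr.rounds]⟩ (by simp [h20]) (by simp)]
      simp [hheavy]
    · exact eval_frameAddr hf (by simp [h20]) (by omega) (by omega)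
    · exact eval_reg (by simp [h21])
    · exact eval_frameAddr hf (by simp [h20]) (by omega) (by omega)
    · exact eval_reg (by simp [hr.samples])
    · exact eval_frameAddr hf (by simp [h20]) (by omega) (by omega)
    · exact eval_const (by omega)
    · refine ⟨by simp [h20], fun x hx => by simp [show x ≠ 22 by omega], fun a ha => ?_, by simp,
        by simp, by simp, by simp⟩
      simp [show a ≠ 3 * (i + 1) by omega, show a ≠ 3 * (i + 1) + 1 by omega,
        show a ≠ 3 * (i + 1) + 2 by omega]
    · rw [testTime]
      simp only [Expr.cost, frameAddr]
      exact_mod_cast (by omega)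

end VertexTest

/-! ### Accuracy of one round of the vertex test -/

section PassProb

variable {n : ℕ} {G : SimpleGraph (Fin n)} {L : AdjList G} {α E S : ℕ}

/-- The probability of a positive result of the test, as a real number. -/
noncomputable def passReal (L : AdjList G) (α E S i : ℕ) (v : Fin n) : ℝ :=
  passProb L α E S i v true

/-- At least one trial is made, and it has the zero measure as its distribution. This default agrees
with the peeling, where an isolated vertex does not survive. -/
theorem passProb_succ_of_isolated (hS : 0 < S) (i : ℕ) {v : Fin n} (hv : L.deg v = 0) (o : Bool) :
    passProb L α E S (i + 1) v o = 0 := by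
  obtain ⟨S, rfl⟩ := Nat.exists_eq_succ_of_ne_zero hS.ne'
  rw [passProb, if_neg (by omega)]
  simp [iterExp, nbrAvg, hv]

theorem passReal_nonneg (i : ℕ) (v : Fin n) : 0 ≤ passReal L α E S i v := NNReal.coe_nonneg _

theorem passReal_zero (v : Fin n) : passReal L α E S 0 v = 1 := by
  simp [passReal, passProb, dirac]

theorem passReal_add {v : Fin n} (hv : 0 < L.deg v) (i : ℕ) :
    passReal L α E S i v + passProb L α E S i v false = 1 := by
  have := sum_passProb (α := α) (E := E) (S := S) i v hv
  rw [Fintype.sum_bool] at this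
  rw [passReal]
  exact_mod_cast this

theorem passReal_le_one (hS : 0 < S) (i : ℕ) (v : Fin n) : passReal L α E S i v ≤ 1 := by
  rcases Nat.eq_zero_or_pos (L.deg v) with hv | hv
  · cases i with
    | zero => rw [passReal_zero]
    | succ i => simp [passReal, passProb_succ_of_isolated hS i hv]
  · have := passReal_add (α := α) (E := E) (S := S) hv i
    have h0 : (0 : ℝ) ≤ passProb L α E S i v false := NNReal.coe_nonneg _
    linarith

theorem sum_nbrAvg_bit (v : Fin n) (i : ℕ) :
    ∑ o, (nbrAvg L (passProb L α E S i) v o : ℝ) * bit o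
      = nbrSum G (passReal L α E S i) v / L.deg v := by
  classical
  have h := sum_range_nbr (L := L) v (passReal L α E S i)
  rw [Fintype.sum_bool]
  simp only [bit, nbrAvg, if_true, Bool.false_eq_true, if_false, Int.cast_one, Int.cast_zero,
    mul_one, mul_zero, add_zero]
  push_cast
  rw [← Finset.mul_sum, nbrSum]
  change _ * ∑ r ∈ Finset.range (L.deg v), passReal L α E S i (L.nbr v r) = _
  rw [h, div_eq_inv_mul]

theorem sum_nbrAvg_bit_sq (v : Fin n) (i : ℕ) :
    ∑ o, (nbrAvg L (passProb L α E S i) v o : ℝ) * (bit o : ℝ) ^ 2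
      = nbrSum G (passReal L α E S i) v / L.deg v := by
  rw [← sum_nbrAvg_bit]
  refine Finset.sum_congr rfl fun o _ => ?_
  cases o <;> simp [bit]

theorem dirac_le_one {ι : Type} [DecidableEq ι] (o o' : ι) : dirac o o' ≤ 1 := by
  rw [dirac]
  split_ifs <;> simp

theorem dirac_ne_zero {ι : Type} [DecidableEq ι] {o o' : ι} : dirac o o' ≠ 0 ↔ o' = o := by
  rw [dirac]
  split_ifs with h <;> simp [h]

/-- The ratio is the unit in which counts of positive results are measured: a neighbour sum of c·α
corresponds to an expected count of c times it. Light vertices and S = 1000000 E² make it at least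
50000 E. -/
theorem samples_div_deg_ge (hα : 1 ≤ α) (hE : 21 ≤ E) {v : Fin n} (hv : 0 < L.deg v)
    (hlight : (L.deg v : ℝ) ≤ 20 * α * E) :
    50000 * (E : ℝ) ≤ α * (1000000 * E * E : ℕ) / L.deg v := by
  have hα' : (1 : ℝ) ≤ α := by exact_mod_cast hα
  have hE' : (21 : ℝ) ≤ E := by exact_mod_cast hE
  have hv' : (0 : ℝ) < L.deg v := by exact_mod_cast hv
  rw [le_div_iff₀ hv']
  push_cast
  have := mul_le_mul_of_nonneg_left hlight (by positivity : (0 : ℝ) ≤ 50000 * E)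
  linarith

/-- With the unit `q`, the expected count is at most 51q/20 and passing needs 11q/4, a deviation of
q/5. The variance is at most the mean, so Chebyshev gives 63.75/q, and q ≥ 50000E brings this below
1/(400E). -/
theorem passReal_succ_le (hα : 1 ≤ α) (hE : 21 ≤ E) (i : ℕ) (v : Fin n)
    (hlight : degInto G Finset.univ v ≤ 20 * α * E)
    (hsum : nbrSum G (passReal L α E (1000000 * E * E) i) v ≤ 51 / 20 * α) :
    passReal L α E (1000000 * E * E) (i + 1) v ≤ 1 / (400 * E) := by
  have hα' : (1 : ℝ) ≤ α := by exact_mod_cast hα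
  have hE' : (21 : ℝ) ≤ E := by exact_mod_cast hE
  rw [← deg_eq_degInto (L := L)] at hlight
  have hS0 : 0 < 1000000 * E * E := by positivity
  rcases Nat.eq_zero_or_pos (L.deg v) with hv | hv
  · rw [passReal, passProb_succ_of_isolated hS0 i hv]
    simp
  have hq := samples_div_deg_ge hα hE hv hlight
  have hv' : (0 : ℝ) < L.deg v := by exact_mod_cast hv
  have hlight' : ¬ 20 * α * E < L.deg v := by
    rw [not_lt]
    exact_mod_cast hlight
  set S := 1000000 * E * E with hS
  set q : ℝ := α * (S : ℕ) / L.deg v with hqdef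
  have hmean := sum_nbrAvg_bit (L := L) (α := α) (E := E) (S := S) v i
  have hvar := sum_nbrAvg_bit_sq (L := L) (α := α) (E := E) (S := S) v i
  set D := nbrSum G (passReal L α E S i) v with hD
  have hSD : (S : ℝ) * (D / L.deg v) ≤ 51 / 20 * q := by
    rw [hqdef, ← mul_div_assoc, ← mul_div_assoc, div_le_div_iff_of_pos_right hv']
    have : (0 : ℝ) ≤ S := by positivity
    nlinarith
  have hcheb := iterExp_chebyshev (p := nbrAvg L (passProb L α E S i) v) (y := bit)
    (sum_bool_nbrAvg hv fun u hu => sum_passProb i u hu)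
    (f := fun z => dirac (decide ((11 * α * S : ℕ) ≤ 4 * z * L.deg v)) true)
    (fun z => dirac_le_one _ _) (a := q / 5) S (by linarith) hmean hvar.le (fun z hz => ?_)
  · have hx : passReal L α E S (i + 1) v * (q / 5) ^ 2 ≤ 51 / 20 * q := by
      rw [passReal, passProb, if_neg hlight']
      exact hcheb.trans hSD
    have hqpos : 0 < q := by linarith
    have hx2 : passReal L α E S (i + 1) v * q ≤ 63.75 := by
      refine le_of_mul_le_mul_right ?_ hqpos
      linarith
    have hx0 := passReal_nonneg (L := L) (α := α) (E := E) (S := S) (i + 1) v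
    rw [le_div_iff₀ (by positivity)]
    nlinarith
  · have hz' := of_decide_eq_true (dirac_ne_zero.mp hz).symm
    have hz2 : (11 * α * S : ℝ) ≤ 4 * z * L.deg v := by exact_mod_cast hz'
    have hz3 : 11 / 4 * q ≤ z := by
      rw [hqdef, ← mul_div_assoc, div_le_iff₀ hv']
      linarith
    refine le_trans ?_ (le_abs_self _)
    linarith

/-- The mean `y` is at least 117q/40, and failing needs a count below 11q/4 = (110/117)(117q/40), a
deviation of more than y/20. Chebyshev bounds the failure by 400/y, which is less than 1/40. Heavy
vertices pass with certainty. -/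
theorem le_passReal_succ (hα : 1 ≤ α) (hE : 21 ≤ E) (i : ℕ) (v : Fin n)
    (hsum : 117 / 40 * α ≤ nbrSum G (passReal L α E (1000000 * E * E) i) v) :
    39 / 40 ≤ passReal L α E (1000000 * E * E) (i + 1) v := by
  have hα' : (1 : ℝ) ≤ α := by exact_mod_cast hα
  have hE' : (21 : ℝ) ≤ E := by exact_mod_cast hE
  have hS0 : 0 < 1000000 * E * E := by positivity
  by_cases hheavy : 20 * α * E < L.deg v
  · rw [passReal, passProb, if_pos hheavy]
    norm_num [dirac]
  have hlight : (L.deg v : ℝ) ≤ 20 * α * E := by exact_mod_cast not_lt.mp hheavy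
  have hle : nbrSum G (passReal L α E (1000000 * E * E) i) v ≤ L.deg v := by
    rw [deg_eq_degInto]
    simpa using nbrSum_le (G := G) (S := Finset.univ) (δ := 0) le_rfl
      (passReal_le_one (L := L) (α := α) (E := E) hS0 i) (by simp) v
  have hv : 0 < L.deg v := by
    have : (0 : ℝ) < L.deg v := by linarith
    exact_mod_cast this
  have hq := samples_div_deg_ge hα hE hv hlight
  have hv' : (0 : ℝ) < L.deg v := by exact_mod_cast hv
  set S := 1000000 * E * E with hS
  set q : ℝ := α * (S : ℕ) / L.deg v with hqdef
  have hmean := sum_nbrAvg_bit (L := L) (α := α) (E := E) (S := S) v i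
  have hvar := sum_nbrAvg_bit_sq (L := L) (α := α) (E := E) (S := S) v i
  set D := nbrSum G (passReal L α E S i) v with hD
  have hSD : 117 / 40 * q ≤ (S : ℝ) * (D / L.deg v) := by
    rw [hqdef, ← mul_div_assoc, ← mul_div_assoc, div_le_div_iff_of_pos_right hv']
    have : (0 : ℝ) ≤ S := by positivity
    nlinarith
  set y := (S : ℝ) * (D / L.deg v) with hy
  have hcheb := iterExp_chebyshev (p := nbrAvg L (passProb L α E S i) v) (y := bit)
    (sum_bool_nbrAvg hv fun u hu => sum_passProb i u hu)
    (f := fun z => dirac (decide ((11 * α * S : ℕ) ≤ 4 * z * L.deg v)) false)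
    (fun z => dirac_le_one _ _) (a := y / 20) S (by linarith) hmean hvar.le (fun z hz => ?_)
  · have hfalse : (passProb L α E S (i + 1) v false : ℝ) * (y / 20) ^ 2 ≤ y := by
      rw [passProb, if_neg hheavy]
      exact hcheb
    have hypos : 0 < y := by linarith
    have hx2 : (passProb L α E S (i + 1) v false : ℝ) * y ≤ 400 := by
      refine le_of_mul_le_mul_right ?_ hypos
      linarith
    have hx0 : (0 : ℝ) ≤ passProb L α E S (i + 1) v false := NNReal.coe_nonneg _
    have hadd := passReal_add (α := α) (E := E) (S := S) hv (i + 1)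
    have : (passProb L α E S (i + 1) v false : ℝ) ≤ 1 / 40 := by nlinarith
    linarith
  · have hz' := of_decide_eq_false (dirac_ne_zero.mp hz).symm
    have hz2 : 4 * z * L.deg v < (11 * α * S : ℝ) := by exact_mod_cast not_le.mp hz'
    have hz3 : z ≤ 11 / 4 * q := by
      rw [hqdef, ← mul_div_assoc, le_div_iff₀ hv']
      linarith
    rw [abs_sub_comm]
    refine le_trans ?_ (le_abs_self _)
    linarith

end PassProb

/-! ### Search for the square root of the number of edges

In the search, register `8` holds a guess for the square root of the number of edges. -/

section Search

variable {n : ℕ} {G : SimpleGraph (Fin n)} {L : AdjList G} {w : ℕ}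

theorem Reach.rand_fin {ι : Type} [Fintype ι] {l l' : List Cmd} {s : Store} {x N : ℕ} {e : Expr}
    {Q : ι → Store → Prop} {T : ℝ≥0} (he : e.eval w s = N) (hN : 0 < N) {μ : Fin N → ι → ℝ≥0}
    (h : ∀ r : Fin N, Reach w L l l' (s.setReg x r) (μ r) Q T) :
    Reach w L (.rand x e :: l) l' s (fun o => ∑ r, (N : ℝ≥0)⁻¹ * μ r o) Q
      ((e.cost + 1 : ℕ) + T) := by
  have := Reach.rand_const (x := x) he hN (Q := Q) (T := T)
    (μ := fun r => if h : r < N then μ ⟨r, h⟩ else 0) (l := l) (l' := l') (fun r hr => by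
      simpa [hr] using h ⟨r, hr⟩)
  refine this.mono (fun o => ?_) (fun _ _ => id) le_rfl
  rw [Finset.sum_range]
  simp

/-- The distribution of the outcome of a trial of the search: whether a random number below `θ` is
smaller than the degree of a random vertex. -/
noncomputable def hitProb (L : AdjList G) (θ : ℕ) : Bool → ℝ≥0 := fun o =>
  ∑ v, (n : ℝ≥0)⁻¹ * ∑ r ∈ Finset.range θ, (θ : ℝ≥0)⁻¹ * dirac (decide (r < L.deg v)) o

/-- The number of trials for the guess `θ`. -/
def hitTrials (n θ : ℕ) : ℕ := 2048 * (n / θ + 1)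

/-- The distribution of whether the search stops at `θ`. -/
noncomputable def stopProb (L : AdjList G) (θ : ℕ) : Bool → ℝ≥0 := fun o =>
  iterExp (hitProb L θ) bit (fun z => dirac (decide (2048 ≤ 4 * z)) o) (hitTrials n θ) 0

/-- Make the trials for the guess in register `8`, and count the hits in register `10`. -/
def countHits : Cmd :=
  .seq (.assign 10 (.const 0)) <|
  .seq (.assign 11 (.op .mul (.const 2048) (.op .add (.op .div (.reg 0) (.reg 8)) (.const 1)))) <|
  .loop (.reg 11) <|
    .seq (.assign 11 (.op .sub (.reg 11) (.const 1))) <|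
    .seq (.rand 12 (.reg 0)) <|
    .seq (.rand 13 (.reg 8)) <|
    .seq (.degree 14 (.reg 12)) <|
    .assign 10 (.op .add (.reg 10) (.op .lt (.reg 13) (.reg 14)))

theorem sum_hitProb (hn : 0 < n) {θ : ℕ} (hθ : 0 < θ) : ∑ o, hitProb L θ o = 1 := by
  have hn' : (n : ℝ≥0) ≠ 0 := by positivity
  have hθ' : (θ : ℝ≥0) ≠ 0 := by positivity
  have key : ∀ v, hitProb L θ true + hitProb L θ false = v → v = 1 := by
    rintro _ rfl
    simp only [hitProb]
    simp_rw [← Finset.sum_add_distrib, ← mul_add, ← Finset.sum_add_distrib, ← mul_add,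
      dirac_true_add_dirac_false]
    simp [hn', hθ']
  rw [Fintype.sum_bool]
  exact key _ rfl

theorem sum_stopProb (hn : 0 < n) {θ : ℕ} (hθ : 0 < θ) : ∑ o, stopProb L θ o = 1 := by
  rw [Fintype.sum_bool]
  exact iterExp_add_eq_one (sum_hitProb hn hθ) (fun z => dirac_true_add_dirac_false _) _ _

theorem reach_countHits (hw : 10000 * (n + 1) < 2 ^ w) {θ : ℕ} (hθ : 0 < θ) (hn : 0 < n)
    (l' : List Cmd) {s : Store} (h0 : s.reg 0 = n) (h8 : s.reg 8 = θ) :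
    Reach w L (countHits :: l') l' s (stopProb L θ)
      (fun o s' => (∀ x < 10, s'.reg x = s.reg x) ∧ 4 * s'.reg 10 < 2 ^ w ∧
        decide (2048 ≤ 4 * s'.reg 10) = o) (hitTrials n θ * 30 + 30) := by
  have hdiv : n / θ ≤ n := Nat.div_le_self _ _
  have htr : hitTrials n θ ≤ 2048 * (n + 1) := Nat.mul_le_mul_left _ (by omega)
  set body : Cmd := .seq (.assign 11 (.op .sub (.reg 11) (.const 1))) <|
    .seq (.rand 12 (.reg 0)) <|
    .seq (.rand 13 (.reg 8)) <|
    .seq (.degree 14 (.reg 12)) <|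
    .assign 10 (.op .add (.reg 10) (.op .lt (.reg 13) (.reg 14))) with hbody
  -- The last condition bounds the counter by the number of trials and so excludes overflow.
  let Inv : ℕ → ℤ → Store → Prop := fun r z s' =>
    (∀ x < 10, s'.reg x = s.reg x) ∧ s'.reg 11 = r ∧ (s'.reg 10 : ℤ) = z ∧
      z + r ≤ hitTrials n θ
  have hstep : ∀ r z s', Inv (r + 1) z s' →
      Reach w L (.loop (.reg 11) body :: l') (.loop (.reg 11) body :: l') s' (hitProb L θ)
        (fun o => Inv r (z + bit o)) 30 := by
    rintro r z s' ⟨gr, g11, g10, gle⟩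
    have hz : 0 ≤ z := g10 ▸ Nat.cast_nonneg _
    refine (Reach.loop_true ?_ <| Reach.seq <| Reach.assign (v := r) ?_ <| Reach.seq <|
      Reach.rand_fin (N := n) ?_ hn (T := 18) fun v => (Reach.seq <|
        Reach.rand_const (N := θ) ?_ hθ (μ := fun q => dirac (decide (q < L.deg v))) (T := 15)
          fun q hq => (Reach.seq <| Reach.degree (v := L.deg v) ?_ <|
            Reach.assign (v := s'.reg 10 + if q < L.deg v then 1 else 0) ?_ <|
            Reach.refl _ ?_).le ?_).le ?_).le ?_
    · rw [eval_reg g11]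
      exact Nat.succ_ne_zero r
    · exact eval_sub (eval_reg g11) (eval_const (by omega)) (by push_cast at gle; omega)
    · exact eval_reg (by simp [gr 0, h0])
    · exact eval_reg (by simp [gr 8, h8])
    · rw [eval_reg (x := v) (by simp), degreeQuery_eq]
    · refine eval_add (eval_reg (by simp)) (eval_lt (eval_reg (by simp)) (eval_reg (by simp))
        (by omega)) ?_
      push_cast at gle
      split_ifs <;> omega
    · refine ⟨fun x hx => ?_, by simp, ?_, ?_⟩
      · rw [← gr x hx]
        simp [show x ≠ 10 by omega, show x ≠ 11 by omega, show x ≠ 12 by omega,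
          show x ≠ 13 by omega, show x ≠ 14 by omega]
      · by_cases h : q < L.deg v <;> simp [h, bit, g10]
      · push_cast at gle
        by_cases h : q < L.deg v <;> simp [h, bit] <;> omega
    all_goals norm_num [Expr.cost]
  have hexit : ∀ z s', Inv 0 z s' →
      Reach w L (.loop (.reg 11) body :: l') l' s'
        (fun o => dirac (decide (2048 ≤ 4 * z)) o)
        (fun o s' => (∀ x < 10, s'.reg x = s.reg x) ∧ 4 * s'.reg 10 < 2 ^ w ∧
          decide (2048 ≤ 4 * s'.reg 10) = o) 2 := by
    rintro z s' ⟨gr, g11, g10, gle⟩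
    have h1 : 4 * s'.reg 10 < 2 ^ w := by omega
    have h2 : decide (2048 ≤ 4 * s'.reg 10) = decide (2048 ≤ 4 * z) :=
      decide_eq_decide.mpr (by omega)
    refine (Reach.loop_false ?_ <| Reach.refl (decide (2048 ≤ 4 * z)) ⟨gr, h1, h2⟩).le ?_
    · rw [eval_reg g11]
    · norm_num [Expr.cost]
  refine (Reach.seq <| Reach.assign (v := 0) ?_ <| Reach.seq <|
    Reach.assign (v := hitTrials n θ) ?_ <|
    Reach.iterate (y := bit) (sum_hitProb hn hθ) hstep hexit (hitTrials n θ) 0 _ ?_).le ?_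
  · exact eval_const (by omega)
  · exact eval_mul (eval_const (by omega)) (eval_add (eval_div (eval_reg (by simp [h0]))
      (eval_reg (by simp [h8])) (by omega)) (eval_const (by omega)) (by omega))
      (lt_of_le_of_lt htr (by omega))
  · exact ⟨fun x hx => by simp [show x ≠ 10 by omega, show x ≠ 11 by omega], by simp, by simp,
      by simp⟩
  · simp only [Expr.cost]
    exact_mod_cast (by omega)

/-! ### Sampling edges

Register `16` holds a degree bound `Θ`. A random edge is found either from an endpoint of degree at
most `Θ`, or as a random edge at a vertex of higher degree that has been reached from a neighbour of
degree at most `Θ`. -/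

/-- The distribution of the edge sampled at a neighbour `u` of a vertex of degree at most `Θ`. -/
noncomputable def secondEdge (L : AdjList G) (Θ : ℕ) (u : Fin n) : Option (Fin n × Fin n) → ℝ≥0 :=
  if Θ < L.deg u then
    fun o => ∑ r ∈ Finset.range (L.deg u), (L.deg u : ℝ≥0)⁻¹ * dirac (some (u, L.nbr u r)) o
  else dirac none

/-- The distribution of the sampled edge, given the random vertex and index. -/
noncomputable def edgeFrom (L : AdjList G) (Θ : ℕ) (v : Fin n) (r : ℕ) :
    Option (Fin n × Fin n) → ℝ≥0 :=
  if r < L.deg v ∧ L.deg v ≤ Θ then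
    fun o => ∑ c ∈ Finset.range 2, ((2 : ℕ) : ℝ≥0)⁻¹ *
      (if c = 0 then secondEdge L Θ (L.nbr v r) else dirac (some (v, L.nbr v r))) o
  else dirac none

/-- The distribution of the sampled edge. -/
noncomputable def edgeProb (L : AdjList G) (Θ : ℕ) : Option (Fin n × Fin n) → ℝ≥0 := fun o =>
  ∑ v, (n : ℝ≥0)⁻¹ * ∑ r ∈ Finset.range Θ, (Θ : ℝ≥0)⁻¹ * edgeFrom L Θ v r o

/-- Sample an edge. Its endpoints are put into the registers `12` and `18`, and register `19`
tells whether an edge has been found. -/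
def sampleEdge : Cmd :=
  .seq (.rand 12 (.reg 0)) <|
  .seq (.rand 13 (.reg 16)) <|
  .seq (.degree 14 (.reg 12)) <|
  .seq (.assign 19 (.op .mul (.op .lt (.reg 13) (.reg 14))
    (.op .sub (.const 1) (.op .lt (.reg 16) (.reg 14))))) <|
  .cond (.reg 19)
    (.seq (.neighbor 18 (.reg 12) (.op .add (.reg 13) (.const 1))) <|
      .seq (.rand 17 (.const 2)) <|
      .cond (.reg 17) .skip <|
        .seq (.degree 14 (.reg 18)) <|
        .cond (.op .lt (.reg 16) (.reg 14))
          (.seq (.assign 12 (.reg 18)) <|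
            .seq (.rand 13 (.reg 14)) <|
            .neighbor 18 (.reg 12) (.op .add (.reg 13) (.const 1)))
          (.assign 19 (.const 0)))
    .skip

/-- The store after the sampling of an edge. -/
def EdgePost (G : SimpleGraph (Fin n)) (s : Store) : Option (Fin n × Fin n) → Store → Prop
  | none, s' => (∀ x, x < 12 ∨ x = 15 ∨ x = 16 → s'.reg x = s.reg x) ∧ s'.mem = s.mem ∧
      s'.reg 19 = 0
  | some (v, u), s' => (∀ x, x < 12 ∨ x = 15 ∨ x = 16 → s'.reg x = s.reg x) ∧ s'.mem = s.mem ∧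
      s'.reg 19 = 1 ∧ s'.reg 12 = v ∧ s'.reg 18 = u ∧ G.Adj v u

theorem reach_sampleEdge (hw : 10000 * (n + 1) < 2 ^ w) (hn : 0 < n) {Θ : ℕ} (hΘ : 0 < Θ)
    (l' : List Cmd) {s : Store} (h0 : s.reg 0 = n) (h16 : s.reg 16 = Θ) :
    Reach w L (sampleEdge :: l') l' s (edgeProb L Θ) (EdgePost G s) 60 := by
  refine (Reach.seq <| Reach.rand_fin (N := n) ?_ hn (T := 57) fun v => (Reach.seq <|
    Reach.rand_const (N := Θ) ?_ hΘ (μ := edgeFrom L Θ v) (T := 54)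
    fun r hr => (Reach.seq <| Reach.degree (v := L.deg v) ?_ <| Reach.seq <|
      Reach.assign (v := if r < L.deg v ∧ L.deg v ≤ Θ then 1 else 0) ?_ (T := 37) ?_).le
        ?_).le ?_).le ?_
  · exact eval_reg h0
  · exact eval_reg (by simp [h16])
  · rw [eval_reg (x := v) (by simp), degreeQuery_eq]
  -- The conjunction of the two comparisons is computed as a product of bits.
  · have := eval_mul (w := w) (eval_lt (s := ((s.setReg 12 v).setReg 13 r).setReg 14 (L.deg v))
      (eval_reg (i := 13) (x := r) (by simp)) (eval_reg (i := 14) (x := L.deg v) (by simp))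
      (by omega)) (eval_sub (eval_const (c := 1) (by omega)) (eval_lt (eval_reg (i := 16) (x := Θ)
      (by simp [h16])) (eval_reg (i := 14) (x := L.deg v) (by simp)) (by omega)) (by omega))
      (by split_ifs <;> omega)
    rw [this]
    by_cases h1 : r < L.deg v <;> by_cases h2 : Θ < L.deg v
    · simp [h1, h2]
    · simp [h1, h2, not_lt.mp h2]
    · simp [h1]
    · simp [h1]
  · rw [edgeFrom]
    split_ifs with hcond
    · obtain ⟨hrd, hdΘ⟩ := hcond
      have hadj : G.Adj v (L.nbr v r) := adj_nbr hrd
      have hdn : L.deg v < n := deg_lt v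
      refine (Reach.cond_true ?_ <| Reach.seq <| Reach.neighbor (v := L.nbr v r) ?_ <|
        Reach.seq <| Reach.rand_const (N := 2) ?_ two_pos
          (μ := fun c => if c = 0 then secondEdge L Θ (L.nbr v r) else dirac (some (v, L.nbr v r)))
          (T := 23) fun c _ => ?_).le ?_
      · rw [eval_reg (x := 1) (by simp)]
        exact one_ne_zero
      · rw [eval_reg (x := v) (by simp), eval_add (x := r) (y := 1) (eval_reg (by simp))
          (eval_const (by omega)) (by omega), neighborQuery_eq hrd]
      · exact eval_const (by omega)
      · by_cases hc : c = 0
        · simp only [hc, if_true]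
          set u := L.nbr v r with hu
          refine (Reach.cond_false ?_ <| Reach.seq <| Reach.degree (v := L.deg u) ?_ (T := 17)
            ?_).le ?_
          · exact eval_reg (by simp)
          · rw [eval_reg (x := u) (by simp), degreeQuery_eq]
          · rw [secondEdge]
            split_ifs with hh
            · have hun : L.deg u < n := deg_lt u
              refine (Reach.cond_true ?_ <| Reach.seq <| Reach.assign (v := u) ?_ <| Reach.seq <|
                Reach.rand_const (N := L.deg u) ?_ (by omega)
                (μ := fun q => dirac (some (u, L.nbr u q))) (T := 5) fun q hq =>
                (Reach.neighbor (v := L.nbr u q) ?_ <| Reach.refl _ ?_).le ?_).le ?_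
              · rw [eval_lt (x := Θ) (y := L.deg u) (eval_reg (by simp [h16]))
                  (eval_reg (by simp)) (by omega), if_pos hh]
                exact one_ne_zero
              · exact eval_reg (by simp)
              · exact eval_reg (by simp)
              · rw [eval_reg (x := u) (by simp), eval_add (x := q) (y := 1) (eval_reg (by simp))
                  (eval_const (by omega)) (by omega), neighborQuery_eq hq]
              · refine ⟨fun x hx => ?_, rfl, by simp, by simp, by simp, adj_nbr hq⟩
                simp [show x ≠ 12 by omega, show x ≠ 13 by omega, show x ≠ 14 by omega,
                  show x ≠ 17 by omega, show x ≠ 18 by omega, show x ≠ 19 by omega]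
              all_goals norm_num [Expr.cost]
            · refine (Reach.cond_false ?_ <| Reach.assign (v := 0) ?_ <| Reach.refl _ ?_).le ?_
              · rw [eval_lt (x := Θ) (y := L.deg u) (eval_reg (by simp [h16]))
                  (eval_reg (by simp)) (by omega), if_neg hh]
              · exact eval_const (by omega)
              · refine ⟨fun x hx => ?_, rfl, by simp⟩
                simp [show x ≠ 12 by omega, show x ≠ 13 by omega, show x ≠ 14 by omega,
                  show x ≠ 17 by omega, show x ≠ 18 by omega, show x ≠ 19 by omega]
              · norm_num [Expr.cost]
          · norm_num [Expr.cost]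
        · simp only [hc, if_false]
          refine (Reach.cond_true ?_ <| Reach.skip <| Reach.refl _ ?_).le ?_
          · rw [eval_reg (x := c) (by simp)]
            exact hc
          · refine ⟨fun x hx => ?_, rfl, by simp, by simp, by simp, hadj⟩
            simp [show x ≠ 12 by omega, show x ≠ 13 by omega, show x ≠ 14 by omega,
              show x ≠ 17 by omega, show x ≠ 18 by omega, show x ≠ 19 by omega]
          · norm_num [Expr.cost]
      · norm_num [Expr.cost]
    · refine (Reach.cond_false ?_ <| Reach.skip <| Reach.refl _ ?_).le ?_
      · exact eval_reg (by simp)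
      · refine ⟨fun x hx => ?_, rfl, by simp⟩
        simp [show x ≠ 12 by omega, show x ≠ 13 by omega, show x ≠ 14 by omega,
          show x ≠ 19 by omega]
      · norm_num [Expr.cost]
  all_goals norm_num [Expr.cost]

end Search

/-! ### Testing the sampled edges -/

section Final

variable {n : ℕ} {G : SimpleGraph (Fin n)} {L : AdjList G} {w α E S l : ℕ}

/-- Test the vertex in register `x`, and add the result to the memory cell `3 * l + 5`, where `l`
is the number of rounds. -/
def vertexTest (x : ℕ) : Cmd :=
  .seq (.assign 20 (.reg 7)) <| .seq (.assign 21 (.reg x)) <| .seq callVertex testLoop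

/-- The cell `3 * l + 5` is `3 * (l + 1) + 2`, the counter of a virtual frame above the stack, so
the outermost call reports its result just as the inner ones do. -/
theorem reach_vertexTest (hf : TestFits w n α E S l) (k : List Cmd) {x : ℕ} (hx : x < 20)
    {u : Fin n} (hu : 0 < L.deg u) {s : Store} {c : ℕ} (hr : TestRegs α E S l s)
    (hxu : s.reg x = u) (hc : s.mem (3 * l + 5) = c) (hc' : c + 1 < 2 ^ w) :
    Reach w L (vertexTest x :: k) k s (passProb L α E S l u)
      (fun o s' => (∀ y < 20, s'.reg y = s.reg y) ∧ (s'.mem (3 * l + 5) : ℤ) = c + bit o)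
      (testTime S l + 20) := by
  refine (Reach.seq <| Reach.assign (v := l) ?_ <| Reach.seq <| Reach.assign (v := u) ?_ <|
    Reach.seq <| ((reach_callVertex hf k l le_rfl u hu _ c ?_ ?_ ?_ ?_ hc').bind
      (μ := fun o => dirac o) (T' := fun _ => 6)
      (R := fun o s' => (∀ y < 20, s'.reg y = s.reg y) ∧ (s'.mem (3 * l + 5) : ℤ) = c + bit o)
      ?_)).mono ?_ (fun _ _ => id) ?_
  · exact eval_reg hr.rounds
  · exact eval_reg (by simpa [hx.ne] using hxu)
  · refine hr.congr fun y hy => ?_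
    simp [show y ≠ 20 by omega, show y ≠ 21 by omega]
  · simp
  · simp
  · simpa [mul_add] using hc
  · rintro o s' ⟨h20, hreg, -, hm⟩
    have hreg' : ∀ y < 20, s'.reg y = s.reg y := by
      intro y hy
      rw [hreg y hy]
      simp [show y ≠ 20 by omega, show y ≠ 21 by omega]
    refine (Reach.loop_false ?_ <| Reach.refl o ?_).le ?_
    · rw [eval_testLoop_cond hf (hr.congr hreg') h20, if_neg (by omega)]
    · exact ⟨hreg', by rw [← hm, show 3 * (l + 1) + 2 = 3 * l + 5 by ring]⟩
    · norm_num [Expr.cost]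
  · intro o
    cases o <;> simp [dirac]
  · rw [← Finset.sum_mul, sum_passProb l u hu]
    simp only [Expr.cost]
    norm_num
    exact_mod_cast (by omega)

/-- The distribution of the outcome of a trial, given the sampled edge: whether an edge has been
found, and whether both of its endpoints passed the test. -/
noncomputable def pairProb (L : AdjList G) (α E S l : ℕ) :
    Option (Fin n × Fin n) → Option Bool → ℝ≥0
  | none => dirac none
  | some (v, u) => fun o => ∑ o₁, passProb L α E S l v o₁ *
      ∑ o₂, passProb L α E S l u o₂ * dirac (some (o₁ && o₂)) o

/-- Test both endpoints of the sampled edge. Register `10` counts the edges, register `15` those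
both of whose endpoints pass. -/
def edgeTest : Cmd :=
  .seq (.assign 10 (.op .add (.reg 10) (.const 1))) <|
  .seq (.store (.op .add (.op .mul (.const 3) (.reg 7)) (.const 5)) (.const 0)) <|
  .seq (vertexTest 12) <|
  .seq (vertexTest 18) <|
  .assign 15 (.op .add (.reg 15)
    (.op .eq (.mem (.op .add (.op .mul (.const 3) (.reg 7)) (.const 5))) (.const 2)))

/-- Both tests add to the same cell, which is reset first; both endpoints pass exactly if it ends at
2. -/
theorem reach_edgeTest (hf : TestFits w n α E S l) (k : List Cmd) {v u : Fin n}
    (hadj : G.Adj v u) {s : Store} (hr : TestRegs α E S l s) (h12 : s.reg 12 = v)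
    (h18 : s.reg 18 = u) (h10 : s.reg 10 + 1 < 2 ^ w) (h15 : s.reg 15 + 1 < 2 ^ w) :
    Reach w L (edgeTest :: k) k s (pairProb L α E S l (some (v, u)))
      (fun o s' => o ≠ none ∧ (∀ x < 20, x ≠ 10 → x ≠ 15 → s'.reg x = s.reg x) ∧
        s'.reg 10 = s.reg 10 + 1 ∧ s'.reg 15 = s.reg 15 + if o = some true then 1 else 0)
      (2 * testTime S l + 80) := by
  have h5 := hf.size
  have ha := hf.addr
  have hdv : 0 < L.deg v := deg_pos_of_adj hadj
  have hdu : 0 < L.deg u := deg_pos_of_adj hadj.symm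
  refine (Reach.seq <| Reach.assign (v := s.reg 10 + 1) ?_ <| Reach.seq <|
    Reach.store (i := 3 * l + 5) (v := 0) ?_ ?_ <| Reach.seq <|
    (reach_vertexTest hf _ (x := 12) (by norm_num) hdv (c := 0) ?_ ?_ ?_ ?_).bind
      (μ := fun o₁ o => ∑ o₂, passProb L α E S l u o₂ * dirac (some (o₁ && o₂)) o)
      (T' := fun _ => testTime S l + 40) ?_).mono (fun _ => rfl) (fun _ _ => id) ?_
  · exact eval_add (eval_reg rfl) (eval_const (by omega)) h10
  · exact eval_add (eval_mul (eval_const (by omega)) (eval_reg (by simpa using hr.rounds))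
      (by omega)) (eval_const (by omega)) (by omega)
  · exact eval_const (by omega)
  · exact ⟨by simpa using hr.alpha, by simpa using hr.eps, by simpa using hr.samples,
      by simpa using hr.rounds⟩
  · simpa using h12
  · simp
  · omega
  · rintro o₁ s₁ ⟨hreg₁, hm₁⟩
    have hr₁ : TestRegs α E S l s₁ := TestRegs.congr ⟨by simpa using hr.alpha,
      by simpa using hr.eps, by simpa using hr.samples, by simpa using hr.rounds⟩ hreg₁
    obtain ⟨c₁, hc₁⟩ : ∃ c₁ : ℕ, s₁.mem (3 * l + 5) = c₁ := ⟨_, rfl⟩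
    rw [hc₁] at hm₁
    have hc₁' : c₁ ≤ 1 := by cases o₁ <;> simp [bit] at hm₁ <;> omega
    refine (Reach.seq <| (reach_vertexTest hf _ (x := 18) (by norm_num) hdu (c := c₁) hr₁ ?_ hc₁
      ?_).bind (μ := fun o₂ => dirac (some (o₁ && o₂))) (T' := fun _ => 15) ?_).mono
      (fun _ => rfl) (fun _ _ => id) ?_
    · rw [hreg₁ 18 (by norm_num)]
      simpa using h18
    · omega
    · rintro o₂ s₂ ⟨hreg₂, hm₂⟩
      have hr₂ := hr₁.congr hreg₂
      have hreg : ∀ x < 20, x ≠ 10 → s₂.reg x = s.reg x := by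
        intro x hx h10
        rw [hreg₂ x hx, hreg₁ x hx]
        simp [h10]
      obtain ⟨c₂, hc₂⟩ : ∃ c₂ : ℕ, s₂.mem (3 * l + 5) = c₂ := ⟨_, rfl⟩
      rw [hc₂] at hm₂
      have hbit : (if c₂ = 2 then 1 else 0) = if (some (o₁ && o₂) = some true) then 1 else 0 := by
        have hc₂' : (c₂ : ℤ) = bit o₁ + bit o₂ := by rw [hm₂, hm₁]; simp
        congr 1
        cases o₁ <;> cases o₂ <;> simp [bit] at hc₂' ⊢ <;> omega
      refine (Reach.assign (v := s.reg 15 + if (some (o₁ && o₂) = some true) then 1 else 0) ?_ <|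
        Reach.refl _ ?_).le ?_
      · rw [← hbit]
        refine eval_add (eval_reg (hreg 15 (by norm_num) (by norm_num))) (eval_eq (eval_mem
          (eval_add (eval_mul (eval_const (by omega)) (eval_reg hr₂.rounds) (by omega))
          (eval_const (by omega)) (by omega)) hc₂) (eval_const (by omega)) (by omega)) ?_
        split_ifs <;> omega
      · refine ⟨by simp, fun x hx hx10 hx15 => ?_, ?_, by simp⟩
        · rw [← hreg x hx hx10]
          simp [hx15]
        · simp only [setReg_reg]
          rw [if_neg (by norm_num), hreg₂ 10 (by norm_num), hreg₁ 10 (by norm_num)]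
          simp
      · norm_num [Expr.cost]
    · rw [← Finset.sum_mul, sum_passProb l u hdu]
      norm_num
      exact_mod_cast (by omega)
  · rw [← Finset.sum_mul, sum_passProb l v hdv]
    simp only [Expr.cost]
    norm_num
    exact_mod_cast (by omega)

theorem sum_dirac {ι : Type} [Fintype ι] [DecidableEq ι] (o : ι) : ∑ o', dirac o o' = 1 := by
  simp [dirac]

theorem sum_average {ι : Type} [Fintype ι] {N : ℕ} (hN : 0 < N) {μ : ℕ → ι → ℝ≥0}
    (h : ∀ r < N, ∑ o, μ r o = 1) :
    ∑ o, ∑ r ∈ Finset.range N, (N : ℝ≥0)⁻¹ * μ r o = 1 := by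
  have hN' : (N : ℝ≥0) ≠ 0 := by positivity
  rw [Finset.sum_comm]
  simp_rw [← Finset.mul_sum]
  rw [Finset.sum_congr rfl fun r hr => h r (Finset.mem_range.mp hr)]
  simp [hN']

theorem sum_edgeProb (hn : 0 < n) {Θ : ℕ} (hΘ : 0 < Θ) : ∑ o, edgeProb L Θ o = 1 := by
  have hn' : (n : ℝ≥0) ≠ 0 := by positivity
  have hsecond : ∀ u, ∑ o, secondEdge L Θ u o = 1 := by
    intro u
    rw [secondEdge]
    split_ifs with h
    · exact sum_average (by omega) fun r _ => sum_dirac _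
    · exact sum_dirac _
  have hfrom : ∀ v r, ∑ o, edgeFrom L Θ v r o = 1 := by
    intro v r
    rw [edgeFrom]
    split_ifs
    · refine sum_average two_pos fun c _ => ?_
      split_ifs
      · exact hsecond _
      · exact sum_dirac _
    · exact sum_dirac _
  simp only [edgeProb]
  rw [Finset.sum_comm]
  have : ∀ v ∈ Finset.univ, ∑ o, (n : ℝ≥0)⁻¹ * ∑ r ∈ Finset.range Θ,
      (Θ : ℝ≥0)⁻¹ * edgeFrom L Θ v r o = (n : ℝ≥0)⁻¹ := fun v _ => by
    rw [← Finset.mul_sum, sum_average hΘ fun r _ => hfrom v r, mul_one]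
  rw [Finset.sum_congr rfl this]
  simp [hn']

theorem sum_pairProb {e : Option (Fin n × Fin n)}
    (he : ∀ v u, e = some (v, u) → 0 < L.deg v ∧ 0 < L.deg u) :
    ∑ o, pairProb L α E S l e o = 1 := by
  match e with
  | none => exact sum_dirac _
  | some (v, u) =>
    obtain ⟨hv, hu⟩ := he v u rfl
    simp only [pairProb]
    rw [Finset.sum_comm]
    simp_rw [← Finset.mul_sum]
    have : ∀ o₁ : Bool, ∑ o, ∑ o₂, passProb L α E S l u o₂ * dirac (some (o₁ && o₂)) o = 1 := by
      intro o₁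
      rw [Finset.sum_comm]
      simp_rw [← Finset.mul_sum, sum_dirac, mul_one]
      exact sum_passProb l u hu
    simp_rw [this, mul_one]
    exact sum_passProb l v hv

/-- The numbers in the program are smaller than `2 ^ w`. -/
structure Fits (w n α E S l : ℕ) : Prop extends TestFits w n α E S l where
  hits : 10000 * (n + 1) < 2 ^ w
  edges : 500 * n * α < 2 ^ w
  square : n * n < 2 ^ w
  score : 200000000 * E * (n + 1) * E < 2 ^ w

/-- The distribution of the outcome of a trial. -/
noncomputable def trialProb (L : AdjList G) (α E S l Θ : ℕ) : Option Bool → ℝ≥0 := fun o =>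
  ∑ e, edgeProb L Θ e * pairProb L α E S l e o

/-- The probability that an edge is found in a trial. -/
noncomputable def foundProb (L : AdjList G) (Θ : ℕ) : ℝ≥0 := ∑ e, edgeProb L Θ (some e)

/-- The contribution of a trial to the score. -/
def score (E : ℕ) : Option Bool → ℤ
  | none => 0
  | some false => -11
  | some true => E - 11

/-- The number of trials. -/
def edgeTrials (n E Θ : ℕ) : ℕ := 10000000 * E * (n / Θ + 1)

/-- The distribution of the answer that is based on the trials. -/
noncomputable def answerProb (L : AdjList G) (α E S l Θ : ℕ) : Bool → ℝ≥0 := fun o =>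
  iterExp (trialProb L α E S l Θ) (score E) (fun z => dirac (decide (z ≤ 0)) o)
    (edgeTrials n E Θ) 0

/-- Sample an edge and test its endpoints. -/
def trial : Cmd :=
  .seq (.assign 11 (.op .sub (.reg 11) (.const 1))) <|
  .seq sampleEdge <| .cond (.reg 19) edgeTest .skip

/-- Decide by sampling edges, with the degree bound in register `16`. -/
def decideBySampling : Cmd :=
  .seq (.assign 10 (.const 0)) <|
  .seq (.assign 15 (.const 0)) <|
  .seq (.assign 11 (.op .mul (.op .mul (.const 10000000) (.reg 4))
    (.op .add (.op .div (.reg 0) (.reg 16)) (.const 1)))) <|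
  .seq (.loop (.reg 11) trial) <|
  .assign 9 (.op .sub (.const 1)
    (.op .lt (.op .mul (.const 11) (.reg 10)) (.op .mul (.reg 15) (.reg 4))))

/-- Only genuine edges are sampled. Hence the endpoints that are tested have positive degree, where
the test has a proper distribution. -/
theorem edgeProb_some_eq_zero {Θ : ℕ} {v u : Fin n} (h : ¬ G.Adj v u) :
    edgeProb L Θ (some (v, u)) = 0 := by
  have key : ∀ (v' : Fin n) (r : ℕ), r < L.deg v' → some (v, u) ≠ some (v', L.nbr v' r) := by
    rintro v' r hr heq
    rw [Option.some.injEq, Prod.mk.injEq] at heq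
    obtain ⟨rfl, rfl⟩ := heq
    exact h (adj_nbr hr)
  refine Finset.sum_eq_zero fun v' _ => mul_eq_zero_of_right _ <| Finset.sum_eq_zero fun r _ =>
    mul_eq_zero_of_right _ ?_
  rw [edgeFrom]
  split_ifs with hr
  · refine Finset.sum_eq_zero fun c _ => mul_eq_zero_of_right _ ?_
    split_ifs
    · rw [secondEdge]
      split_ifs
      · refine Finset.sum_eq_zero fun q hq => mul_eq_zero_of_right _ ?_
        rw [dirac, if_neg (key _ q (Finset.mem_range.mp hq))]
      · simp [dirac]
    · rw [dirac, if_neg (key _ r hr.1)]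
  · simp [dirac]

theorem sum_trialProb (hn : 0 < n) {Θ : ℕ} (hΘ : 0 < Θ) : ∑ o, trialProb L α E S l Θ o = 1 := by
  simp only [trialProb]
  rw [Finset.sum_comm, ← sum_edgeProb (L := L) hn hΘ]
  refine Finset.sum_congr rfl fun e _ => ?_
  rw [← Finset.mul_sum]
  match e with
  | none => rw [sum_pairProb (by simp), mul_one]
  | some (v, u) =>
    by_cases h : G.Adj v u
    · rw [sum_pairProb, mul_one]
      intro v' u' he
      rw [Option.some.injEq, Prod.mk.injEq] at he
      obtain ⟨rfl, rfl⟩ := he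
      exact ⟨deg_pos_of_adj h, deg_pos_of_adj h.symm⟩
    · rw [edgeProb_some_eq_zero h, zero_mul]

theorem sum_answerProb (hn : 0 < n) {Θ : ℕ} (hΘ : 0 < Θ) :
    ∑ o, answerProb L α E S l Θ o = 1 := by
  rw [Fintype.sum_bool]
  exact iterExp_add_eq_one (sum_trialProb hn hΘ) (fun z => dirac_true_add_dirac_false _) _ _

theorem reach_trial (hf : Fits w n α E S l) (hn : 0 < n) {Θ r : ℕ} (hΘ : 0 < Θ) (k : List Cmd)
    {s : Store} (hr : TestRegs α E S l s) (h0 : s.reg 0 = n) (h16 : s.reg 16 = Θ)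
    (h11 : s.reg 11 = r + 1) (hr' : r + 1 < 2 ^ w) (h10 : s.reg 10 + 1 < 2 ^ w)
    (h15 : s.reg 15 + 1 < 2 ^ w) :
    Reach w L (trial :: k) k s (trialProb L α E S l Θ)
      (fun o s' => (∀ x, x < 10 ∨ x = 16 → s'.reg x = s.reg x) ∧ s'.reg 11 = r ∧
        s'.reg 10 = s.reg 10 + (if o = none then 0 else 1) ∧
        s'.reg 15 = s.reg 15 + if o = some true then 1 else 0)
      (78 + foundProb L Θ * (2 * testTime S l + 80)) := by
  have h5 := hf.size
  refine (Reach.seq <| Reach.assign (v := r) ?_ <| Reach.seq <|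
    (reach_sampleEdge hf.hits hn hΘ _ ?_ ?_).bind (μ := pairProb L α E S l)
      (T' := fun e => if e = none then 3 else 2 * testTime S l + 82) ?_).mono (fun _ => rfl)
      (fun _ _ => id) ?_
  · exact eval_sub (eval_reg h11) (eval_const (by omega)) (by omega)
  · simpa using h0
  · simpa using h16
  · rintro (_ | ⟨v, u⟩) s₁ hs₁
    · obtain ⟨hreg, -, h19⟩ := hs₁
      refine (Reach.cond_false (eval_reg h19) <| Reach.skip <| Reach.refl _ ?_).le ?_
      · refine ⟨fun x hx => ?_, ?_, ?_, ?_⟩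
        · rw [hreg x (by omega)]
          simp [show x ≠ 11 by omega]
        · rw [hreg 11 (by omega)]
          simp
        · rw [hreg 10 (by omega)]
          simp
        · rw [hreg 15 (by omega)]
          simp
      · norm_num [Expr.cost]
    · obtain ⟨hreg, -, h19, h12, h18, hadj⟩ := hs₁
      have hr₁ : TestRegs α E S l s₁ := by
        refine ⟨?_, ?_, ?_, ?_⟩
        · rw [hreg 1 (by omega)]; simpa using hr.alpha
        · rw [hreg 4 (by omega)]; simpa using hr.eps
        · rw [hreg 5 (by omega)]; simpa using hr.samples
        · rw [hreg 7 (by omega)]; simpa using hr.rounds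
      have g10 : s₁.reg 10 = s.reg 10 := by rw [hreg 10 (by omega)]; simp
      have g15 : s₁.reg 15 = s.reg 15 := by rw [hreg 15 (by omega)]; simp
      refine (Reach.cond_true ?_ <| (reach_edgeTest hf.toTestFits k hadj hr₁ h12 h18
        (by rwa [g10]) (by rwa [g15])).mono (fun _ => rfl) ?_ le_rfl).le ?_
      · rw [eval_reg h19]
        exact one_ne_zero
      · rintro o s₂ ⟨ho, hreg₂, h10₂, h15₂⟩
        refine ⟨fun x hx => ?_, ?_, ?_, ?_⟩
        · rw [hreg₂ x (by omega) (by omega) (by omega), hreg x (by omega)]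
          simp [show x ≠ 11 by omega]
        · rw [hreg₂ 11 (by omega) (by omega) (by omega), hreg 11 (by omega)]
          simp
        · rw [h10₂, g10, if_neg ho]
        · rw [h15₂, g15]
      · simp only [Expr.cost, reduceCtorEq, if_false]
        exact_mod_cast (by omega)
  -- The costly tests are weighted with the probability that an edge is found; a failed trial costs
  -- a constant.
  · have hsum := sum_edgeProb (L := L) hn hΘ
    rw [Fintype.sum_option] at hsum ⊢
    simp only [reduceCtorEq, if_true, if_false, ← Finset.sum_mul, Expr.cost]
    rw [← foundProb] at hsum ⊢
    rw [← NNReal.coe_le_coe]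
    have hsum' : (edgeProb L Θ none : ℝ) + foundProb L Θ = 1 := by exact_mod_cast hsum
    have h1 : (0 : ℝ) ≤ edgeProb L Θ none := NNReal.coe_nonneg _
    push_cast
    nlinarith

theorem reach_decideBySampling (hf : Fits w n α E S l) (hn : 0 < n) {Θ : ℕ} (hΘ : 0 < Θ)
    (k : List Cmd) {s : Store} (hr : TestRegs α E S l s) (h0 : s.reg 0 = n)
    (h16 : s.reg 16 = Θ) :
    Reach w L (decideBySampling :: k) k s (answerProb L α E S l Θ)
      (fun o s' => (∀ x < 9, s'.reg x = s.reg x) ∧ s'.reg 9 = if o then 1 else 0)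
      (edgeTrials n E Θ * (80 + foundProb L Θ * (2 * testTime S l + 80)) + 50) := by
  have h5 := hf.size
  have hE := hf.eps_pos
  have hdiv : n / Θ ≤ n := Nat.div_le_self _ _
  have hscore : 20 * edgeTrials n E Θ * E < 2 ^ w := by
    refine lt_of_le_of_lt (Nat.mul_le_mul_right E ?_) hf.score
    rw [edgeTrials, ← mul_assoc, ← mul_assoc]
    exact Nat.mul_le_mul_left _ (by omega)
  have hscore' : 20 * edgeTrials n E Θ < 2 ^ w :=
    lt_of_le_of_lt (Nat.le_mul_of_pos_right _ hE) hscore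
  have hle1 : 1 ≤ n / Θ + 1 := Nat.le_add_left _ _
  have hE' : 10000000 * E < 2 ^ w := by
    have : 10000000 * E ≤ edgeTrials n E Θ := Nat.le_mul_of_pos_right _ hle1
    omega
  -- The score is never stored: it is E times the number of passing edges minus 11 times the number
  -- of edges, so comparing these two products decides its sign.
  let Inv : ℕ → ℤ → Store → Prop := fun r z s' =>
    (∀ x < 9, s'.reg x = s.reg x) ∧ s'.reg 16 = Θ ∧ s'.reg 11 = r ∧
      s'.reg 10 + r ≤ edgeTrials n E Θ ∧ s'.reg 15 ≤ s'.reg 10 ∧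
      (s'.reg 15 : ℤ) * E - 11 * s'.reg 10 = z
  have hregs : ∀ s', (∀ x < 9, s'.reg x = s.reg x) → TestRegs α E S l s' := fun s' h =>
    ⟨(h 1 (by norm_num)).trans hr.alpha, (h 4 (by norm_num)).trans hr.eps,
      (h 5 (by norm_num)).trans hr.samples, (h 7 (by norm_num)).trans hr.rounds⟩
  have hstep : ∀ (k' : List Cmd) r z s', Inv (r + 1) z s' →
      Reach w L (.loop (.reg 11) trial :: k') (.loop (.reg 11) trial :: k') s'
        (trialProb L α E S l Θ) (fun o => Inv r (z + score E o))
        (80 + foundProb L Θ * (2 * testTime S l + 80)) := by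
    rintro k' r z s' ⟨gr, g16, g11, gle, gle', gz⟩
    refine (Reach.loop_true ?_ <| (reach_trial hf hn hΘ _ (hregs s' gr)
      ((gr 0 (by norm_num)).trans h0) g16 g11 (by omega) (by omega) (by omega)).mono
      (fun _ => rfl) ?_ le_rfl).le ?_
    · rw [eval_reg g11]
      exact Nat.succ_ne_zero r
    · rintro o s₂ ⟨h1, h2, h3, h4⟩
      refine ⟨fun x hx => (h1 x (by omega)).trans (gr x hx), (h1 16 (by omega)).trans g16, h2,
        ?_, ?_, ?_⟩
      · rw [h3]
        split_ifs <;> omega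
      · rw [h3, h4]
        match o with
        | none => simpa using gle'
        | some false => simp; omega
        | some true => simpa using gle'
      · rw [h3, h4, ← gz]
        match o with
        | none => simp [score]
        | some false => simp [score]; ring
        | some true => simp [score]; ring
    · simp only [Expr.cost]
      rw [← add_assoc]
      gcongr
      norm_num
  have hexit : ∀ z s', Inv 0 z s' →
      Reach w L (.loop (.reg 11) trial :: .assign 9 (.op .sub (.const 1)
        (.op .lt (.op .mul (.const 11) (.reg 10)) (.op .mul (.reg 15) (.reg 4)))) :: k) k s'
        (fun o => dirac (decide (z ≤ 0)) o)
        (fun o s' => (∀ x < 9, s'.reg x = s.reg x) ∧ s'.reg 9 = if o then 1 else 0) 20 := by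
    rintro z s' ⟨gr, g16, g11, gle, gle', gz⟩
    have hiff : (11 * s'.reg 10 < s'.reg 15 * E) ↔ ¬ z ≤ 0 := by
      rw [← gz, not_le, sub_pos]
      exact_mod_cast Iff.rfl
    refine (Reach.loop_false ?_ <| Reach.assign (v := 1 - if 11 * s'.reg 10 < s'.reg 15 * E
      then 1 else 0) ?_ <| Reach.refl _ ?_).le ?_
    · exact eval_reg g11
    · refine eval_sub (eval_const (by omega)) (eval_lt (eval_mul (eval_const (by omega))
        (eval_reg rfl) (by omega)) (eval_mul (eval_reg rfl)
        (eval_reg ((gr 4 (by norm_num)).trans hr.eps)) ?_) (by omega)) (by omega)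
      refine lt_of_le_of_lt (Nat.mul_le_mul_right E ?_) hscore
      omega
    · refine ⟨fun x hx => ?_, ?_⟩
      · rw [← gr x hx]
        simp [show x ≠ 9 by omega]
      · by_cases hz : z ≤ 0 <;> simp [hiff, hz]
    · norm_num [Expr.cost]
  refine (Reach.seq <| Reach.assign (v := 0) ?_ <| Reach.seq <| Reach.assign (v := 0) ?_ <|
    Reach.seq <| Reach.assign (v := edgeTrials n E Θ) ?_ <| Reach.seq <|
    Reach.iterate (y := score E) (sum_trialProb hn hΘ) (hstep _) hexit (edgeTrials n E Θ) 0 _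
      ?_).le ?_
  · exact eval_const (by omega)
  · exact eval_const (by omega)
  · exact eval_mul (eval_mul (eval_const (by omega)) (eval_reg (by simpa using hr.eps)) hE')
      (eval_add (eval_div (eval_reg (by simpa using h0)) (eval_reg (by simpa using h16))
      (by omega)) (eval_const (by omega)) (by omega)) (by rw [← edgeTrials]; omega)
  · refine ⟨fun x hx => ?_, by simpa using h16, by simp, by simp, by simp, by simp⟩
    simp [show x ≠ 10 by omega, show x ≠ 11 by omega, show x ≠ 15 by omega]
  · simp only [Expr.cost]
    rw [← NNReal.coe_le_coe]
    push_cast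
    linarith

end Final

/-! ### Analysis of the search -/

section SearchAnalysis

variable {n : ℕ} {G : SimpleGraph (Fin n)} {L : AdjList G}

theorem sum_deg : ∑ v, (L.deg v : ℝ) = 2 * G.edgeSet.ncard := by
  simp_rw [deg_eq_degInto]
  exact sum_degInto_univ

theorem card_lt_mul_le (Θ : ℕ) :
    ((Finset.univ.filter fun v => Θ ≤ L.deg v).card : ℝ) * Θ ≤ 2 * G.edgeSet.ncard := by
  rw [← sum_deg (L := L)]
  calc ((Finset.univ.filter fun v => Θ ≤ L.deg v).card : ℝ) * Θ
      = ∑ v with Θ ≤ L.deg v, (Θ : ℝ) := by simp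
    _ ≤ ∑ v with Θ ≤ L.deg v, (L.deg v : ℝ) :=
      Finset.sum_le_sum fun v hv => by exact_mod_cast (Finset.mem_filter.mp hv).2
    _ ≤ _ := Finset.sum_le_sum_of_subset_of_nonneg (Finset.subset_univ _) fun _ _ _ => by positivity

theorem sum_range_dirac_lt (θ d : ℕ) :
    ∑ r ∈ Finset.range θ, dirac (decide (r < d)) true = (min d θ : ℕ) := by
  have : ∀ r, dirac (decide (r < d)) true = if r < d then 1 else 0 := fun r => by
    by_cases h : r < d <;> simp [h, dirac]
  simp_rw [this]
  rw [← Finset.sum_filter, Finset.sum_const, nsmul_eq_mul, mul_one]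
  congr 1
  rw [show (Finset.range θ).filter (fun r => r < d) = Finset.range (min d θ) by
    ext r; simp; omega]
  simp

theorem hitProb_true (θ : ℕ) :
    (hitProb L θ true : ℝ) = (∑ v, ((min (L.deg v) θ : ℕ) : ℝ)) / (n * θ) := by
  simp only [hitProb]
  simp_rw [← Finset.mul_sum, sum_range_dirac_lt]
  push_cast
  rw [div_eq_inv_mul, mul_inv]
  ring

theorem sum_hitProb_bit (θ : ℕ) :
    ∑ o, (hitProb L θ o : ℝ) * bit o = hitProb L θ true := by
  simp [bit]

theorem sum_hitProb_bit_sq (θ : ℕ) :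
    ∑ o, (hitProb L θ o : ℝ) * (bit o : ℝ) ^ 2 = hitProb L θ true := by
  simp [bit]

theorem hitTrials_le {θ : ℕ} (hθ : 0 < θ) (hθn : θ ≤ n) :
    (hitTrials n θ : ℝ) ≤ 4096 * (n / θ) := by
  have hθ' : (0 : ℝ) < θ := by exact_mod_cast hθ
  have h1 : ((n / θ : ℕ) : ℝ) ≤ n / θ := Nat.cast_div_le
  have h2 : (1 : ℝ) ≤ n / θ := by
    rw [le_div_iff₀ hθ', one_mul]
    exact_mod_cast hθn
  rw [hitTrials]
  push_cast
  linarith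

theorem div_le_natDiv_add_one {θ : ℕ} (hθ : 0 < θ) : (n : ℝ) / θ ≤ (n / θ : ℕ) + 1 := by
  have hθ' : (0 : ℝ) < θ := by exact_mod_cast hθ
  rw [div_le_iff₀ hθ']
  have : n < (n / θ + 1) * θ := by
    rw [mul_comm]
    exact Nat.lt_mul_div_succ n hθ
  exact_mod_cast this.le

/-- The search is unlikely to stop early. -/
theorem stopProb_true_le {θ : ℕ} (hθ : 0 < θ) (hθn : θ ≤ n) :
    (stopProb L θ true : ℝ) * (θ : ℝ) ^ 2 ≤ 16 * G.edgeSet.ncard := by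
  have hn : 0 < n := lt_of_lt_of_le hθ hθn
  have hθ' : (0 : ℝ) < θ := by exact_mod_cast hθ
  have hn' : (0 : ℝ) < n := by exact_mod_cast hn
  -- Stopping needs 512 = 2048/4 hits, and the expected number of hits is at most 4096(n/θ) ·
  -- 2m/(nθ), whence 8192/512 = 16.
  have h1 := iterExp_markov (p := hitProb L θ) (y := bit) (sum_hitProb hn hθ)
    (f := fun z => dirac (decide (2048 ≤ 4 * z)) true) (a := 512)
    (fun o => by cases o <;> simp [bit]) (fun z hz => ?_) (hitTrials n θ) (z := 0) le_rfl
  · rw [sum_hitProb_bit, hitProb_true] at h1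
    have h2 : (∑ v, ((min (L.deg v) θ : ℕ) : ℝ)) ≤ 2 * G.edgeSet.ncard := by
      rw [← sum_deg (L := L)]
      exact Finset.sum_le_sum fun v _ => by exact_mod_cast min_le_left _ _
    have h3 : (hitTrials n θ : ℝ) * ((∑ v, ((min (L.deg v) θ : ℕ) : ℝ)) / (n * θ))
        ≤ 4096 * (n / θ) * (2 * G.edgeSet.ncard / (n * θ)) := by
      gcongr
      exact hitTrials_le hθ hθn
    have h4 : 4096 * (n / θ) * (2 * G.edgeSet.ncard / (n * θ)) * (θ : ℝ) ^ 2
        = 8192 * (G.edgeSet.ncard : ℝ) := by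
      field_simp
      ring
    have h5 : (stopProb L θ true : ℝ) * 512
        ≤ 4096 * (n / θ) * (2 * G.edgeSet.ncard / (n * θ)) := by
      refine le_trans ?_ h3
      simpa [stopProb] using h1
    have h6 := mul_le_mul_of_nonneg_right h5 (sq_nonneg (θ : ℝ))
    linarith
  · by_cases h : 2048 ≤ 4 * z
    · have h' : (512 : ℝ) ≤ z := by exact_mod_cast (by omega : 512 ≤ z)
      simpa [h, dirac] using h'
    · have h' : (0 : ℝ) ≤ z := by exact_mod_cast hz
      simpa [h, dirac] using h'

/-- Either at least θ vertices have degree at least θ and contribute θ each, or the pairs among the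
fewer heavy vertices number at most θ² ≤ m. Then the degrees of the light vertices, which count
every remaining edge, add up to at least (2m - θ²)/2. -/
theorem sq_le_two_mul_sum_min {θ : ℕ} (hθm : θ ^ 2 ≤ G.edgeSet.ncard) :
    (θ : ℝ) ^ 2 ≤ 2 * ∑ v, ((min (L.deg v) θ : ℕ) : ℝ) := by
  classical
  have hm : (θ : ℝ) ^ 2 ≤ G.edgeSet.ncard := by exact_mod_cast hθm
  set W : Finset (Fin n) := Finset.univ.filter fun v => θ ≤ L.deg v with hW
  by_cases hc : θ ≤ W.card
  · have h1 : (W.card : ℝ) * θ ≤ ∑ v, ((min (L.deg v) θ : ℕ) : ℝ) := by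
      calc (W.card : ℝ) * θ = ∑ v ∈ W, (θ : ℝ) := by simp
        _ ≤ ∑ v ∈ W, ((min (L.deg v) θ : ℕ) : ℝ) := by
          refine Finset.sum_le_sum fun v hv => ?_
          rw [min_eq_right (Finset.mem_filter.mp hv).2]
        _ ≤ _ := Finset.sum_le_sum_of_subset_of_nonneg (Finset.subset_univ _)
          fun _ _ _ => by positivity
    have h2 : (θ : ℝ) ≤ W.card := by exact_mod_cast hc
    nlinarith
  · have hlight : adjPairs G Wᶜ Finset.univ ≤ ∑ v, ((min (L.deg v) θ : ℕ) : ℝ) := by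
      rw [← sum_degInto]
      refine (Finset.sum_le_sum (g := fun v => ((min (L.deg v) θ : ℕ) : ℝ)) fun v hv => ?_).trans
        (Finset.sum_le_sum_of_subset_of_nonneg (Finset.subset_univ _) fun _ _ _ => by positivity)
      rw [← deg_eq_degInto (L := L), min_eq_left]
      have : ¬ θ ≤ L.deg v := by simpa [hW] using hv
      omega
    have htot : adjPairs G Finset.univ Finset.univ
        = adjPairs G W W + adjPairs G W Wᶜ + adjPairs G Wᶜ Finset.univ := by
      rw [← adjPairs_union_right disjoint_compl_right, Finset.union_compl,
        ← adjPairs_union_left disjoint_compl_right, Finset.union_compl]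
    have h1 : adjPairs G W Wᶜ ≤ adjPairs G Wᶜ Finset.univ := by
      rw [adjPairs_comm]
      exact adjPairs_mono le_rfl subset_rfl (Finset.subset_univ _)
    have h2 := adjPairs_le_card_mul_card (F := G) (A := W) (B := W)
    have h3 : (W.card : ℝ) ≤ θ := by exact_mod_cast (not_le.mp hc).le
    have h4 : (W.card : ℝ) * W.card ≤ θ * θ := by gcongr
    rw [adjPairs_univ] at htot
    nlinarith

/-- The search is unlikely to go on for long. -/
theorem stopProb_false_le {θ : ℕ} (hθ : 0 < θ) (hn : 0 < n) (hθm : θ ^ 2 ≤ G.edgeSet.ncard) :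
    (stopProb L θ false : ℝ) ≤ 1 / 256 := by
  have hθ' : (0 : ℝ) < θ := by exact_mod_cast hθ
  have hn' : (0 : ℝ) < n := by exact_mod_cast hn
  set y : ℝ := hitTrials n θ * hitProb L θ true with hy
  have hy1 : 1024 ≤ y := by
    have h1 : 2048 * ((n : ℝ) / θ) ≤ hitTrials n θ := by
      rw [hitTrials]
      push_cast
      have := div_le_natDiv_add_one (n := n) hθ
      linarith
    have h2 : (θ : ℝ) / (2 * n) ≤ hitProb L θ true := by
      rw [hitProb_true, div_le_div_iff₀ (by positivity) (by positivity)]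
      have := sq_le_two_mul_sum_min (L := L) hθm
      nlinarith
    calc (1024 : ℝ) = 2048 * ((n : ℝ) / θ) * (θ / (2 * n)) := by field_simp; norm_num
      _ ≤ y := by rw [hy]; gcongr
  -- At least 1024 hits are expected and going on means fewer than 512, so the deviation is half the
  -- mean `y`, and the probability is at most 4/y.
  have hcheb := iterExp_chebyshev (p := hitProb L θ) (y := bit) (sum_hitProb hn hθ)
    (f := fun z => dirac (decide (2048 ≤ 4 * z)) false) (fun z => dirac_le_one _ _)
    (a := y / 2) (hitTrials n θ) (by linarith) (sum_hitProb_bit θ) (sum_hitProb_bit_sq θ).le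
    (fun z hz => ?_)
  · have h1 : (stopProb L θ false : ℝ) * (y / 2) ^ 2 ≤ y := hcheb
    have h2 : (stopProb L θ false : ℝ) * y ≤ 4 := by
      refine le_of_mul_le_mul_right ?_ (by linarith : 0 < y)
      linarith
    have h3 : (0 : ℝ) ≤ stopProb L θ false := NNReal.coe_nonneg _
    nlinarith
  · have hz' := of_decide_eq_false (dirac_ne_zero.mp hz).symm
    have hz2 : (z : ℝ) ≤ 512 := by exact_mod_cast (by omega : z ≤ 512)
    rw [abs_sub_comm]
    refine le_trans ?_ (le_abs_self _)
    linarith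

end SearchAnalysis

/-! ### Analysis of the sampling of edges -/

section EdgeAnalysis

variable {n : ℕ} {G : SimpleGraph (Fin n)} {L : AdjList G} {α E S l : ℕ}

/-- The expected value of `F` at the sampled edge (`0` if no edge is found). -/
def edgeExp (ν : Option (Fin n × Fin n) → ℝ≥0) (F : Fin n → Fin n → ℝ≥0) : ℝ≥0 :=
  ∑ e : Fin n × Fin n, ν (some e) * F e.1 e.2

variable {F : Fin n → Fin n → ℝ≥0}

theorem edgeExp_sum {ι : Type*} (s : Finset ι) (c : ℝ≥0) (μ : ι → Option (Fin n × Fin n) → ℝ≥0) :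
    edgeExp (fun o => ∑ r ∈ s, c * μ r o) F = ∑ r ∈ s, c * edgeExp (μ r) F := by
  simp only [edgeExp, Finset.sum_mul, Finset.mul_sum]
  rw [Finset.sum_comm]
  simp_rw [mul_assoc]

theorem edgeExp_dirac_some (v u : Fin n) : edgeExp (dirac (some (v, u))) F = F v u := by
  rw [edgeExp, Finset.sum_eq_single (v, u)]
  · simp [dirac]
  · intro e _ he
    simp [dirac, he]
  · simp

theorem edgeExp_dirac_none : edgeExp (dirac none) F = 0 := by
  simp [edgeExp, dirac]

/-- The sum of `F` over the edges at `v`. -/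
def edgeSum (L : AdjList G) (F : Fin n → Fin n → ℝ≥0) (v : Fin n) : ℝ≥0 :=
  ∑ r ∈ Finset.range (L.deg v), F v (L.nbr v r)

theorem edgeExp_secondEdge (Θ : ℕ) (u : Fin n) :
    edgeExp (secondEdge L Θ u) F
      = if Θ < L.deg u then (L.deg u : ℝ≥0)⁻¹ * edgeSum L F u else 0 := by
  rw [secondEdge]
  split_ifs
  · rw [edgeExp_sum]
    simp_rw [edgeExp_dirac_some, edgeSum, Finset.mul_sum]
  · exact edgeExp_dirac_none

theorem edgeExp_edgeFrom (Θ : ℕ) (v : Fin n) (r : ℕ) :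
    edgeExp (edgeFrom L Θ v r) F = if r < L.deg v ∧ L.deg v ≤ Θ then
      2⁻¹ * (F v (L.nbr v r) + edgeExp (secondEdge L Θ (L.nbr v r)) F) else 0 := by
  rw [edgeFrom]
  split_ifs
  · rw [edgeExp_sum, Finset.sum_range_succ, Finset.sum_range_one]
    simp only [if_true, one_ne_zero, if_false, edgeExp_dirac_some]
    push_cast
    ring
  · exact edgeExp_dirac_none

theorem edgeExp_edgeProb (Θ : ℕ) :
    edgeExp (edgeProb L Θ) F = (n : ℝ≥0)⁻¹ * ((Θ : ℝ≥0)⁻¹ * (2⁻¹ * ∑ v with L.deg v ≤ Θ,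
      (edgeSum L F v + ∑ r ∈ Finset.range (L.deg v), edgeExp (secondEdge L Θ (L.nbr v r)) F))) := by
  have h1 : edgeExp (edgeProb L Θ) F
      = ∑ v, (n : ℝ≥0)⁻¹ * ∑ r ∈ Finset.range Θ, (Θ : ℝ≥0)⁻¹ * edgeExp (edgeFrom L Θ v r) F := by
    simp_rw [← edgeExp_sum]
    rfl
  rw [h1, Finset.sum_filter, Finset.mul_sum, Finset.mul_sum, Finset.mul_sum]
  refine Finset.sum_congr rfl fun v _ => ?_
  congr 1
  rw [← Finset.mul_sum]
  congr 1
  simp_rw [edgeExp_edgeFrom]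
  split_ifs with hv
  · have : (Finset.range Θ).filter (fun r => r < L.deg v) = Finset.range (L.deg v) := by
      ext r
      simp
      omega
    simp_rw [and_iff_left hv]
    rw [← Finset.sum_filter, this, ← Finset.mul_sum, Finset.sum_add_distrib, edgeSum]
  · simp [hv]

/-- The edges that can be found at vertices of degree more than `Θ`. -/
theorem sum_light_secondEdge (Θ : ℕ) :
    ((∑ v with L.deg v ≤ Θ, ∑ r ∈ Finset.range (L.deg v),
        edgeExp (secondEdge L Θ (L.nbr v r)) F : ℝ≥0) : ℝ)
      = ∑ u with ¬ L.deg u ≤ Θ, degInto G (Finset.univ.filter fun v => L.deg v ≤ Θ) u *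
        ((L.deg u : ℝ)⁻¹ * edgeSum L F u) := by
  classical
  have hnbr : ∀ v, ∑ r ∈ Finset.range (L.deg v), edgeExp (secondEdge L Θ (L.nbr v r)) F
      = ∑ u, if G.Adj v u then edgeExp (secondEdge L Θ u) F else 0 :=
    fun v => sum_range_nbr v fun u => edgeExp (secondEdge L Θ u) F
  simp_rw [hnbr]
  rw [Finset.sum_comm, Finset.sum_filter]
  push_cast
  refine Finset.sum_congr rfl fun u _ => ?_
  rw [edgeExp_secondEdge]
  by_cases hu : L.deg u ≤ Θ
  · simp [hu, not_lt.mpr hu]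
  · rw [if_pos hu, if_pos (not_le.mp hu), degInto, Finset.sum_mul]
    refine Finset.sum_congr rfl fun v _ => ?_
    by_cases hvu : G.Adj v u
    · simp [hvu, hvu.symm]
    · simp [hvu, mt G.adj_symm hvu]

/-- An oriented edge that starts at a light vertex has probability 1/(2nΘ). One that starts at a
heavy vertex `u` is reached through the light neighbours of `u`, and its weight is multiplied by
their proportion. The coin flip accounts for the factor 2. -/
theorem two_mul_edgeExp (hn : 0 < n) {Θ : ℕ} (hΘ : 0 < Θ) :
    2 * n * Θ * (edgeExp (edgeProb L Θ) F : ℝ) = ∑ v with L.deg v ≤ Θ, (edgeSum L F v : ℝ)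
      + ∑ u with ¬ L.deg u ≤ Θ, degInto G (Finset.univ.filter fun v => L.deg v ≤ Θ) u *
        ((L.deg u : ℝ)⁻¹ * edgeSum L F u) := by
  rw [edgeExp_edgeProb, Finset.sum_add_distrib, ← sum_light_secondEdge]
  push_cast
  have hΘ' : (Θ : ℝ) ≠ 0 := by positivity
  have hn' : (n : ℝ) ≠ 0 := by positivity
  field_simp

theorem edgeExp_le (hn : 0 < n) {Θ : ℕ} (hΘ : 0 < Θ) :
    2 * n * Θ * (edgeExp (edgeProb L Θ) F : ℝ) ≤ ∑ v, (edgeSum L F v : ℝ) := by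
  rw [two_mul_edgeExp hn hΘ, ← Finset.sum_filter_add_sum_filter_not Finset.univ
    (fun v => L.deg v ≤ Θ) (fun v => (edgeSum L F v : ℝ))]
  gcongr with u hu
  have hu' : ¬ L.deg u ≤ Θ := (Finset.mem_filter.mp hu).2
  have hpos : (0 : ℝ) < L.deg u := by exact_mod_cast (by omega)
  have h1 : degInto G (Finset.univ.filter fun v => L.deg v ≤ Θ) u ≤ L.deg u := by
    rw [deg_eq_degInto]
    exact degInto_mono (Finset.subset_univ _) u
  rw [← mul_assoc]
  refine mul_le_of_le_one_left (NNReal.coe_nonneg _) ?_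
  rw [← div_eq_mul_inv, div_le_one hpos]
  exact h1

/-- At most 2m/Θ ≤ Θ/50 vertices are heavy, while a heavy vertex has more than Θ neighbours, so at
least 98 percent of these are light. -/
theorem le_edgeExp (hn : 0 < n) {Θ : ℕ} (hΘ : 0 < Θ)
    (hΘm : 100 * (G.edgeSet.ncard : ℝ) ≤ (Θ : ℝ) ^ 2) :
    0.98 * ∑ v, (edgeSum L F v : ℝ) ≤ 2 * n * Θ * (edgeExp (edgeProb L Θ) F : ℝ) := by
  classical
  have hΘ' : (0 : ℝ) < Θ := by exact_mod_cast hΘ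
  rw [two_mul_edgeExp hn hΘ, ← Finset.sum_filter_add_sum_filter_not Finset.univ
    (fun v => L.deg v ≤ Θ) (fun v => (edgeSum L F v : ℝ)), mul_add, Finset.mul_sum, Finset.mul_sum]
  refine add_le_add (Finset.sum_le_sum fun v hv => ?_) (Finset.sum_le_sum fun u hu => ?_)
  · have : (0 : ℝ) ≤ edgeSum L F v := NNReal.coe_nonneg _
    linarith
  · have hu' : ¬ L.deg u ≤ Θ := (Finset.mem_filter.mp hu).2
    have hdΘ : (Θ : ℝ) ≤ L.deg u := by exact_mod_cast (not_le.mp hu').le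
    have hpos : (0 : ℝ) < L.deg u := lt_of_lt_of_le hΘ' hdΘ
    set A : Finset (Fin n) := Finset.univ.filter fun v => L.deg v ≤ Θ with hA
    have hsplit : (L.deg u : ℝ) = degInto G A u + degInto G Aᶜ u := by
      rw [deg_eq_degInto, degInto, degInto, degInto, Finset.sum_add_sum_compl]
    have hcompl : degInto G Aᶜ u ≤ Aᶜ.card := by
      rw [degInto]
      refine (Finset.sum_le_card_nsmul _ _ (1 : ℝ) fun v _ => ?_).trans_eq (by simp)
      split_ifs <;> norm_num
    have hcard : (Aᶜ.card : ℝ) * Θ ≤ 2 * G.edgeSet.ncard := by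
      refine le_trans ?_ (card_lt_mul_le (L := L) Θ)
      gcongr
      intro v hv
      have : ¬ L.deg v ≤ Θ := by simpa [hA] using hv
      simp
      omega
    have hcard' : (Aᶜ.card : ℝ) ≤ Θ / 50 := by
      refine le_of_mul_le_mul_right ?_ hΘ'
      nlinarith
    have h1 : 0.98 * (L.deg u : ℝ) ≤ degInto G A u := by linarith
    rw [← mul_assoc]
    refine mul_le_mul_of_nonneg_right ?_ (NNReal.coe_nonneg _)
    rw [← div_eq_mul_inv, le_div_iff₀ hpos]
    exact h1

theorem foundProb_eq (Θ : ℕ) : foundProb L Θ = edgeExp (edgeProb L Θ) fun _ _ => 1 := by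
  simp [foundProb, edgeExp]

theorem sum_edgeSum_one : ∑ v, (edgeSum L (fun _ _ => 1) v : ℝ) = 2 * G.edgeSet.ncard := by
  simp [edgeSum, sum_deg]

theorem foundProb_le (hn : 0 < n) {Θ : ℕ} (hΘ : 0 < Θ) :
    n * Θ * (foundProb L Θ : ℝ) ≤ G.edgeSet.ncard := by
  have := edgeExp_le (L := L) (F := fun _ _ => 1) hn hΘ
  rw [sum_edgeSum_one, ← foundProb_eq] at this
  linarith

theorem le_foundProb (hn : 0 < n) {Θ : ℕ} (hΘ : 0 < Θ)
    (hΘm : 100 * (G.edgeSet.ncard : ℝ) ≤ (Θ : ℝ) ^ 2) :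
    0.98 * G.edgeSet.ncard ≤ n * Θ * (foundProb L Θ : ℝ) := by
  have := le_edgeExp (L := L) (F := fun _ _ => 1) hn hΘ hΘm
  rw [sum_edgeSum_one, ← foundProb_eq] at this
  linarith

theorem trialProb_true (Θ : ℕ) : trialProb L α E S l Θ (some true) = edgeExp (edgeProb L Θ)
    fun v u => passProb L α E S l v true * passProb L α E S l u true := by
  rw [trialProb, Fintype.sum_option, edgeExp]
  simp [pairProb, dirac]

theorem sum_edgeSum_pass : ∑ v, (edgeSum L
      (fun v u => passProb L α E S l v true * passProb L α E S l u true) v : ℝ)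
    = ∑ v, passReal L α E S l v * nbrSum G (passReal L α E S l) v := by
  classical
  refine Finset.sum_congr rfl fun v _ => ?_
  rw [edgeSum, ← Finset.mul_sum]
  push_cast
  congr 1
  exact sum_range_nbr (L := L) v (passReal L α E S l)

theorem trialProb_none (Θ : ℕ) : trialProb L α E S l Θ none = edgeProb L Θ none := by
  rw [trialProb, Fintype.sum_option]
  simp [pairProb, dirac]

theorem trialProb_add (hn : 0 < n) {Θ : ℕ} (hΘ : 0 < Θ) :
    (trialProb L α E S l Θ (some true) : ℝ) + trialProb L α E S l Θ (some false)
      = foundProb L Θ := by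
  have h1 := sum_trialProb (L := L) (α := α) (E := E) (S := S) (l := l) hn hΘ
  have h2 := sum_edgeProb (L := L) hn hΘ
  rw [Fintype.sum_option] at h1 h2
  rw [← h2, trialProb_none, add_right_inj, Fintype.sum_bool] at h1
  exact_mod_cast h1

theorem sum_trialProb_score (hn : 0 < n) {Θ : ℕ} (hΘ : 0 < Θ) :
    ∑ o, (trialProb L α E S l Θ o : ℝ) * score E o
      = E * trialProb L α E S l Θ (some true) - 11 * foundProb L Θ := by
  rw [Fintype.sum_option, Fintype.sum_bool, ← trialProb_add hn hΘ]
  simp only [score]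
  push_cast
  ring

/-- A passing edge contributes (E - 11)², which is at most E², and every other edge 121. -/
theorem sum_trialProb_score_sq_le (hn : 0 < n) {Θ : ℕ} (hΘ : 0 < Θ) (hE : 21 ≤ E) :
    ∑ o, (trialProb L α E S l Θ o : ℝ) * (score E o : ℝ) ^ 2
      ≤ E * (E * trialProb L α E S l Θ (some true)) + 121 * foundProb L Θ := by
  have hE' : (21 : ℝ) ≤ E := by exact_mod_cast hE
  rw [Fintype.sum_option, Fintype.sum_bool, ← trialProb_add hn hΘ]
  simp only [score]
  push_cast
  have h1 : (0 : ℝ) ≤ trialProb L α E S l Θ (some true) := NNReal.coe_nonneg _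
  nlinarith

/-- The expected number of edges found is at least 0.98 · 10000000 · E · m/Θ², and 9800000/360000
exceeds 27. -/
theorem le_edgeTrials_mul_foundProb (hn : 0 < n) {Θ : ℕ} (hΘ : 0 < Θ)
    (hm : 0 < G.edgeSet.ncard)
    (hΘm : 100 * (G.edgeSet.ncard : ℝ) ≤ (Θ : ℝ) ^ 2)
    (hΘm' : (Θ : ℝ) ^ 2 ≤ 360000 * (G.edgeSet.ncard : ℝ)) :
    27 * (E : ℝ) ≤ edgeTrials n E Θ * foundProb L Θ := by
  have hΘ' : (0 : ℝ) < Θ := by exact_mod_cast hΘ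
  have hn' : (0 : ℝ) < n := by exact_mod_cast hn
  have hm' : (0 : ℝ) < G.edgeSet.ncard := by exact_mod_cast hm
  have h1 : 10000000 * E * ((n : ℝ) / Θ) ≤ edgeTrials n E Θ := by
    rw [edgeTrials]
    push_cast
    gcongr
    exact div_le_natDiv_add_one hΘ
  have h2 : 0.98 * (G.edgeSet.ncard : ℝ) / (n * Θ) ≤ foundProb L Θ := by
    rw [div_le_iff₀ (by positivity)]
    linarith [le_foundProb (L := L) hn hΘ hΘm]
  calc 27 * (E : ℝ) ≤ 10000000 * E * ((n : ℝ) / Θ) * (0.98 * G.edgeSet.ncard / (n * Θ)) := by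
        rw [show 10000000 * E * ((n : ℝ) / Θ) * (0.98 * G.edgeSet.ncard / (n * Θ))
          = 9800000 * E * G.edgeSet.ncard / (Θ : ℝ) ^ 2 by field_simp; ring,
          le_div_iff₀ (by positivity)]
        have := mul_le_mul_of_nonneg_left hΘm' (by positivity : (0 : ℝ) ≤ 27 * E)
        have h3 : (0 : ℝ) ≤ E * G.edgeSet.ncard := by positivity
        linarith
    _ ≤ _ := by gcongr

/-- If the graph is close to having small arboricity, then the answer is usually positive. -/
theorem answerProb_false_le {j : ℕ} (hα : 1 ≤ α) (hE : 21 ≤ E) (hj : 4 * E ≤ 2 ^ j)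
    (hn : 0 < n) {Θ : ℕ} (hΘ : 0 < Θ) (hm : 0 < G.edgeSet.ncard)
    (hΘm : 100 * (G.edgeSet.ncard : ℝ) ≤ (Θ : ℝ) ^ 2)
    (hΘm' : (Θ : ℝ) ^ 2 ≤ 360000 * (G.edgeSet.ncard : ℝ)) {H : SimpleGraph (Fin n)}
    (hH : arboricity H ≤ α)
    (hR : ((G.edgeSet \ H.edgeSet).ncard : ℝ) * (E - 1) ≤ G.edgeSet.ncard) :
    (answerProb L α E (1000000 * E * E) (1 + 2 * j) Θ false : ℝ) ≤ 1 / 20 := by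
  have hE' : (21 : ℝ) ≤ E := by exact_mod_cast hE
  have hn' : (0 : ℝ) < n := by exact_mod_cast hn
  have hΘ' : (0 : ℝ) < Θ := by exact_mod_cast hΘ
  have hS : 0 < 1000000 * E * E := by positivity
  have hphi := sum_mul_nbrSum_le_of_close hα hE hj rfl hH hR
    (x := passReal L α E (1000000 * E * E)) passReal_nonneg (passReal_le_one hS)
    (passReal_succ_le hα hE)
  set S := 1000000 * E * E
  set l := 1 + 2 * j
  have hq2 := edgeExp_le (L := L)
    (F := fun v u => passProb L α E S l v true * passProb L α E S l u true) hn hΘ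
  rw [sum_edgeSum_pass, ← trialProb_true] at hq2
  have hq1 := le_foundProb (L := L) hn hΘ hΘm
  have hTq := le_edgeTrials_mul_foundProb (L := L) (E := E) hn hΘ hm hΘm hΘm'
  have hmean := sum_trialProb_score (L := L) (α := α) (E := E) (S := S) (l := l) hn hΘ
  have hvar := sum_trialProb_score_sq_le (L := L) (α := α) (S := S) (l := l) hn hΘ hE
  have hq0 : (0 : ℝ) ≤ foundProb L Θ := NNReal.coe_nonneg _
  set q₂ : ℝ := ((trialProb L α E S l Θ (some true) : ℝ≥0) : ℝ)
  set q₁ : ℝ := ((foundProb L Θ : ℝ≥0) : ℝ)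
  set T : ℝ := ((edgeTrials n E Θ : ℕ) : ℝ) with hT
  -- 12m/E passing ordered pairs among 2m, divided by the sampling loss: 6/0.98 is less than 6.13.
  -- The mean score is thus below -4.87 per edge found.
  have hEq : E * q₂ ≤ 6.13 * q₁ := by
    have h1 : 2 * n * Θ * q₂ * E ≤ 12 * G.edgeSet.ncard := by
      have := hq2.trans hphi
      rwa [le_div_iff₀ (by positivity)] at this
    have h2 : n * Θ * (E * q₂) ≤ n * Θ * (6.13 * q₁) := by linarith
    exact le_of_mul_le_mul_left h2 (by positivity)
  have hq1pos : 0 < T * q₁ := by linarith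
  have hcheb := iterExp_chebyshev (p := trialProb L α E S l Θ) (y := score E)
    (sum_trialProb hn hΘ) (f := fun z => dirac (decide (z ≤ 0)) false)
    (fun z => dirac_le_one _ _) (a := 4.8 * (T * q₁)) (edgeTrials n E Θ) (by linarith) hmean
    hvar (fun z hz => ?_)
  · have h1 : (answerProb L α E S l Θ false : ℝ) * (4.8 * (T * q₁)) ^ 2
        ≤ T * (E * (E * q₂) + 121 * q₁) := hcheb
    have h2 : E * (E * q₂) + 121 * q₁ ≤ 12 * E * q₁ := by nlinarith
    have h3 : T * (E * (E * q₂) + 121 * q₁) ≤ 12 * E * (T * q₁) := by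
      have : 0 ≤ T := by positivity
      nlinarith
    have h4 : (answerProb L α E S l Θ false : ℝ) * (4.8 * 4.8 * (T * q₁)) ≤ 12 * E := by
      refine le_of_mul_le_mul_right ?_ hq1pos
      linarith
    have h5 : (0 : ℝ) ≤ answerProb L α E S l Θ false := NNReal.coe_nonneg _
    have h6 : (answerProb L α E S l Θ false : ℝ) * (4.8 * 4.8 * (27 * E)) ≤ 12 * E :=
      le_trans (by gcongr) h4
    refine le_of_mul_le_mul_right ?_ (by positivity : (0 : ℝ) < 622.08 * E)
    linarith
  · have hz' := of_decide_eq_false (dirac_ne_zero.mp hz).symm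
    have hz2 : (0 : ℝ) ≤ z := by exact_mod_cast (not_le.mp hz').le
    refine le_trans ?_ (le_abs_self _)
    have : T * (E * q₂ - 11 * q₁) ≤ T * (-4.87 * q₁) := by
      have : 0 ≤ T := by positivity
      gcongr
      linarith
    linarith

/-- If the graph is far from having small arboricity, then the answer is usually negative. -/
theorem answerProb_true_le (hα : 1 ≤ α) (hE : 21 ≤ E)
    (hn : 0 < n) {Θ : ℕ} (hΘ : 0 < Θ) (hm : 0 < G.edgeSet.ncard)
    (hΘm : 100 * (G.edgeSet.ncard : ℝ) ≤ (Θ : ℝ) ^ 2)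
    (hΘm' : (Θ : ℝ) ^ 2 ≤ 360000 * (G.edgeSet.ncard : ℝ))
    (hfar : ∀ H ≤ G, arboricity H ≤ 3 * α →
      20 * (G.edgeSet.ncard : ℝ) ≤ ((G.edgeSet \ H.edgeSet).ncard : ℝ) * E) (l : ℕ) :
    (answerProb L α E (1000000 * E * E) l Θ true : ℝ) ≤ 1 / 20 := by
  have hE' : (21 : ℝ) ≤ E := by exact_mod_cast hE
  have hn' : (0 : ℝ) < n := by exact_mod_cast hn
  have hΘ' : (0 : ℝ) < Θ := by exact_mod_cast hΘ
  have hphi := le_sum_mul_nbrSum_of_far (l := l) hE hfar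
    (x := passReal L α E (1000000 * E * E)) passReal_nonneg passReal_zero
    (le_passReal_succ hα hE)
  set S := 1000000 * E * E
  have hq2 := le_edgeExp (L := L)
    (F := fun v u => passProb L α E S l v true * passProb L α E S l u true) hn hΘ hΘm
  rw [sum_edgeSum_pass, ← trialProb_true] at hq2
  have hq1 := foundProb_le (L := L) hn hΘ
  have hTq := le_edgeTrials_mul_foundProb (L := L) (E := E) hn hΘ hm hΘm hΘm'
  have hmean := sum_trialProb_score (L := L) (α := α) (E := E) (S := S) (l := l) hn hΘ
  have hvar := sum_trialProb_score_sq_le (L := L) (α := α) (S := S) (l := l) hn hΘ hE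
  have hq0 : (0 : ℝ) ≤ foundProb L Θ := NNReal.coe_nonneg _
  set q₂ : ℝ := ((trialProb L α E S l Θ (some true) : ℝ≥0) : ℝ)
  set q₁ : ℝ := ((foundProb L Θ : ℝ≥0) : ℝ)
  set T : ℝ := ((edgeTrials n E Θ : ℕ) : ℝ) with hT
  have hT0 : 0 ≤ T := by positivity
  -- 0.98 · 19 exceeds 18.6, so 11q₁ is less than 0.6 of E·q₂, and the mean score is at least 0.4 of
  -- it.
  have hEq : 18.6 * q₁ ≤ E * q₂ := by
    have h1 : 0.98 * (38 * G.edgeSet.ncard) ≤ 2 * n * Θ * q₂ * E := by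
      rw [div_le_iff₀ (by positivity)] at hphi
      nlinarith
    have h2 : n * Θ * (18.6 * q₁) ≤ n * Θ * (E * q₂) := by linarith
    exact le_of_mul_le_mul_left h2 (by positivity)
  have hTq2 : T * (18.6 * q₁) ≤ T * (E * q₂) := by gcongr
  set z₀ := E * q₂
  have hz0 : 0 < T * z₀ := by linarith
  have hcheb := iterExp_chebyshev (p := trialProb L α E S l Θ) (y := score E)
    (sum_trialProb hn hΘ) (f := fun z => dirac (decide (z ≤ 0)) true)
    (fun z => dirac_le_one _ _) (a := 0.4 * (T * z₀)) (edgeTrials n E Θ) (by linarith) hmean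
    hvar (fun z hz => ?_)
  · have h1 : (answerProb L α E S l Θ true : ℝ) * (0.4 * (T * z₀)) ^ 2
        ≤ T * (E * z₀ + 121 * q₁) := hcheb
    have h2 : E * z₀ + 121 * q₁ ≤ 1.4 * E * z₀ := by nlinarith
    have h3 : T * (E * z₀ + 121 * q₁) ≤ 1.4 * E * (T * z₀) := by nlinarith
    have h4 : (answerProb L α E S l Θ true : ℝ) * (0.4 * 0.4 * (T * z₀)) ≤ 1.4 * E := by
      refine le_of_mul_le_mul_right ?_ hz0
      linarith
    have h5 : (0 : ℝ) ≤ answerProb L α E S l Θ true := NNReal.coe_nonneg _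
    have h6 : (answerProb L α E S l Θ true : ℝ) * (0.4 * 0.4 * (500 * E)) ≤ 1.4 * E :=
      le_trans (mul_le_mul_of_nonneg_left (by linarith) h5) h4
    refine le_of_mul_le_mul_right ?_ (by positivity : (0 : ℝ) < 80 * E)
    linarith
  · have hz' := of_decide_eq_true (dirac_ne_zero.mp hz).symm
    have hz2 : (z : ℝ) ≤ 0 := by exact_mod_cast hz'
    rw [abs_sub_comm]
    refine le_trans ?_ (le_abs_self _)
    linarith

end EdgeAnalysis

/-! ### The search and the program -/

section Search

variable {w n : ℕ} {G : SimpleGraph (Fin n)} {L : AdjList G} {α E S l : ℕ}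

/-- Decide with the guess in register `8`. -/
def decideAtGuess : Cmd :=
  .cond (.op .lt (.op .mul (.op .mul (.const 500) (.reg 0)) (.reg 1))
      (.op .mul (.reg 8) (.reg 8)))
    (.assign 9 (.const 0))
    (.seq (.assign 16 (.op .mul (.const 30) (.reg 8))) decideBySampling)

/-- Halve the guess in register `8` until there are sufficiently many hits, and then decide. -/
def search : Cmd :=
  .loop (.reg 8) <| .seq countHits <| .cond (.op .lt (.op .mul (.const 4) (.reg 10)) (.const 2048))
    (.assign 8 (.op .div (.reg 8) (.const 2))) (.seq decideAtGuess (.assign 8 (.const 0)))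

/-- The distribution of the answer of `decideAtGuess`. -/
noncomputable def guessProb (L : AdjList G) (α E S l θ : ℕ) : Bool → ℝ≥0 :=
  if 500 * n * α < θ * θ then dirac false else answerProb L α E S l (30 * θ)

/-- A bound for the expected time of `decideAtGuess`. -/
noncomputable def guessTime (L : AdjList G) (α E S l θ : ℕ) : ℝ≥0 :=
  if 500 * n * α < θ * θ then 20 else
    edgeTrials n E (30 * θ) * (80 + foundProb L (30 * θ) * (2 * testTime S l + 80)) + 70

/-- The distribution of the answer of `search`. -/
noncomputable def searchProb (L : AdjList G) (α E S l θ : ℕ) : Bool → ℝ≥0 :=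
  if θ = 0 then dirac true else fun o =>
    stopProb L θ true * guessProb L α E S l θ o +
      stopProb L θ false * searchProb L α E S l (θ / 2) o
termination_by θ
decreasing_by omega

/-- A bound for the expected time of `search`. -/
noncomputable def searchTime (L : AdjList G) (α E S l θ : ℕ) : ℝ≥0 :=
  if θ = 0 then 2 else hitTrials n θ * 30 + 50 + (stopProb L θ true * guessTime L α E S l θ +
      stopProb L θ false * searchTime L α E S l (θ / 2))
termination_by θ
decreasing_by omega

theorem reach_decideAtGuess (hf : Fits w n α E S l) (hn : 0 < n) {θ : ℕ} (hθ : 0 < θ)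
    (hθn : θ ≤ n) (k : List Cmd) {s : Store} (hr : TestRegs α E S l s) (h0 : s.reg 0 = n)
    (h8 : s.reg 8 = θ) :
    Reach w L (decideAtGuess :: k) k s (guessProb L α E S l θ)
      (fun o s' => (∀ x < 9, s'.reg x = s.reg x) ∧ s'.reg 9 = if o then 1 else 0)
      (guessTime L α E S l θ) := by
  have h1 := hf.hits
  have h2 := hf.edges
  have h3 : θ * θ < 2 ^ w := lt_of_le_of_lt (Nat.mul_le_mul hθn hθn) hf.square
  have hcond : (Expr.op .lt (.op .mul (.op .mul (.const 500) (.reg 0)) (.reg 1))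
      (.op .mul (.reg 8) (.reg 8))).eval w s = if 500 * n * α < θ * θ then 1 else 0 :=
    eval_lt (eval_mul (eval_mul (eval_const (by omega)) (eval_reg h0) (by omega))
      (eval_reg hr.alpha) h2) (eval_mul (eval_reg h8) (eval_reg h8) h3) (by omega)
  rw [guessProb, guessTime]
  split_ifs with h
  · refine (Reach.cond_true ?_ <| Reach.assign (v := 0) ?_ <| Reach.refl false ?_).le ?_
    · rw [hcond, if_pos h]
      exact one_ne_zero
    · exact eval_const (by omega)
    · refine ⟨fun x hx => ?_, by simp⟩
      simp [show x ≠ 9 by omega]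
    · norm_num [Expr.cost]
  · refine (Reach.cond_false ?_ <| Reach.seq <| Reach.assign (v := 30 * θ) ?_ <|
      (reach_decideBySampling hf hn (Θ := 30 * θ) (by omega) k ?_ ?_ ?_).mono (fun _ => rfl)
        ?_ le_rfl).le ?_
    · rw [hcond, if_neg h]
    · exact eval_mul (eval_const (by omega)) (eval_reg h8) (by omega)
    · exact ⟨by simpa using hr.alpha, by simpa using hr.eps, by simpa using hr.samples,
        by simpa using hr.rounds⟩
    · simpa using h0
    · simp
    · rintro o s' ⟨g1, g2⟩
      refine ⟨fun x hx => (g1 x hx).trans ?_, g2⟩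
      simp [show x ≠ 16 by omega]
    · simp only [Expr.cost]
      rw [← NNReal.coe_le_coe]
      push_cast
      linarith

theorem sum_guessProb (hn : 0 < n) {θ : ℕ} (hθ : 0 < θ) : ∑ o, guessProb L α E S l θ o = 1 := by
  rw [guessProb]
  split_ifs
  · exact sum_dirac _
  · exact sum_answerProb hn (by omega)

theorem searchProb_zero : searchProb L α E S l 0 = dirac true := by
  rw [searchProb, if_pos rfl]

theorem searchProb_of_pos {θ : ℕ} (hθ : 0 < θ) (o : Bool) : searchProb L α E S l θ o
    = stopProb L θ true * guessProb L α E S l θ o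
      + stopProb L θ false * searchProb L α E S l (θ / 2) o := by
  conv_lhs => rw [searchProb, if_neg hθ.ne']

theorem sum_searchProb {θ : ℕ} (hθn : θ ≤ n) : ∑ o, searchProb L α E S l θ o = 1 := by
  induction θ using Nat.strong_induction_on with
  | _ θ ih =>
    rcases Nat.eq_zero_or_pos θ with rfl | hθ
    · rw [searchProb_zero]
      exact sum_dirac _
    · have hn := lt_of_lt_of_le hθ hθn
      simp_rw [searchProb_of_pos hθ]
      rw [Finset.sum_add_distrib, ← Finset.mul_sum, ← Finset.mul_sum, sum_guessProb hn hθ,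
        ih (θ / 2) (by omega) (by omega), mul_one, mul_one, ← sum_stopProb (L := L) hn hθ, Fintype.sum_bool]

/-- Strong induction on the guess. A decision is followed by setting the guess to 0, which leaves
the loop. Register 9 starts at 1: if the guess reaches 0 by halving, no decision was made and the
answer is YES. -/
theorem reach_search (hf : Fits w n α E S l) (k : List Cmd) (θ : ℕ) :
    θ ≤ n → ∀ s : Store, TestRegs α E S l s → s.reg 0 = n → s.reg 8 = θ → s.reg 9 = 1 →
    Reach w L (search :: k) k s (searchProb L α E S l θ)
      (fun o s' => s'.reg 9 = if o then 1 else 0) (searchTime L α E S l θ) := by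
  induction θ using Nat.strong_induction_on with
  | _ θ ih =>
    intro hθn s hr h0 h8 h9
    have hsize := hf.size
    have hhits := hf.hits
    rw [searchProb, searchTime]
    split_ifs with hθ
    · subst hθ
      refine (Reach.loop_false (eval_reg h8) <| Reach.refl true ?_).le ?_
      · simpa using h9
      · norm_num [Expr.cost]
    · have hθ' : 0 < θ := Nat.pos_of_ne_zero hθ
      have hn : 0 < n := lt_of_lt_of_le hθ' hθn
      refine (Reach.loop_true ?_ <| Reach.seq <| ((reach_countHits hhits hθ' hn _ h0 h8).bind
        (μ := fun o => if o then guessProb L α E S l θ else searchProb L α E S l (θ / 2))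
        (T' := fun o => 12 + if o then guessTime L α E S l θ else searchTime L α E S l (θ / 2))
        (R := fun o s' => s'.reg 9 = if o then 1 else 0) ?_).mono
        (ν' := fun o => stopProb L θ true * guessProb L α E S l θ o +
          stopProb L θ false * searchProb L α E S l (θ / 2) o)
        (fun o => ?_) (fun _ _ => id) le_rfl).le ?_
      · rw [eval_reg h8]
        exact hθ
      · rintro o s₁ ⟨g1, g2, g3⟩
        have hr₁ : TestRegs α E S l s₁ := ⟨(g1 1 (by norm_num)).trans hr.alpha,
          (g1 4 (by norm_num)).trans hr.eps, (g1 5 (by norm_num)).trans hr.samples,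
          (g1 7 (by norm_num)).trans hr.rounds⟩
        have e0 := (g1 0 (by norm_num)).trans h0
        have e8 := (g1 8 (by norm_num)).trans h8
        have e9 := (g1 9 (by norm_num)).trans h9
        have hcond : (Expr.op .lt (.op .mul (.const 4) (.reg 10)) (.const 2048)).eval w s₁
            = if 4 * s₁.reg 10 < 2048 then 1 else 0 :=
          eval_lt (eval_mul (eval_const (by omega)) (eval_reg rfl) g2) (eval_const (by omega))
            (by omega)
        cases o with
        | true =>
          have hle := of_decide_eq_true g3
          refine (Reach.cond_false ?_ <| Reach.seq <| ((reach_decideAtGuess hf hn hθ' hθn _ hr₁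
            e0 e8).bind (μ := fun o => dirac o) (T' := fun _ => 4)
            (R := fun o s' => s'.reg 9 = if o then 1 else 0) ?_).mono
            (ν' := guessProb L α E S l θ) (fun o => ?_)
            (fun _ _ => id) le_rfl).le ?_
          · rw [hcond, if_neg (not_lt.mpr hle)]
          · rintro o s₂ ⟨f1, f2⟩
            refine (Reach.assign (v := 0) ?_ <| Reach.loop_false ?_ <| Reach.refl o ?_).le ?_
            · exact eval_const (by omega)
            · exact eval_reg (by simp)
            · simpa using f2
            · norm_num [Expr.cost]
          · simp [dirac]
          · simp only [Expr.cost, if_true]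
            rw [← Finset.sum_mul, sum_guessProb hn hθ', ← NNReal.coe_le_coe]
            push_cast
            linarith
        | false =>
          have hlt := not_le.mp (of_decide_eq_false g3)
          refine (Reach.cond_true ?_ <| Reach.assign (v := θ / 2) ?_ <|
            (ih (θ / 2) (by omega) (by omega) _ ?_ ?_ ?_ ?_)).le ?_
          · rw [hcond, if_pos hlt]
            exact one_ne_zero
          · exact eval_div (eval_reg e8) (eval_const (by omega)) (by omega)
          · exact ⟨by simpa using hr₁.alpha, by simpa using hr₁.eps, by simpa using hr₁.samples,
              by simpa using hr₁.rounds⟩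
          · simpa using e0
          · simp
          · simpa using e9
          · simp only [Expr.cost, Bool.false_eq_true, if_false]
            rw [← add_assoc]
            gcongr
            norm_num
      · simp
      · have hsum := sum_stopProb (L := L) hn hθ'
        rw [Fintype.sum_bool] at hsum ⊢
        simp only [Expr.cost, if_true, Bool.false_eq_true, if_false]
        rw [← NNReal.coe_le_coe]
        rw [← NNReal.coe_inj] at hsum
        push_cast at hsum ⊢
        linarith

/-! ### The program -/

/-- Set up the parameters. -/
def setup : Cmd :=
  .seq (.assign 4 (.op .add (.op .div (.reg 3) (.reg 2)) (.const 1))) <|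
  .seq (.assign 5 (.op .mul (.op .mul (.const 1000000) (.reg 4)) (.reg 4))) <|
  .seq (.assign 6 (.const 1)) <|
  .seq (.assign 7 (.const 1)) <|
  .seq (.loop (.op .lt (.reg 6) (.op .mul (.const 4) (.reg 4)))
    (.seq (.assign 6 (.op .mul (.const 2) (.reg 6)))
      (.assign 7 (.op .add (.reg 7) (.const 2))))) <|
  .seq (.assign 8 (.reg 0)) (.assign 9 (.const 1))

/-- The whole program. -/
def program : Cmd := .seq setup <| .seq search <| .assign 0 (.reg 9)

/-- Logarithm by doubling: register 6 runs through the powers of 2 and register 7 counts two rounds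
for each, until `4 * E` is reached. The induction is on the number `d` of doublings to come. -/
theorem reach_roundsLoop {j : ℕ} (hj : j = Nat.clog 2 (4 * E)) (hw : 2 * 2 ^ j < 2 ^ w)
    (haddr : 2 * j + 10 < 2 ^ w) (hE : 4 * E < 2 ^ w) (k : List Cmd) (d : ℕ) :
    ∀ i, i + d = j → ∀ s : Store, s.reg 4 = E → s.reg 6 = 2 ^ i → s.reg 7 = 1 + 2 * i →
    Reach w L (.loop (.op .lt (.reg 6) (.op .mul (.const 4) (.reg 4)))
      (.seq (.assign 6 (.op .mul (.const 2) (.reg 6)))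
        (.assign 7 (.op .add (.reg 7) (.const 2)))) :: k) k s (dirac ())
      (fun _ s' => (∀ x < 6, s'.reg x = s.reg x) ∧ s'.reg 7 = 1 + 2 * j) (20 * d + 10) := by
  have hcond : ∀ (s : Store) (i : ℕ), s.reg 4 = E → s.reg 6 = 2 ^ i →
      (Expr.op .lt (.reg 6) (.op .mul (.const 4) (.reg 4))).eval w s
        = if 2 ^ i < 4 * E then 1 else 0 := fun s i h4 h6 =>
    eval_lt (eval_reg h6) (eval_mul (eval_const (by omega)) (eval_reg h4) hE) (by omega)
  induction d with
  | zero =>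
    rintro i hi s h4 h6 h7
    obtain rfl : i = j := by omega
    refine (Reach.loop_false ?_ <| Reach.refl () ?_).le ?_
    · rw [hcond s i h4 h6, if_neg]
      rw [not_lt, hj]
      exact Nat.le_pow_clog (by norm_num) _
    · exact ⟨fun _ _ => rfl, h7⟩
    · norm_num [Expr.cost]
  | succ d ih =>
    rintro i hi s h4 h6 h7
    have hle : 2 ^ i ≤ 2 ^ j := Nat.pow_le_pow_right (by norm_num) (by omega)
    refine (Reach.loop_true ?_ <| Reach.seq <| Reach.assign (v := 2 ^ (i + 1)) ?_ <|
      Reach.assign (v := 1 + 2 * (i + 1)) ?_ <| (ih (i + 1) (by omega) _ ?_ ?_ ?_).mono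
      (fun _ => rfl) ?_ le_rfl).le ?_
    · rw [hcond s i h4 h6, if_pos]
      · exact one_ne_zero
      · rw [← Nat.lt_clog_iff_pow_lt (by norm_num)]
        omega
    · rw [pow_succ, mul_comm]
      exact eval_mul (eval_const (by omega)) (eval_reg h6) (by omega)
    · rw [mul_add, ← add_assoc]
      exact eval_add (eval_reg (by simpa using h7)) (eval_const (by omega)) (by omega)
    · simpa using h4
    · simp
    · simp
    · rintro _ s' ⟨g1, g2⟩
      refine ⟨fun x hx => (g1 x hx).trans ?_, g2⟩
      simp [show x ≠ 6 by omega, show x ≠ 7 by omega]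
    · simp only [Expr.cost]
      rw [← NNReal.coe_le_coe]
      push_cast
      linarith

theorem reach_program {num den j : ℕ} (hE : E = den / num + 1) (hj : j = Nat.clog 2 (4 * E))
    (hS : S = 1000000 * E * E) (hf : Fits w n α E S (1 + 2 * j)) (hw : 2 * 2 ^ j < 2 ^ w)
    (hSw : S < 2 ^ w) (hden : den < 2 ^ w)
    {s : Store} (h0 : s.reg 0 = n) (h1 : s.reg 1 = α) (h2 : s.reg 2 = num)
    (h3 : s.reg 3 = den) :
    Reach w L [program] [] s (searchProb L α E S (1 + 2 * j) n)
      (fun o s' => s'.reg 0 = if o then 1 else 0)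
      (searchTime L α E S (1 + 2 * j) n + (20 * j + 80)) := by
  have haddr := hf.addr
  have hsize := hf.size
  have hEpos := hf.eps_pos
  have hES : 1000000 * E ≤ S := by
    rw [hS]
    exact Nat.le_mul_of_pos_right _ hEpos
  refine (Reach.seq <| Reach.seq <| Reach.assign (v := E) ?_ <| Reach.seq <|
    Reach.assign (v := S) ?_ <| Reach.seq <| Reach.assign (v := 1) ?_ <| Reach.seq <|
    Reach.assign (v := 1) ?_ <| Reach.seq <| (reach_roundsLoop hj hw (by omega) (by omega) _ j 0
      (by omega) _ ?_ ?_ ?_).bind_unit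
      (T₂ := searchTime L α E S (1 + 2 * j) n + 20) ?_).le ?_
  rotate_left 7
  · rintro s' ⟨g1, g7⟩
    have e0 : s'.reg 0 = n := (g1 0 (by norm_num)).trans (by simpa using h0)
    have e1 : s'.reg 1 = α := (g1 1 (by norm_num)).trans (by simpa using h1)
    have e4 : s'.reg 4 = E := (g1 4 (by norm_num)).trans (by simp)
    have e5 : s'.reg 5 = S := (g1 5 (by norm_num)).trans (by simp)
    refine (Reach.seq <| Reach.assign (v := n) ?_ <| Reach.assign (v := 1) ?_ <| Reach.seq <|
      ((reach_search hf _ n le_rfl _ ?_ ?_ ?_ ?_).bind (μ := fun o => dirac o)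
        (T' := fun _ => 2) (R := fun o s' => s'.reg 0 = if o then 1 else 0) ?_).mono
        (ν' := searchProb L α E S (1 + 2 * j) n) (T' := searchTime L α E S (1 + 2 * j) n + 2)
        (fun o => ?_) (fun _ _ => id) ?_).le ?_
    · exact eval_reg e0
    · exact eval_const (by omega)
    · exact ⟨by simpa using e1, by simpa using e4, by simpa using e5, by simpa using g7⟩
    · simpa using e0
    · simp
    · simp
    · rintro o s₂ h
      refine (Reach.assign (v := if o then 1 else 0) (eval_reg h) <| Reach.refl o ?_).le ?_
      · simp
      · norm_num [Expr.cost]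
    · simp [dirac]
    · rw [← Finset.sum_mul, sum_searchProb le_rfl, one_mul]
    · simp only [Expr.cost]
      rw [← NNReal.coe_le_coe]
      push_cast
      linarith
  · simp only [Expr.cost]
    rw [← NNReal.coe_le_coe]
    push_cast
    linarith
  · rw [hE]
    exact eval_add (eval_div (eval_reg h3) (eval_reg h2) hden) (eval_const (by omega)) (by omega)
  · rw [hS]
    exact eval_mul (eval_mul (eval_const (by omega)) (eval_reg (by simp)) (by omega))
      (eval_reg (by simp)) (by omega)
  · exact eval_const (by omega)
  · exact eval_const (by omega)
  · simp
  · simp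
  · simp

end Search

/-! ### Analysis of the program -/

section ProgramAnalysis

variable {n : ℕ} {G : SimpleGraph (Fin n)} {L : AdjList G} {α E S l : ℕ}

/-- Rounded halving loses at most a factor 3. This is the source of the constants 9 and 81 for
squares and fourth powers of the guess. -/
theorem le_three_mul_half {θ : ℕ} (hθ : 2 ≤ θ) : θ ≤ 3 * (θ / 2) := by omega

theorem stopProb_add (hn : 0 < n) {θ : ℕ} (hθ : 0 < θ) :
    (stopProb L θ true : ℝ) + stopProb L θ false = 1 := by
  have := sum_stopProb (L := L) hn hθ
  rw [Fintype.sum_bool] at this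
  exact_mod_cast this

theorem guessProb_le_one (hn : 0 < n) {θ : ℕ} (hθ : 0 < θ) (o : Bool) :
    (guessProb L α E S l θ o : ℝ) ≤ 1 := by
  rw [← NNReal.coe_one, ← sum_guessProb (L := L) (α := α) (E := E) (S := S) (l := l) hn hθ,
    NNReal.coe_le_coe]
  exact Finset.single_le_sum (fun _ _ => zero_le) (Finset.mem_univ o)

theorem searchProb_le_one {θ : ℕ} (hθn : θ ≤ n) (o : Bool) :
    (searchProb L α E S l θ o : ℝ) ≤ 1 := by
  rw [← NNReal.coe_one, ← sum_searchProb (L := L) (α := α) (E := E) (S := S) (l := l) hθn,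
    NNReal.coe_le_coe]
  exact Finset.single_le_sum (fun _ _ => zero_le) (Finset.mem_univ o)

theorem coe_searchProb_of_pos {θ : ℕ} (hθ : 0 < θ) (o : Bool) :
    (searchProb L α E S l θ o : ℝ) = stopProb L θ true * guessProb L α E S l θ o
      + stopProb L θ false * searchProb L α E S l (θ / 2) o := by
  rw [searchProb_of_pos hθ]
  push_cast
  rfl

/-- Without edges the answer is positive. -/
theorem searchProb_true_of_no_edges (hm : G.edgeSet.ncard = 0) (θ : ℕ) :
    θ ≤ n → (searchProb L α E S l θ true : ℝ) = 1 := by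
  induction θ using Nat.strong_induction_on with
  | _ θ ih =>
    intro hθn
    rcases Nat.eq_zero_or_pos θ with rfl | hθ
    · simp [searchProb_zero, dirac]
    · have h1 := stopProb_true_le (L := L) hθ hθn
      have h2 := stopProb_add (L := L) (lt_of_lt_of_le hθ hθn) hθ
      have hθ' : (0 : ℝ) < (θ : ℝ) ^ 2 := by positivity
      have h3 : (stopProb L θ true : ℝ) = 0 := by
        refine le_antisymm ?_ (NNReal.coe_nonneg _)
        rw [hm] at h1
        refine le_of_mul_le_mul_right ?_ hθ'
        simpa using h1
      rw [coe_searchProb_of_pos hθ, ih (θ / 2) (by omega) (by omega), h3]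
      linarith

/-- The probability of a wrong answer if the guess is not too large. -/
theorem searchProb_le_of_sq_le {o : Bool} (hm : 0 < G.edgeSet.ncard)
    (h : ∀ θ, 0 < θ → θ ≤ n → G.edgeSet.ncard ≤ 9 * θ ^ 2 → θ ^ 2 ≤ 400 * G.edgeSet.ncard →
      (guessProb L α E S l θ o : ℝ) ≤ 1 / 20) (θ : ℕ) :
    0 < θ → θ ≤ n → G.edgeSet.ncard ≤ 9 * θ ^ 2 → θ ^ 2 ≤ 400 * G.edgeSet.ncard →
      (searchProb L α E S l θ o : ℝ) ≤ 1 / 20 + 1 / 256 := by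
  induction θ using Nat.strong_induction_on with
  | _ θ ih =>
    intro hθ hθn h1 h2
    have hn := lt_of_lt_of_le hθ hθn
    have hsum := stopProb_add (L := L) hn hθ
    have hg := h θ hθ hθn h1 h2
    have hs0 : (0 : ℝ) ≤ stopProb L θ true := NNReal.coe_nonneg _
    have hs1 : (0 : ℝ) ≤ stopProb L θ false := NNReal.coe_nonneg _
    rw [coe_searchProb_of_pos hθ]
    have hg' := mul_le_mul_of_nonneg_left hg hs0
    -- Once θ² ≤ m, going on has probability at most 1/256, and a wrong answer afterwards is
    -- conceded. Before that, the halved guess is still in the window, and the bound is preserved as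
    -- a convex combination.
    by_cases hle : θ ^ 2 ≤ G.edgeSet.ncard
    · have h3 := stopProb_false_le (L := L) hθ hn hle
      have h4 := mul_le_mul_of_nonneg_left (searchProb_le_one (L := L) (α := α) (E := E) (S := S)
        (l := l) (show θ / 2 ≤ n by omega) o) hs1
      linarith
    · have hθ2 : 2 ≤ θ := by
        by_contra hlt
        obtain rfl : θ = 1 := by omega
        omega
      have h5 := le_three_mul_half hθ2
      have h6 : θ ^ 2 ≤ 9 * (θ / 2) ^ 2 := by
        calc θ ^ 2 ≤ (3 * (θ / 2)) ^ 2 := Nat.pow_le_pow_left h5 2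
          _ = _ := by ring
      have h7 : (θ / 2) ^ 2 ≤ θ ^ 2 := Nat.pow_le_pow_left (by omega) 2
      have h8 := mul_le_mul_of_nonneg_left
        (ih (θ / 2) (by omega) (by omega) (by omega) (by omega) (by omega)) hs1
      linarith

/-- The probability of a wrong answer. -/
theorem searchProb_le {o : Bool} (hm : 0 < G.edgeSet.ncard)
    (h : ∀ θ, 0 < θ → θ ≤ n → G.edgeSet.ncard ≤ 9 * θ ^ 2 → θ ^ 2 ≤ 400 * G.edgeSet.ncard →
      (guessProb L α E S l θ o : ℝ) ≤ 1 / 20) (θ : ℕ) :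
    θ ≤ n → 400 * G.edgeSet.ncard < θ ^ 2 →
      (searchProb L α E S l θ o : ℝ)
        ≤ 1 / 8 - 16 / 3 * (G.edgeSet.ncard / (θ : ℝ) ^ 2) := by
  induction θ using Nat.strong_induction_on with
  | _ θ ih =>
    intro hθn h2
    have hθ : 0 < θ := by
      by_contra h0
      obtain rfl : θ = 0 := by omega
      omega
    have hθ' : (0 : ℝ) < θ := by exact_mod_cast hθ
    have hn := lt_of_lt_of_le hθ hθn
    have hsum := stopProb_add (L := L) hn hθ
    have hs0 : (0 : ℝ) ≤ stopProb L θ true := NNReal.coe_nonneg _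
    have hp0 : (0 : ℝ) ≤ searchProb L α E S l (θ / 2) o := NNReal.coe_nonneg _
    have hsp : (stopProb L θ true : ℝ) ≤ 16 * (G.edgeSet.ncard / (θ : ℝ) ^ 2) := by
      rw [← mul_div_assoc, le_div_iff₀ (by positivity)]
      exact stopProb_true_le hθ hθn
    have hsmall : (G.edgeSet.ncard : ℝ) / (θ : ℝ) ^ 2 ≤ 1 / 400 := by
      rw [div_le_div_iff₀ (by positivity) (by norm_num)]
      have : (400 * G.edgeSet.ncard : ℝ) < (θ : ℝ) ^ 2 := by exact_mod_cast h2
      linarith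
    -- Stopping too early, with probability at most 16m/θ², is conceded as an error. These
    -- probabilities grow by a factor at least 4 with each halving; the term -(16/3)m/θ² in the
    -- claim sums the geometric series, since 4 · 16/3 - 16 = 16/3.
    have hmain : (searchProb L α E S l θ o : ℝ)
        ≤ 16 * (G.edgeSet.ncard / (θ : ℝ) ^ 2) + searchProb L α E S l (θ / 2) o := by
      rw [coe_searchProb_of_pos hθ]
      have h3 := mul_le_mul_of_nonneg_left (guessProb_le_one (L := L) (α := α) (E := E) (S := S)
        (l := l) hn hθ o) hs0
      have h4 : (stopProb L θ false : ℝ) * searchProb L α E S l (θ / 2) o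
          ≤ 1 * searchProb L α E S l (θ / 2) o :=
        mul_le_mul_of_nonneg_right (by linarith) hp0
      linarith
    have hθ2 : 2 ≤ θ := by
      by_contra hlt
      obtain rfl : θ = 1 := by omega
      omega
    have hhalf : 0 < θ / 2 := by omega
    by_cases hle : (θ / 2) ^ 2 ≤ 400 * G.edgeSet.ncard
    · have h6 : θ ^ 2 ≤ 9 * (θ / 2) ^ 2 := by
        calc θ ^ 2 ≤ (3 * (θ / 2)) ^ 2 := Nat.pow_le_pow_left (le_three_mul_half hθ2) 2
          _ = _ := by ring
      have := searchProb_le_of_sq_le hm h (θ / 2) hhalf (by omega) (by omega) hle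
      linarith
    · have h7 := ih (θ / 2) (by omega) (by omega) (by omega)
      have h8 : 4 * ((G.edgeSet.ncard : ℝ) / (θ : ℝ) ^ 2)
          ≤ G.edgeSet.ncard / ((θ / 2 : ℕ) : ℝ) ^ 2 := by
        have h9 : ((θ / 2 : ℕ) : ℝ) ≤ θ / 2 := Nat.cast_div_le
        have h10 : (0 : ℝ) < (θ / 2 : ℕ) := by exact_mod_cast hhalf
        calc 4 * ((G.edgeSet.ncard : ℝ) / (θ : ℝ) ^ 2)
            = G.edgeSet.ncard / ((θ : ℝ) / 2) ^ 2 := by field_simp; norm_num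
          _ ≤ _ := by gcongr
      linarith

theorem ncard_edgeSet_lt_sq (L : AdjList G) (hm : 0 < G.edgeSet.ncard) :
    G.edgeSet.ncard < n ^ 2 := by
  classical
  have h1 : (2 * G.edgeSet.ncard : ℝ) = ∑ v, (L.deg v : ℝ) := sum_deg.symm
  have h2 : ∑ v, (L.deg v : ℝ) ≤ ∑ _v : Fin n, (n : ℝ) :=
    Finset.sum_le_sum fun v _ => by exact_mod_cast (deg_lt (L := L) v).le
  have h3 : (2 * G.edgeSet.ncard : ℝ) ≤ (n : ℝ) * n := by
    rw [h1]
    simpa using h2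
  have h4 : 2 * G.edgeSet.ncard ≤ n * n := by exact_mod_cast h3
  rw [sq]
  omega

theorem searchProb_initial_le {o : Bool} (hm : 0 < G.edgeSet.ncard)
    (h : ∀ θ, 0 < θ → θ ≤ n → G.edgeSet.ncard ≤ 9 * θ ^ 2 → θ ^ 2 ≤ 400 * G.edgeSet.ncard →
      (guessProb L α E S l θ o : ℝ) ≤ 1 / 20) :
    (searchProb L α E S l n o : ℝ) ≤ 1 / 3 := by
  have hmn := ncard_edgeSet_lt_sq L hm
  by_cases hle : n ^ 2 ≤ 400 * G.edgeSet.ncard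
  · have hn : 0 < n := by
      by_contra h0
      obtain rfl : n = 0 := by omega
      omega
    have := searchProb_le_of_sq_le hm h n hn le_rfl (by omega) hle
    linarith
  · have := searchProb_le hm h n le_rfl (by omega)
    have h0 : (0 : ℝ) ≤ G.edgeSet.ncard / (n : ℝ) ^ 2 := by positivity
    linarith

/-- At most m/20 edges are removed, and a graph of arboricity α has at most αn edges. A close graph
is therefore never rejected for its density. -/
theorem ncard_le_of_close {H : SimpleGraph (Fin n)} (hHG : H ≤ G) (hH : arboricity H ≤ α)
    (hE : 21 ≤ E) (hR : ((G.edgeSet \ H.edgeSet).ncard : ℝ) * (E - 1) ≤ G.edgeSet.ncard) :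
    19 * G.edgeSet.ncard ≤ 20 * (α * n) := by
  classical
  have hE' : (21 : ℝ) ≤ E := by exact_mod_cast hE
  have h1 : 20 * (G.edgeSet \ H.edgeSet).ncard ≤ G.edgeSet.ncard := by
    have : (20 : ℝ) * (G.edgeSet \ H.edgeSet).ncard ≤ G.edgeSet.ncard := by
      nlinarith [(Nat.cast_nonneg (G.edgeSet \ H.edgeSet).ncard : (0 : ℝ) ≤ _)]
    exact_mod_cast this
  have h2 := adjPairs_le_of_arboricity_le hH Finset.univ
  rw [adjPairs_univ, Finset.card_univ, Fintype.card_fin] at h2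
  have h3 : (G.edgeSet \ H.edgeSet).ncard + H.edgeSet.ncard = G.edgeSet.ncard :=
    Set.ncard_sdiff_add_ncard_of_subset (SimpleGraph.edgeSet_mono hHG) (Set.toFinite _)
  have h4 : 2 * H.edgeSet.ncard ≤ 2 * α * n := by exact_mod_cast h2
  nlinarith

/-- The positive answer is likely if the graph is close to having small arboricity. -/
theorem searchProb_false_le {j : ℕ} (hE : 21 ≤ E) (hj : 4 * E ≤ 2 ^ j)
    (hm : 0 < G.edgeSet.ncard) {H : SimpleGraph (Fin n)} (hHG : H ≤ G) (hH : arboricity H ≤ α)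
    (hR : ((G.edgeSet \ H.edgeSet).ncard : ℝ) * (E - 1) ≤ G.edgeSet.ncard) :
    (searchProb L α E (1000000 * E * E) (1 + 2 * j) n false : ℝ) ≤ 1 / 3 := by
  refine searchProb_initial_le hm fun θ hθ hθn h1 h2 => ?_
  have h3 := ncard_le_of_close hHG hH hE hR
  have hα : 1 ≤ α := by
    by_contra h0
    obtain rfl : α = 0 := by omega
    omega
  -- θ² ≤ 400m ≤ 400 · (20/19)αn, which is less than 500αn.
  have h4 : ¬ 500 * n * α < θ * θ := by
    rw [← sq, not_lt]
    nlinarith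
  rw [guessProb, if_neg h4]
  have h1' : (G.edgeSet.ncard : ℝ) ≤ 9 * (θ : ℝ) ^ 2 := by exact_mod_cast h1
  have h2' : (θ : ℝ) ^ 2 ≤ 400 * G.edgeSet.ncard := by exact_mod_cast h2
  refine answerProb_false_le hα hE hj (by omega) (by omega) hm ?_ ?_ hH hR
  · push_cast
    linarith
  · push_cast
    linarith

/-- The negative answer is likely if the graph is far from having small arboricity. -/
theorem searchProb_true_le (hE : 21 ≤ E) (hm : 0 < G.edgeSet.ncard)
    (hfar : ∀ H ≤ G, arboricity H ≤ 3 * α →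
      20 * (G.edgeSet.ncard : ℝ) ≤ ((G.edgeSet \ H.edgeSet).ncard : ℝ) * E) :
    (searchProb L α E (1000000 * E * E) l n true : ℝ) ≤ 1 / 3 := by
  refine searchProb_initial_le hm fun θ hθ hθn h1 h2 => ?_
  rw [guessProb]
  split_ifs with h4
  · simp [dirac]
  have hα : 1 ≤ α := by
    by_contra h0
    obtain rfl : α = 0 := by omega
    exact h4 (by positivity)
  have h1' : (G.edgeSet.ncard : ℝ) ≤ 9 * (θ : ℝ) ^ 2 := by exact_mod_cast h1
  have h2' : (θ : ℝ) ^ 2 ≤ 400 * G.edgeSet.ncard := by exact_mod_cast h2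
  refine answerProb_true_le hα hE (by omega) (by omega) hm ?_ ?_ hfar l
  · push_cast
    linarith
  · push_cast
    linarith

end ProgramAnalysis

/-! ### Running time -/

section RunningTime

variable {n : ℕ} {G : SimpleGraph (Fin n)} {L : AdjList G} {α E S l : ℕ}

theorem le_testTime (S l : ℕ) : 100 ≤ testTime S l := by
  cases l <;> simp [testTime]

theorem one_le_div_of_le {θ : ℕ} (hθ : 0 < θ) (hθn : θ ≤ n) : (1 : ℝ) ≤ n / θ := by
  rw [one_le_div (by exact_mod_cast hθ)]
  exact_mod_cast hθn

/-- There are order E·n/θ cheap trials, and a proportion of order m/(nθ) of them pays for vertex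
tests, about E·m/θ² tests in all. Past the density check θ² ≤ 500nα, so m/θ² is at most 500nαm/θ⁴,
which becomes nα/m at θ = √m. -/
theorem guessTime_le (hE : 1 ≤ E) {θ : ℕ} (hθ : 0 < θ) (hθn : θ ≤ n) :
    (guessTime L α E S l θ : ℝ) ≤ 1000000000 * E * (n / θ)
      + 1000000000 * E * testTime S l * (n * α * G.edgeSet.ncard / (θ : ℝ) ^ 4) := by
  have hn : 0 < n := lt_of_lt_of_le hθ hθn
  have hθ' : (0 : ℝ) < θ := by exact_mod_cast hθ
  have hn' : (0 : ℝ) < n := by exact_mod_cast hn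
  have hE' : (1 : ℝ) ≤ E := by exact_mod_cast hE
  have hQ : (100 : ℝ) ≤ testTime S l := by exact_mod_cast le_testTime S l
  have h1 := one_le_div_of_le hθ hθn
  have hEn : (1 : ℝ) ≤ E * (n / θ) := one_le_mul_of_one_le_of_one_le hE' h1
  rw [guessTime]
  split_ifs with hα
  · have h2 : (0 : ℝ) ≤ 1000000000 * E * testTime S l *
      (n * α * G.edgeSet.ncard / (θ : ℝ) ^ 4) := by positivity
    push_cast
    linarith
  · have hα' : (θ : ℝ) ^ 2 ≤ 500 * n * α := by
      rw [not_lt, ← sq] at hα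
      exact_mod_cast hα
    have htr : (edgeTrials n E (30 * θ) : ℝ) ≤ 11000000 * (E * (n / θ)) := by
      rw [edgeTrials]
      have h3 : ((n / (30 * θ) : ℕ) : ℝ) ≤ (n / θ) / 30 := by
        refine Nat.cast_div_le.trans_eq ?_
        push_cast
        field_simp
      push_cast
      nlinarith
    have hfound : (foundProb L (30 * θ) : ℝ) ≤ G.edgeSet.ncard / (30 * n * θ) := by
      rw [le_div_iff₀ (by positivity)]
      have := foundProb_le (L := L) hn (Θ := 30 * θ) (by omega)
      push_cast at this
      linarith
    have hprod : (edgeTrials n E (30 * θ) : ℝ) * foundProb L (30 * θ)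
        ≤ 400000 * E * (G.edgeSet.ncard / (θ : ℝ) ^ 2) := by
      calc (edgeTrials n E (30 * θ) : ℝ) * foundProb L (30 * θ)
          ≤ 11000000 * (E * (n / θ)) * (G.edgeSet.ncard / (30 * n * θ)) := by gcongr
        _ = 11000000 / 30 * E * (G.edgeSet.ncard / (θ : ℝ) ^ 2) := by field_simp
        _ ≤ _ := by
          gcongr
          norm_num
    have hquart : (G.edgeSet.ncard : ℝ) / (θ : ℝ) ^ 2
        ≤ 500 * (n * α * G.edgeSet.ncard / (θ : ℝ) ^ 4) := by
      rw [← mul_div_assoc, div_le_div_iff₀ (by positivity) (by positivity)]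
      calc (G.edgeSet.ncard : ℝ) * (θ : ℝ) ^ 4
          = G.edgeSet.ncard * (θ : ℝ) ^ 2 * (θ : ℝ) ^ 2 := by ring
        _ ≤ G.edgeSet.ncard * (θ : ℝ) ^ 2 * (500 * n * α) := by gcongr
        _ = _ := by ring
    have hsecond : (edgeTrials n E (30 * θ) : ℝ) * foundProb L (30 * θ) * (2 * testTime S l + 80)
        ≤ 1000000000 * E * testTime S l * (n * α * G.edgeSet.ncard / (θ : ℝ) ^ 4) := by
      calc (edgeTrials n E (30 * θ) : ℝ) * foundProb L (30 * θ) * (2 * testTime S l + 80)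
          ≤ 400000 * E * (500 * (n * α * G.edgeSet.ncard / (θ : ℝ) ^ 4)) * (3 * testTime S l) := by
            refine mul_le_mul (hprod.trans ?_) (by linarith) (by positivity) (by positivity)
            gcongr
        _ = 600000000 * E * testTime S l * (n * α * G.edgeSet.ncard / (θ : ℝ) ^ 4) := by ring
        _ ≤ _ := by
          gcongr
          norm_num
    push_cast
    linarith

theorem coe_searchTime_of_pos {θ : ℕ} (hθ : 0 < θ) : (searchTime L α E S l θ : ℝ)
    = hitTrials n θ * 30 + 50 + (stopProb L θ true * guessTime L α E S l θ +
      stopProb L θ false * searchTime L α E S l (θ / 2)) := by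
  conv_lhs => rw [searchTime, if_neg hθ.ne']
  push_cast
  rfl

theorem hitTime_le (hE : 1 ≤ E) {θ : ℕ} (hθ : 0 < θ) (hθn : θ ≤ n) :
    (hitTrials n θ : ℝ) * 30 + 50 ≤ 1000000 * E * (n / θ) := by
  have h1 := hitTrials_le hθ hθn
  have h2 := one_le_div_of_le hθ hθn
  have hE' : (1 : ℝ) ≤ E := by exact_mod_cast hE
  nlinarith

/-- Below √m the cost bound grows by at most the factor 81 per halving, but going on has probability
at most 1/256. The factor 2 absorbs the rest, since 2 · 81/256 is less than 1. -/
theorem searchTime_le_of_sq_le (hE : 1 ≤ E) (θ : ℕ) : 0 < θ → θ ≤ n →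
    θ ^ 2 ≤ G.edgeSet.ncard →
    (searchTime L α E S l θ : ℝ) ≤ 2 * (1000000000 * E * (n / θ))
      + 2 * (1000000000 * E * testTime S l * (n * α * G.edgeSet.ncard / (θ : ℝ) ^ 4)) := by
  induction θ using Nat.strong_induction_on with
  | _ θ ih =>
    intro hθ hθn hm
    have hn : 0 < n := lt_of_lt_of_le hθ hθn
    have hθ' : (0 : ℝ) < θ := by exact_mod_cast hθ
    have hE' : (1 : ℝ) ≤ E := by exact_mod_cast hE
    have hhit := hitTime_le hE hθ hθn
    have hg := guessTime_le (L := L) (α := α) (S := S) (l := l) hE hθ hθn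
    have hsp := stopProb_false_le (L := L) hθ hn hm
    have hsum := stopProb_add (L := L) hn hθ
    have hs1 : (0 : ℝ) ≤ stopProb L θ false := NNReal.coe_nonneg _
    have hg0 : (0 : ℝ) ≤ guessTime L α E S l θ := NNReal.coe_nonneg _
    have hu0 : (0 : ℝ) ≤ searchTime L α E S l (θ / 2) := NNReal.coe_nonneg _
    have hg' : (stopProb L θ true : ℝ) * guessTime L α E S l θ ≤ 1 * guessTime L α E S l θ :=
      mul_le_mul_of_nonneg_right (by linarith) hg0
    have hu' := mul_le_mul_of_nonneg_right hsp hu0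
    rw [coe_searchTime_of_pos hθ]
    set X : ℝ := E * (n / θ) with hX
    set Y : ℝ := E * testTime S l * (n * α * G.edgeSet.ncard / (θ : ℝ) ^ 4) with hY
    have hX1 : 1 ≤ X := one_le_mul_of_one_le_of_one_le hE' (one_le_div_of_le hθ hθn)
    have hY0 : 0 ≤ Y := by positivity
    have hhalf : (searchTime L α E S l (θ / 2) : ℝ)
        ≤ 2 * (1000000000 * (3 * X)) + 2 * (1000000000 * (81 * Y)) := by
      rcases Nat.eq_zero_or_pos (θ / 2) with h0 | h0
      · rw [h0, searchTime, if_pos rfl]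
        push_cast
        linarith
      · have h2 := ih (θ / 2) (by omega) h0 (by omega)
          ((Nat.pow_le_pow_left (by omega) 2).trans hm)
        have h3 : (θ : ℝ) / 3 ≤ (θ / 2 : ℕ) := by
          have : (θ : ℝ) ≤ 3 * (θ / 2 : ℕ) := by exact_mod_cast le_three_mul_half (by omega)
          linarith
        have h4 : (n : ℝ) / (θ / 2 : ℕ) ≤ 3 * (n / θ) := by
          calc (n : ℝ) / (θ / 2 : ℕ) ≤ n / (θ / 3) := by gcongr
            _ = _ := by field_simp
        have h5 : (n : ℝ) * α * G.edgeSet.ncard / ((θ / 2 : ℕ) : ℝ) ^ 4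
            ≤ 81 * (n * α * G.edgeSet.ncard / (θ : ℝ) ^ 4) := by
          calc (n : ℝ) * α * G.edgeSet.ncard / ((θ / 2 : ℕ) : ℝ) ^ 4
              ≤ n * α * G.edgeSet.ncard / ((θ : ℝ) / 3) ^ 4 := by gcongr
            _ = _ := by
              field_simp
              norm_num
        calc (searchTime L α E S l (θ / 2) : ℝ) ≤ _ := h2
          _ ≤ 2 * (1000000000 * E * (3 * (n / θ))) + 2 * (1000000000 * E * testTime S l *
              (81 * (n * α * G.edgeSet.ncard / (θ : ℝ) ^ 4))) := by gcongr
          _ = _ := by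
            rw [hX, hY]
            ring
    have e1 : 1000000000 * E * ((n : ℝ) / θ) = 1000000000 * X := by rw [hX]; ring
    have e2 : 1000000000 * E * testTime S l * (n * α * G.edgeSet.ncard / (θ : ℝ) ^ 4)
        = 1000000000 * Y := by rw [hY]; ring
    have e3 : 1000000 * E * ((n : ℝ) / θ) = 1000000 * X := by rw [hX]; ring
    rw [e1, e2] at hg ⊢
    rw [e3] at hhit
    linarith

/-- The time bound for guesses that are larger than the square root of the number of edges. -/
theorem searchTime_le_of_lt_sq (hE : 1 ≤ E) (hm : 0 < G.edgeSet.ncard) {r : ℝ} (hr : 0 < r)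
    (hrm : r ^ 2 = G.edgeSet.ncard) {M : ℝ}
    (hM : M = 6 * (1000000000 * E * (n / r))
      + 162 * (1000000000 * E * testTime S l * (n * α / G.edgeSet.ncard))) (θ : ℕ) :
    θ ≤ n → G.edgeSet.ncard < θ ^ 2 → (searchTime L α E S l θ : ℝ)
      ≤ M + 1000000000 * E * (2 * (n / r) - n / θ) := by
  induction θ using Nat.strong_induction_on with
  | _ θ ih =>
    intro hθn hlt
    have hθ2 : 2 ≤ θ := by
      by_contra h
      have : θ ^ 2 ≤ 1 ^ 2 := Nat.pow_le_pow_left (by omega) 2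
      omega
    have hθ : 0 < θ := by omega
    have hn : 0 < n := lt_of_lt_of_le hθ hθn
    have hθ' : (0 : ℝ) < θ := by exact_mod_cast hθ
    have hE' : (1 : ℝ) ≤ E := by exact_mod_cast hE
    have hm' : (0 : ℝ) < G.edgeSet.ncard := by exact_mod_cast hm
    have hrθ : r < θ := by
      refine lt_of_pow_lt_pow_left₀ 2 hθ'.le ?_
      rw [hrm]
      exact_mod_cast hlt
    have hdiv : (n : ℝ) / θ ≤ n / r := by gcongr
    have hhit := hitTime_le hE hθ hθn
    have hhalf0 : 0 < θ / 2 := by omega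
    have hsum := stopProb_add (L := L) hn hθ
    have hs0 : (0 : ℝ) ≤ stopProb L θ true := NNReal.coe_nonneg _
    have hs1 : (0 : ℝ) ≤ stopProb L θ false := NNReal.coe_nonneg _
    -- `B` bounds the cost both of deciding now and of going on with half the guess, because n/θ at
    -- least doubles. The hit counting at θ fits into the remaining difference 1000000000 · E · n/θ,
    -- so the total telescopes.
    set B : ℝ := M + 1000000000 * E * (2 * (n / r) - 2 * (n / θ)) with hB
    have hMB : M ≤ B := by
      have : (0 : ℝ) ≤ 1000000000 * E * (2 * (n / r) - 2 * (n / θ)) :=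
        mul_nonneg (by positivity) (by linarith)
      linarith
    have hg : (guessTime L α E S l θ : ℝ) ≤ B := by
      refine le_trans ?_ hMB
      refine (guessTime_le hE hθ hθn).trans ?_
      have h1 : (n : ℝ) * α * G.edgeSet.ncard / (θ : ℝ) ^ 4 ≤ n * α / G.edgeSet.ncard := by
        calc (n : ℝ) * α * G.edgeSet.ncard / (θ : ℝ) ^ 4
            ≤ n * α * G.edgeSet.ncard / r ^ 4 := by gcongr
          _ = n * α * G.edgeSet.ncard / (r ^ 2 * r ^ 2) := by ring
          _ = _ := by
            rw [hrm]
            field_simp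
      rw [hM]
      have h2 : 1000000000 * E * ((n : ℝ) / θ) ≤ 6 * (1000000000 * E * (n / r)) := by
        have : 1000000000 * E * ((n : ℝ) / θ) ≤ 1000000000 * E * (n / r) := by gcongr
        have h0 : (0 : ℝ) ≤ 1000000000 * E * (n / r) := by positivity
        linarith
      have h3 : 1000000000 * E * testTime S l * (n * α * G.edgeSet.ncard / (θ : ℝ) ^ 4)
          ≤ 162 * (1000000000 * E * testTime S l * (n * α / G.edgeSet.ncard)) := by
        have : 1000000000 * E * testTime S l * (n * α * G.edgeSet.ncard / (θ : ℝ) ^ 4)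
          ≤ 1000000000 * E * testTime S l * (n * α / G.edgeSet.ncard) := by gcongr
        have h0 : (0 : ℝ) ≤ 1000000000 * E * testTime S l * (n * α / G.edgeSet.ncard) := by
          positivity
        linarith
      linarith
    have hu : (searchTime L α E S l (θ / 2) : ℝ) ≤ B := by
      by_cases hle : (θ / 2) ^ 2 ≤ G.edgeSet.ncard
      · refine le_trans ?_ hMB
        refine (searchTime_le_of_sq_le hE (θ / 2) hhalf0 (by omega) hle).trans ?_
        have h3 : r / 3 ≤ (θ / 2 : ℕ) := by
          have : (θ : ℝ) ≤ 3 * (θ / 2 : ℕ) := by exact_mod_cast le_three_mul_half hθ2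
          linarith
        have h4 : (n : ℝ) / (θ / 2 : ℕ) ≤ 3 * (n / r) := by
          calc (n : ℝ) / (θ / 2 : ℕ) ≤ n / (r / 3) := by gcongr
            _ = _ := by field_simp
        have h5 : (n : ℝ) * α * G.edgeSet.ncard / ((θ / 2 : ℕ) : ℝ) ^ 4
            ≤ 81 * (n * α / G.edgeSet.ncard) := by
          calc (n : ℝ) * α * G.edgeSet.ncard / ((θ / 2 : ℕ) : ℝ) ^ 4
              ≤ n * α * G.edgeSet.ncard / (r / 3) ^ 4 := by gcongr
            _ = n * α * G.edgeSet.ncard / (r ^ 2 * r ^ 2 / 81) := by ring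
            _ = _ := by
              rw [hrm]
              field_simp
        calc 2 * (1000000000 * E * ((n : ℝ) / (θ / 2 : ℕ))) + 2 * (1000000000 * E *
              testTime S l * (n * α * G.edgeSet.ncard / ((θ / 2 : ℕ) : ℝ) ^ 4))
            ≤ 2 * (1000000000 * E * (3 * (n / r))) + 2 * (1000000000 * E *
              testTime S l * (81 * (n * α / G.edgeSet.ncard))) := by gcongr
          _ = M := by
            rw [hM]
            ring
      · refine (ih (θ / 2) (by omega) (by omega) (by omega)).trans ?_
        have h9 : ((θ / 2 : ℕ) : ℝ) ≤ θ / 2 := Nat.cast_div_le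
        have h10 : (0 : ℝ) < (θ / 2 : ℕ) := by exact_mod_cast hhalf0
        have h11 : 2 * ((n : ℝ) / θ) ≤ n / (θ / 2 : ℕ) := by
          calc 2 * ((n : ℝ) / θ) = n / (θ / 2) := by field_simp
            _ ≤ _ := by gcongr
        rw [hB]
        gcongr
    rw [coe_searchTime_of_pos hθ]
    have h1 := mul_le_mul_of_nonneg_left hg hs0
    have h2 := mul_le_mul_of_nonneg_left hu hs1
    have h3 : (stopProb L θ true : ℝ) * B + stopProb L θ false * B = B := by
      rw [← add_mul, hsum, one_mul]
    have h4 : (0 : ℝ) ≤ E * (n / θ) := by positivity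
    rw [hB] at h3
    linarith

theorem searchTime_initial_le (hE : 1 ≤ E) (hm : 0 < G.edgeSet.ncard) :
    (searchTime L α E S l n : ℝ) ≤ 8000000000 * E * (n / √(G.edgeSet.ncard : ℝ))
      + 162000000000 * E * testTime S l * (n * α / G.edgeSet.ncard) := by
  have hm' : (0 : ℝ) < G.edgeSet.ncard := by exact_mod_cast hm
  have h1 := searchTime_le_of_lt_sq (L := L) (α := α) (S := S) (l := l) hE hm
    (r := √(G.edgeSet.ncard : ℝ)) (Real.sqrt_pos.mpr hm')
    (Real.sq_sqrt hm'.le) rfl n le_rfl (ncard_edgeSet_lt_sq L hm)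
  have h2 : (0 : ℝ) ≤ 1000000000 * E * (n / n) := by positivity
  linarith

end RunningTime

/-! ### The parameters -/

section Parameters

theorem testTime_le (S i : ℕ) : testTime S i ≤ 100 * (S + 2) ^ (i + 1) := by
  induction i with
  | zero => simp [testTime]
  | succ i ih =>
    have h1 : S + 2 ≤ (S + 2) ^ (i + 1) := Nat.le_self_pow (by omega) _
    have h2 := Nat.mul_le_mul_left S ih
    calc testTime S (i + 1) = 100 + S * (100 + testTime S i) := rfl
      _ ≤ 100 * ((S + 2) ^ (i + 1) * (S + 2)) := by nlinarith
      _ = _ := by rw [← pow_succ]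

theorem two_pow_clog_le {E : ℕ} (hE : 1 ≤ E) : 2 ^ Nat.clog 2 (4 * E) ≤ 8 * E := by
  have h1 : 0 < Nat.clog 2 (4 * E) := Nat.clog_pos (by norm_num) (by omega)
  have h2 := Nat.pow_pred_clog_lt_self (b := 2) (by norm_num) (x := 4 * E) (by omega)
  have h3 : 2 ^ Nat.clog 2 (4 * E) = 2 ^ (Nat.clog 2 (4 * E)).pred * 2 := by
    rw [← pow_succ, ← Nat.succ_eq_add_one, Nat.succ_pred h1.ne']
  omega

/-- Ten times the bit length gives the tenth power of X; seven of the factors, each at least 21,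
absorb the numerical constant, and a cubic bound remains for the numbers in the program. -/
theorem lt_two_pow_wordLength {n α : ℕ} {ε : ℚ} (hden : 20 ≤ ε.den) :
    200000000 * (n + α + ε.den + 1) ^ 3 < 2 ^ wordLength 9 n α ε := by
  set X := n + α + ε.den + 1
  have h1 : X ≤ 2 ^ Nat.size (n + α + ε.den) := Nat.lt_size_self _
  calc 200000000 * X ^ 3 < 21 ^ 7 * X ^ 3 := by
        gcongr
        norm_num
    _ ≤ X ^ 7 * X ^ 3 := by
      gcongr
      omega
    _ = X ^ 10 := by rw [← pow_add]
    _ ≤ (2 ^ Nat.size (n + α + ε.den)) ^ 10 := Nat.pow_le_pow_left h1 10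
    _ = 2 ^ wordLength 9 n α ε := by rw [← pow_mul, wordLength, mul_comm]

theorem fits_of_le {w n α E j X : ℕ} (hn : n + 1 ≤ X) (hα : α ≤ X) (hE : E ≤ X) (hX : 21 ≤ X)
    (hEpos : 1 ≤ E) (hj : 2 ^ j ≤ 8 * E) (hw : 200000000 * X ^ 3 < 2 ^ w) :
    Fits w n α E (1000000 * E * E) (1 + 2 * j) := by
  have hj' : j < 2 ^ j := Nat.lt_two_pow_self
  have h2 : X ≤ X * X := Nat.le_mul_of_pos_right _ (by omega)
  have h3 : X * X ≤ X * X * X := Nat.le_mul_of_pos_right _ (by omega)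
  have hw' : 200000000 * (X * X * X) < 2 ^ w := by rwa [pow_three'] at hw
  have g1 : α * E ≤ X * X := Nat.mul_le_mul hα hE
  have g2 : E * E * n ≤ X * X * X := Nat.mul_le_mul (Nat.mul_le_mul hE hE) (by omega)
  have g3 : α * E * E ≤ X * X * X := Nat.mul_le_mul g1 hE
  have g4 : n * α ≤ X * X := Nat.mul_le_mul (by omega) hα
  have g5 : n * n ≤ X * X := Nat.mul_le_mul (by omega) (by omega)
  have g6 : E * (n + 1) * E ≤ X * X * X := Nat.mul_le_mul (Nat.mul_le_mul hE hn) hE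
  refine ⟨⟨hEpos, by positivity, ?_, ?_, ?_, by omega, by omega⟩, by omega, ?_, by omega, ?_⟩
  · calc 20 * α * E = 20 * (α * E) := by ring
      _ < 2 ^ w := by omega
  · calc 4 * (1000000 * E * E) * n = 4000000 * (E * E * n) := by ring
      _ < 2 ^ w := by omega
  · calc 11 * α * (1000000 * E * E) = 11000000 * (α * E * E) := by ring
      _ < 2 ^ w := by omega
  · calc 500 * n * α = 500 * (n * α) := by ring
      _ < 2 ^ w := by omega
  · calc 200000000 * E * (n + 1) * E = 200000000 * (E * (n + 1) * E) := by ring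
      _ < 2 ^ w := by omega

/-- The number `E` that stands for `1 / ε`. -/
def epsInv (ε : ℚ) : ℕ := ε.den / ε.num.toNat + 1

variable {ε : ℚ}

theorem toNat_num_pos (h0 : 0 < ε) : 0 < ε.num.toNat := by
  have := Rat.num_pos.mpr h0
  omega

theorem cast_eq_div (h0 : 0 < ε) : (ε : ℝ) = (ε.num.toNat : ℝ) / ε.den := by
  have h1 : ((ε.num.toNat : ℤ) : ℝ) = (ε.num : ℝ) := by
    rw [Int.toNat_of_nonneg (Rat.num_pos.mpr h0).le]
  rw [← Int.cast_natCast (R := ℝ) ε.num.toNat, h1]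
  exact_mod_cast (Rat.num_div_den ε).symm

theorem twenty_mul_num_le (h0 : 0 < ε) (h1 : ε ≤ 1 / 20) : 20 * ε.num.toNat ≤ ε.den := by
  have hden : (0 : ℝ) < ε.den := by exact_mod_cast ε.den_pos
  have h2 : (ε : ℝ) ≤ 1 / 20 := by simpa using (Rat.cast_le (K := ℝ)).mpr h1
  rw [cast_eq_div h0, div_le_div_iff₀ hden (by norm_num)] at h2
  have h3 : ε.num.toNat * 20 ≤ 1 * ε.den := by exact_mod_cast h2
  omega

theorem epsInv_ge (h0 : 0 < ε) (h1 : ε ≤ 1 / 20) : 21 ≤ epsInv ε := by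
  have := (Nat.le_div_iff_mul_le (toNat_num_pos h0)).mpr (twenty_mul_num_le h0 h1)
  rw [epsInv]
  omega

/-- This and `one_le_eps_mul` say E - 1 ≤ 1/ε ≤ E: the first is used for the close case and the
running time, the second for the far case. -/
theorem eps_mul_le (h0 : 0 < ε) : (ε : ℝ) * (epsInv ε - 1) ≤ 1 := by
  have hden : (0 : ℝ) < ε.den := by exact_mod_cast ε.den_pos
  have h1 : ε.den / ε.num.toNat * ε.num.toNat ≤ ε.den := Nat.div_mul_le_self _ _
  rw [cast_eq_div h0, epsInv, div_mul_eq_mul_div, div_le_one hden]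
  push_cast
  rw [add_sub_cancel_right, mul_comm]
  exact_mod_cast h1

theorem one_le_eps_mul (h0 : 0 < ε) : 1 ≤ (ε : ℝ) * epsInv ε := by
  have hden : (0 : ℝ) < ε.den := by exact_mod_cast ε.den_pos
  have h1 : ε.den < ε.num.toNat * (ε.den / ε.num.toNat + 1) :=
    Nat.lt_mul_div_succ _ (toNat_num_pos h0)
  rw [cast_eq_div h0, epsInv, div_mul_eq_mul_div, one_le_div hden]
  exact_mod_cast h1.le

/-- With x = 1/ε, the branching S + 2 is at most x⁷ and j is at most 3 log x. The exponent is 2 +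
7(2 + 2j) = 16 + 14j ≤ 58 log x, using log x ≥ 1. -/
theorem epsInv_mul_testTime_le {x : ℝ} (hx : 20 ≤ x) {E : ℕ} (hE : 1 ≤ E)
    (hEx : (E : ℝ) ≤ 1.05 * x) :
    (E : ℝ) * testTime (1000000 * E * E) (1 + 2 * Nat.clog 2 (4 * E))
      ≤ 100 * x ^ (58 * Real.log x) := by
  set j := Nat.clog 2 (4 * E)
  have hx0 : 0 < x := by linarith
  have hx1 : 1 ≤ x := by linarith
  have hlog : 1 ≤ Real.log x := by
    rw [Real.le_log_iff_exp_le hx0]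
    linarith [Real.exp_one_lt_d9]
  have hE2 : (E : ℝ) ≤ x ^ 2 := by nlinarith
  have hS : ((1000000 * E * E + 2 : ℕ) : ℝ) ≤ x ^ 7 := by
    push_cast
    have h1 : (E : ℝ) * E ≤ (1.05 * x) * (1.05 * x) := by gcongr
    have h2 : (20 : ℝ) ^ 5 ≤ x ^ 5 := by gcongr
    have h3 : (20 : ℝ) ^ 5 * x ^ 2 ≤ x ^ 5 * x ^ 2 := by gcongr
    have h4 : x ^ 7 = x ^ 5 * x ^ 2 := by ring
    rw [h4]
    nlinarith
  have hj : (j : ℝ) ≤ 3 * Real.log x := by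
    have h1 : ((2 ^ j : ℕ) : ℝ) ≤ x ^ 2 := by
      have : ((2 ^ j : ℕ) : ℝ) ≤ ((8 * E : ℕ) : ℝ) := by exact_mod_cast two_pow_clog_le hE
      push_cast at this ⊢
      nlinarith
    have h2 := Real.log_le_log (by positivity) h1
    push_cast at h2
    rw [Real.log_pow, Real.log_pow] at h2
    have h3 := Real.log_two_gt_d9
    push_cast at h2
    have h4 : (j : ℝ) * (2 / 3) ≤ j * Real.log 2 := by
      gcongr
      linarith
    linarith
  have hT : (testTime (1000000 * E * E) (1 + 2 * j) : ℝ) ≤ 100 * (x ^ 7) ^ (1 + 2 * j + 1) := by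
    have h1 : (testTime (1000000 * E * E) (1 + 2 * j) : ℝ)
        ≤ ((100 * (1000000 * E * E + 2) ^ (1 + 2 * j + 1) : ℕ) : ℝ) := by
      exact_mod_cast testTime_le _ _
    refine h1.trans ?_
    rw [Nat.cast_mul, Nat.cast_pow]
    push_cast at hS ⊢
    gcongr
  calc (E : ℝ) * testTime (1000000 * E * E) (1 + 2 * j)
      ≤ x ^ 2 * (100 * (x ^ 7) ^ (1 + 2 * j + 1)) := by gcongr
    _ = 100 * x ^ (2 + 7 * (1 + 2 * j + 1)) := by
      rw [← pow_mul, pow_add]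
      ring
    _ = 100 * x ^ ((2 + 7 * (1 + 2 * j + 1) : ℕ) : ℝ) := by rw [Real.rpow_natCast]
    _ ≤ 100 * x ^ (58 * Real.log x) := by
      gcongr
      push_cast
      linarith

end Parameters

/-! ### The main theorem -/

section Main

variable {n : ℕ} {G : SimpleGraph (Fin n)} (L : AdjList G) (α : ℕ) {ε : ℚ}

theorem reach_initial (h0 : 0 < ε) (h1 : ε ≤ 1 / 20) :
    Reach (wordLength 9 n α ε) L [program] [] (initialConfig program n α ε).store
      (searchProb L α (epsInv ε) (1000000 * epsInv ε * epsInv ε)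
        (1 + 2 * Nat.clog 2 (4 * epsInv ε)) n)
      (fun o s' => s'.reg 0 = if o then 1 else 0)
      (searchTime L α (epsInv ε) (1000000 * epsInv ε * epsInv ε)
        (1 + 2 * Nat.clog 2 (4 * epsInv ε)) n + (20 * Nat.clog 2 (4 * epsInv ε) + 80)) := by
  have hE := epsInv_ge h0 h1
  have hnum := toNat_num_pos h0
  have hden := twenty_mul_num_le h0 h1
  have hEden : epsInv ε ≤ ε.den + 1 := by
    rw [epsInv]
    exact Nat.succ_le_succ (Nat.div_le_self _ _)
  have hw := lt_two_pow_wordLength (n := n) (α := α) (ε := ε) (by omega)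
  have hj := two_pow_clog_le (E := epsInv ε) (by omega)
  set X := n + α + ε.den + 1 with hX
  have hw' : 200000000 * (X * X * X) < 2 ^ wordLength 9 n α ε := by rwa [pow_three'] at hw
  have h2 : X ≤ X * X := Nat.le_mul_of_pos_right _ (by omega)
  have h3 : X * X ≤ X * X * X := Nat.le_mul_of_pos_right _ (by omega)
  have g : epsInv ε * epsInv ε ≤ X * X := Nat.mul_le_mul (by omega) (by omega)
  refine reach_program (E := epsInv ε) (num := ε.num.toNat) (den := ε.den) rfl rfl rfl
    (fits_of_le (X := X) (by omega) (by omega) (by omega) (by omega) (by omega) hj hw)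
    (by omega) ?_ (by omega) rfl rfl rfl rfl
  rw [mul_assoc]
  omega

theorem expectedQueries_le_expectedTime (p : Cmd) (b : ℕ) (ε : ℚ) :
    expectedQueries p b L α ε ≤ expectedTime p b L α ε := by
  refine ENNReal.tsum_le_tsum fun t => ENNReal.tsum_le_tsum fun c => ?_
  gcongr
  obtain ⟨l, s⟩ := c
  match l with
  | [] => simp [Config.queryCost]
  | a :: l => cases a <;> simp [Config.queryCost, Config.timeCost]

theorem two_thirds_le_coe {x y : ℝ≥0} (hxy : x + y = 1) (hy : (y : ℝ) ≤ 1 / 3) :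
    (2 / 3 : ℝ≥0∞) ≤ x := by
  have h1 : (x : ℝ) + y = 1 := by exact_mod_cast hxy
  have h2 : (2 / 3 : ℝ≥0) ≤ x := by
    rw [← NNReal.coe_le_coe]
    push_cast
    linarith
  have h3 : (2 / 3 : ℝ≥0∞) = ((2 / 3 : ℝ≥0) : ℝ≥0∞) := by
    rw [ENNReal.coe_div (by norm_num)]
    rfl
  rw [h3]
  exact_mod_cast h2

theorem accept_of_close (h0 : 0 < ε) (h1 : ε ≤ 1 / 20)
    (h : IsCloseToArboricity G (ε : ℝ) α) : 2 / 3 ≤ acceptProb program 9 L α ε := by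
  obtain ⟨H, hHG, hH, hR⟩ := h
  have hE := epsInv_ge h0 h1
  have hsum := sum_searchProb (L := L) (α := α) (E := epsInv ε)
    (S := 1000000 * epsInv ε * epsInv ε) (l := 1 + 2 * Nat.clog 2 (4 * epsInv ε)) (θ := n) le_rfl
  rw [Fintype.sum_bool] at hsum
  refine le_trans (two_thirds_le_coe hsum ?_)
    ((reach_initial L α h0 h1).le_haltFrom true fun s' hs => by simp [hs])
  -- Without edges the search never stops before the guess 0, and the answer is YES with certainty.
  rcases Nat.eq_zero_or_pos G.edgeSet.ncard with hm | hm
  · have h2 := searchProb_true_of_no_edges (L := L) (α := α) (E := epsInv ε)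
      (S := 1000000 * epsInv ε * epsInv ε) (l := 1 + 2 * Nat.clog 2 (4 * epsInv ε)) hm n le_rfl
    rw [← NNReal.coe_inj, NNReal.coe_add, h2] at hsum
    rw [NNReal.coe_one] at hsum
    linarith
  · refine searchProb_false_le hE (Nat.le_pow_clog (by norm_num) _) hm hHG hH ?_
    have hE' : (21 : ℝ) ≤ epsInv ε := by exact_mod_cast hE
    calc ((G.edgeSet \ H.edgeSet).ncard : ℝ) * (epsInv ε - 1)
        ≤ ε * G.edgeSet.ncard * (epsInv ε - 1) :=
          mul_le_mul_of_nonneg_right hR (by linarith)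
      _ = ε * (epsInv ε - 1) * G.edgeSet.ncard := by ring
      _ ≤ 1 * G.edgeSet.ncard := by
        gcongr
        exact eps_mul_le h0
      _ = _ := one_mul _

theorem arboricity_eq_zero_of_ncard (hm : G.edgeSet.ncard = 0) : arboricity G = 0 := by
  have hG : G = ⊥ := by
    rw [Set.ncard_eq_zero (Set.toFinite _)] at hm
    exact SimpleGraph.edgeSet_eq_empty.mp hm
  refine Nat.sInf_eq_zero.mpr (Or.inl ?_)
  refine ⟨fun i => i.elim0, fun i => i.elim0, fun i => i.elim0, ?_⟩
  rw [hG]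
  exact iSup_of_empty _

theorem reject_of_far (h0 : 0 < ε) (h1 : ε ≤ 1 / 20)
    (h : IsFarFromArboricity G (20 * (ε : ℝ)) (3 * α)) : 2 / 3 ≤ rejectProb program 9 L α ε := by
  have hE := epsInv_ge h0 h1
  have hfar : ∀ H ≤ G, arboricity H ≤ 3 * α →
      20 * (G.edgeSet.ncard : ℝ) ≤ ((G.edgeSet \ H.edgeSet).ncard : ℝ) * epsInv ε := by
    intro H hHG hH
    have h2 : 20 * (ε : ℝ) * G.edgeSet.ncard < (G.edgeSet \ H.edgeSet).ncard := by
      by_contra hle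
      exact h ⟨H, hHG, hH, not_lt.mp hle⟩
    calc 20 * (G.edgeSet.ncard : ℝ) = 20 * G.edgeSet.ncard * 1 := (mul_one _).symm
      _ ≤ 20 * G.edgeSet.ncard * (ε * epsInv ε) := by
        gcongr
        exact one_le_eps_mul h0
      _ = 20 * ε * G.edgeSet.ncard * epsInv ε := by ring
      _ ≤ _ := by gcongr
  -- A graph without edges is at distance 0 from itself and has arboricity 0, so it is not far.
  have hm : 0 < G.edgeSet.ncard := by
    refine Nat.pos_of_ne_zero fun hm => h ⟨G, le_rfl, ?_, ?_⟩
    · rw [arboricity_eq_zero_of_ncard hm]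
      exact Nat.zero_le _
    · simp [hm]
  have hsum := sum_searchProb (L := L) (α := α) (E := epsInv ε)
    (S := 1000000 * epsInv ε * epsInv ε) (l := 1 + 2 * Nat.clog 2 (4 * epsInv ε)) (θ := n) le_rfl
  rw [Fintype.sum_bool, add_comm] at hsum
  exact le_trans (two_thirds_le_coe hsum (searchProb_true_le hE hm hfar))
    ((reach_initial L α h0 h1).le_haltFrom false fun s' hs => by simp [hs])

theorem expectedTime_le (h0 : 0 < ε) (h1 : ε ≤ 1 / 20) (hm : 1 ≤ G.edgeSet.ncard) :
    expectedTime program 9 L α ε ≤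
      ENNReal.ofReal (complexityBound 100000000000000 0 58 n G.edgeSet.ncard α (ε : ℝ)) := by
  have hE := epsInv_ge h0 h1
  have hε : (0 : ℝ) < ε := by exact_mod_cast h0
  have hε' : (ε : ℝ) ≤ 1 / 20 := by simpa using (Rat.cast_le (K := ℝ)).mpr h1
  have hx : 20 ≤ 1 / (ε : ℝ) := by
    rw [le_div_iff₀ hε]
    linarith
  have hm' : (0 : ℝ) < G.edgeSet.ncard := by exact_mod_cast hm
  refine (reach_initial L α h0 h1).timeFrom_le.trans ?_
  rw [← ENNReal.ofReal_coe_nnreal]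
  refine ENNReal.ofReal_le_ofReal ?_
  have hEx : (epsInv ε : ℝ) ≤ 1.05 * (1 / ε) := by
    have h2 : (epsInv ε : ℝ) - 1 ≤ 1 / ε := by
      rw [le_div_iff₀ hε, mul_comm]
      exact eps_mul_le h0
    linarith
  have htest := epsInv_mul_testTime_le hx (E := epsInv ε) (by omega) hEx
  have htime := searchTime_initial_le (L := L) (α := α) (E := epsInv ε)
    (S := 1000000 * epsInv ε * epsInv ε) (l := 1 + 2 * Nat.clog 2 (4 * epsInv ε)) (by omega) hm
  have hj : (Nat.clog 2 (4 * epsInv ε) : ℝ) ≤ 8 * epsInv ε := by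
    exact_mod_cast (Nat.lt_two_pow_self.le.trans (two_pow_clog_le (E := epsInv ε) (by omega)))
  have hlog : 1 ≤ Real.log (1 / ε) := by
    rw [Real.le_log_iff_exp_le (by positivity)]
    linarith [Real.exp_one_lt_d9]
  have hE' : (21 : ℝ) ≤ epsInv ε := by exact_mod_cast hE
  set E := epsInv ε
  set j := Nat.clog 2 (4 * E)
  set Q := testTime (1000000 * E * E) (1 + 2 * j)
  -- As n/√m is at least 1, the setup time, which is linear in E, is absorbed by the first term.
  have hA : (1 : ℝ) ≤ n / √(G.edgeSet.ncard : ℝ) := by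
    rw [one_le_div (Real.sqrt_pos.mpr hm')]
    refine Real.sqrt_le_iff.mpr ⟨by positivity, ?_⟩
    exact_mod_cast (ncard_edgeSet_lt_sq L hm).le
  set A := (n : ℝ) / √(G.edgeSet.ncard : ℝ)
  have hElog : (E : ℝ) ≤ 1.05 * (Real.log (1 / ε) / ε) := by
    refine hEx.trans ?_
    gcongr
  have hEA : (E : ℝ) * A ≤ 1.05 * (A * (Real.log (1 / ε) / ε)) := by
    calc (E : ℝ) * A ≤ 1.05 * (Real.log (1 / ε) / ε) * A := by gcongr
      _ = _ := by ring
  have hEA' : (E : ℝ) ≤ E * A := le_mul_of_one_le_right (by linarith) hA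
  have hQ : (E : ℝ) * Q * (n * α / G.edgeSet.ncard)
      ≤ 100 * (1 / ε) ^ (58 * Real.log (1 / ε)) * (n * α / G.edgeSet.ncard) := by gcongr
  have hQ0 : (0 : ℝ) ≤ (1 / ε) ^ (58 * Real.log (1 / ε)) * (n * α / G.edgeSet.ncard) := by
    positivity
  have hA0 : (0 : ℝ) ≤ A * (Real.log (1 / ε) / ε) := by positivity
  rw [complexityBound, pow_zero, mul_one]
  push_cast
  rw [mul_comm ((n : ℝ) * α / _)]
  linarith

end Main

end ArbTest

theorem mainTheorem1 :
    ∃ (p : ArbTest.Cmd) (b : ℕ) (C : ℝ) (k : ℕ) (D : ℝ),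
      ∀ (n : ℕ) (G : SimpleGraph (Fin n)) (L : ArbTest.AdjList G) (α : ℕ) (ε : ℚ),
        0 < ε → ε ≤ 1 / 20 →
          (ArbTest.IsCloseToArboricity G (ε : ℝ) α → 2 / 3 ≤ ArbTest.acceptProb p b L α ε) ∧
          (ArbTest.IsFarFromArboricity G (20 * (ε : ℝ)) (3 * α) → 2 / 3 ≤ ArbTest.rejectProb p b L α ε) ∧
          (1 ≤ G.edgeSet.ncard →
            ArbTest.expectedQueries p b L α ε ≤
              ENNReal.ofReal (ArbTest.complexityBound C k D n G.edgeSet.ncard α (ε : ℝ)) ∧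
            ArbTest.expectedTime p b L α ε ≤
              ENNReal.ofReal (ArbTest.complexityBound C k D n G.edgeSet.ncard α (ε : ℝ))) := by
  -- The power of the logarithm is 0, since the costs of the successive guesses form geometric sums.
  refine ⟨ArbTest.program, 9, 100000000000000, 0, 58, fun n G L α ε h0 h1 =>
    ⟨ArbTest.accept_of_close L α h0 h1, ArbTest.reject_of_far L α h0 h1, fun hm => ⟨?_, ?_⟩⟩⟩
  · exact (ArbTest.expectedQueries_le_expectedTime L α _ _ ε).trans
      (ArbTest.expectedTime_le L α h0 h1 hm)
  · exact ArbTest.expectedTime_le L α h0 h1 hm
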